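/- Conventions. $M$ denotes a closed (compact, without boundary) smooth manifold of dimension $d$ with a smooth Riemannian metric; $\|Df\|=\sup_{x\in M}\|D_xf\|$, with operator norms for this metric. For $C^1$ diffeomorphisms $f,g$ of $M$, $$d_{C^1}(f,g)=\sup_{v\in TM,\ \|v\|\le 1} d_S(Df\,v,Dg\,v)+\sup_{v\in TM,\ \|v\|\le 1} d_S(Df^{-1}v,Dg^{-1}v),$$ where $d_S$ is the distance on $TM$ of the Sasaki metric. For homeomorphisms $f,g$ of $M$ and $X\subset M$, $g$ is a *tidy perturbation of $f$ supported on $X$* if: (1) $g(x)=f(x)$ for all $x\in M\setminus X$; (2) if $x\in M\setminus X$ and $f^m(x)\in M\setminus X$ for some $m\ge1$, then $g^m(x)=f^m(x)$; (3) if $x\in M\setminus X$ and $g^m(x)\in M\setminus X$ for some $m\ge1$, then $g^m(x)=f^m(x)$; (4) for every $x\in M$ there is $m\in\mathbb Z$ with $f^m(x)\notin\overline X$; (5) for every $x\in M$ there is $m\in\mathbb Z$ with $g^m(x)\notin\overline X$. Theorem B' (Large derivative by perturbation). For any $d\ge 1$ and any $C,K,\varepsilon>0$ there exists an integer $n_0=n_0(d,C,K,\varepsilon)\ge1$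 with the following property. Let $f$ be any $C^1$ diffeomorphism of a closed Riemannian manifold $M$ of dimension $d$ with $\|Df\|,\|Df^{-1}\|<C$, let $n\ge n_0$, and set $N=2^{d+1}n$. Then there exists $\rho_0>0$ such that for any open set $U\subset M$ of diameter $<\rho_0$ for which - the sets $\overline U,f(\overline U),\dots,f^{N-1}(\overline U)$ are pairwise disjoint, and - every $x\in M$ has an iterate $f^m(x)$, $m\in\mathbb Z$, outside the closure of $U\cup f(U)\cup\dots\cup f^{N-1}(U)$ (this holds for instance if $f^N(\overline U)$ is also disjoint from $\overline U,\dots,f^{N-1}(\overline U)$), and for any compact set $\Delta\subset U$, there exists a $C^1$ diffeomorphism $g$ of $M$ such that - $d_{C^1}(f,g)<\varepsilon$; - $g$ is a tidy perturbation of $f$ supported on $U\cup f(U)\cup\dots\cup f^{N-1}(U)$; - for every $x\in\Delta$ there exists $j\in\{0,\dots,N-n\}$ such that $$\max\{\|Dg^n(g^j(x))\|,\ \|Dg^{-n}(g^{j+n}(x))\|\}>K.$$ -/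

import Mathlib

open Set Bundle
open scoped Manifold ContDiff Bundle ENNReal

noncomputable section

/-! ### Tidy perturbations -/

/-- `g` is a tidy perturbation of the homeomorphism `f`, supported on `X`. -/
structure IsTidyPerturbation {M : Type*} [TopologicalSpace M] (f g : M ≃ₜ M) (X : Set M) :
    Prop where
  eq_off : ∀ x ∉ X, g x = f x
  eq_of_return : ∀ x ∉ X, ∀ m : ℕ, 1 ≤ m → f^[m] x ∉ X → g^[m] x = f^[m] x
  eq_of_return' : ∀ x ∉ X, ∀ m : ℕ, 1 ≤ m → g^[m] x ∉ X → g^[m] x = f^[m] x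
  exit : ∀ x, ∃ m : ℤ, (f ^ m) x ∉ closure X
  exit' : ∀ x, ∃ m : ℤ, (g ^ m) x ∉ closure X

/-! ### The Sasaki distance on the tangent bundle of a Riemannian manifold -/

section Sasaki

variable {d : ℕ} {M : Type*} [TopologicalSpace M] [ChartedSpace (EuclideanSpace ℝ (Fin d)) M]
  [IsManifold (𝓡 d) ∞ M] [RiemannianBundle (fun x : M => TangentSpace (𝓡 d) x)]

/-- The vector of `T M` at the point with coordinates `z`, whose coordinates in the chart around
`p` are `u`. -/
def chartVector (p : M) (z u : EuclideanSpace ℝ (Fin d)) :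
    TangentSpace (𝓡 d) ((extChartAt (𝓡 d) p).symm z) :=
  mfderiv 𝓘(ℝ, EuclideanSpace ℝ (Fin d)) (𝓡 d) (extChartAt (𝓡 d) p).symm z u

/-- The Riemannian metric in the coordinates of the chart around `p`. -/
def chartMetric (p : M) (z u v : EuclideanSpace ℝ (Fin d)) : ℝ :=
  inner ℝ (chartVector p z u) (chartVector p z v)

/-- The Christoffel symbols of the first kind of the Levi-Civita connection, in the coordinates of
the chart around `p`: this is `⟨∇_u v, w⟩` at `z`, for vector fields `u, v, w` that are constant in
these coordinates. -/
def chartChristoffel (p : M) (z u v w : EuclideanSpace ℝ (Fin d)) : ℝ :=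
  (fderiv ℝ (fun y => chartMetric p y v w) z u + fderiv ℝ (fun y => chartMetric p y u w) z v
    - fderiv ℝ (fun y => chartMetric p y u v) z w) / 2

/-- `a` is the covariant derivative of a vector field along a curve, all in the coordinates of the
chart around `p`: the curve is at `z` with velocity `z'`, the field is `v` with derivative `v'`. -/
def IsChartCovDeriv (p : M) (z z' v v' a : EuclideanSpace ℝ (Fin d)) : Prop :=
  ∀ w, chartMetric p z a w = chartMetric p z v' w + chartChristoffel p z z' v w

/-- There is a `C¹` curve in `T M` from `u` to `w`, lying over the domain of one chart, whose length
for the Sasaki metric is `ℓ`. In the coordinates of the chart the curve is `t ↦ (c t, v t)`, the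
covariant derivative of `v` along `c` is `a`, and the square of the Sasaki norm of the velocity is
the sum of the squares of the norms of `c'` and `a`. -/
def SasakiArc (u w : TangentBundle (𝓡 d) M) (ℓ : ℝ≥0∞) : Prop :=
  ∃ (p : M) (c v a : ℝ → EuclideanSpace ℝ (Fin d)),
    ContDiff ℝ 1 c ∧ ContDiff ℝ 1 v ∧
    (∀ t ∈ Icc (0 : ℝ) 1, c t ∈ (extChartAt (𝓡 d) p).target) ∧
    (⟨_, chartVector p (c 0) (v 0)⟩ : TangentBundle (𝓡 d) M) = u ∧
    (⟨_, chartVector p (c 1) (v 1)⟩ : TangentBundle (𝓡 d) M) = w ∧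
    (∀ t ∈ Icc (0 : ℝ) 1, IsChartCovDeriv p (c t) (deriv c t) (v t) (deriv v t) (a t)) ∧
    ℓ = ∫⁻ t in Icc (0 : ℝ) 1, ENNReal.ofReal
      (Real.sqrt (‖chartVector p (c t) (deriv c t)‖ ^ 2 + ‖chartVector p (c t) (a t)‖ ^ 2))

/-- There is a piecewise `C¹` curve in `T M` from `u` to `w` whose Sasaki length is `ℓ`. -/
inductive SasakiPath : TangentBundle (𝓡 d) M → TangentBundle (𝓡 d) M → ℝ≥0∞ → Prop
  | refl (u : TangentBundle (𝓡 d) M) : SasakiPath u u 0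
  | step {u v w : TangentBundle (𝓡 d) M} {ℓ ℓ' : ℝ≥0∞} :
      SasakiPath u v ℓ → SasakiArc v w ℓ' → SasakiPath u w (ℓ + ℓ')

/-- The distance on `T M` of the Sasaki metric (infinite between different components). -/
def sasakiEDist (u w : TangentBundle (𝓡 d) M) : ℝ≥0∞ :=
  sInf {ℓ | SasakiPath u w ℓ}

/-- The supremum of the Sasaki distances between `Df v` and `Dg v`, for `v` in the unit ball bundle
of `T M`. -/
def c1EDistAux (f g : M → M) : ℝ≥0∞ :=
  ⨆ (v : TangentBundle (𝓡 d) M) (_ : ‖v.2‖ ≤ 1),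
    sasakiEDist (tangentMap (𝓡 d) (𝓡 d) f v) (tangentMap (𝓡 d) (𝓡 d) g v)

/-- The `C¹` distance on the group of `C¹` diffeomorphisms of `M`; it takes the inverses into
account. -/
def c1EDist (f g : M ≃ₘ^1⟮𝓡 d, 𝓡 d⟯ M) : ℝ≥0∞ :=
  c1EDistAux (d := d) f g + c1EDistAux (d := d) f.symm g.symm

end Sasaki

/-- The union `U ∪ f(U) ∪ ⋯ ∪ f^(N-1)(U)`. -/
def iteratesUnion {M : Type*} (f : M → M) (U : Set M) (N : ℕ) : Set M :=
  ⋃ i ∈ Finset.range N, f^[i] '' U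

end

/-!
The statement is local: by a Lebesgue number argument, it suffices to perturb `f` over small open
sets `U` near each point `q`, read in one chart around `q`. The perturbation `g` follows the
orbits of `f` along the tower `U, f(U), …, f^(N-1)(U)` up to diffeomorphisms of `U`: it maps
`f^i (F i z)` to `f^(i+1) (F (i+1) z)`, where `F i` is supported in `U` and is the identity at
both ends of the tower, which makes `g` tidy (`IsTowerPerturbation`). The maps
`F i z = z + s χ(z) σ_i(ℓ z / s) v` are shears in one direction `v`, cut off by `χ`. As the scale
`s` tends to zero, the terms of their derivatives which contain the derivative of `χ` disappear,
however thin `U` is around `Δ`, and the others do not depend on the scale. The `C¹` cost of the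
perturbation is then governed by the differences `σ_{i+1}' - σ_i'`, weighted by the norms of
`Df^i` at `q` (`ShearProfile.exists_diffeomorph`, `exists_forall_sasakiEDist_shear_le`). Over `Δ`
the derivative of `g^i` is the one of `f^i` composed with `w ↦ w + σ_i'(t) ℓ(w) v`, where the
phase `t` depends on the point and is not under control (`ShearProfile.exists_perturbation`). Out
of two profiles which differ by a shift, such as `sin` and `cos`, one at least has a derivative of
the desired kind at `t`; this is why two windows of length `n` are used one after the other, one
for each profile.

At a point `q` where `f` itself has no large derivative, the norms of `Df^i` and `Df^(i+n)` are
comparable. There are two cases. If some `Df^a`, with `a` bounded, distorts the ratio of the norms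
of two vectors a lot, a small shear inserted at once at time `a` adds to the vector which has been
expanded the most by `Df^a` a multiple of the other one; this is a small change at time `a`, but a
large one at the ends of the windows, where the ratio of the two norms is again as it was at time
`0` (`isPerturbableAt_of_distortion`). Otherwise the distortion is bounded, and a strong shear can
be inserted slowly, at times `0, …, m - 1`, the cost being divided by `m`
(`isPerturbableAt_of_bounded_distortion`). The profile is then the displacement of the projective
action of `diag (Λ, 1)`, a circle diffeomorphism which contracts one half of the circle by a
factor at least `Λ / 2`. In all cases the length of the windows depends only on the constants.
-/

open scoped Topology

set_option linter.unusedSectionVars false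

/-! ### Tangent maps of maps defined on the model space -/

section TangentMaps

/-- The model space of a `d`-dimensional manifold. -/
abbrev Euc (d : ℕ) := EuclideanSpace ℝ (Fin d)

variable {d : ℕ} {M : Type*} [TopologicalSpace M] [ChartedSpace (Euc d) M]
  [IsManifold (𝓡 d) ∞ M]

/-- The derivative at `z` of a map `θ` from the model space to `M`, as a linear map on the model
space. -/
noncomputable def tderiv (θ : Euc d → M) (z : Euc d) :
    Euc d →ₗ[ℝ] TangentSpace (𝓡 d) (θ z) :=
  (mfderiv 𝓘(ℝ, Euc d) (𝓡 d) θ z).toLinearMap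

/-- The image of the vector `w` at `z` under the tangent map of a map `θ` from the model space. -/
noncomputable def tmap (θ : Euc d → M) (z w : Euc d) :
    TangentBundle (𝓡 d) M :=
  ⟨θ z, tderiv θ z w⟩

theorem tmap_comp {g : M → M} {θ : Euc d → M} {z : Euc d}
    (hg : MDifferentiableAt (𝓡 d) (𝓡 d) g (θ z))
    (hθ : MDifferentiableAt 𝓘(ℝ, Euc d) (𝓡 d) θ z)
    (w : Euc d) :
    tmap (g ∘ θ) z w = tangentMap (𝓡 d) (𝓡 d) g (tmap θ z w) := by
  unfold tmap tangentMap tderiv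
  rw [mfderiv_comp z hg hθ]
  rfl

theorem tmap_comp_right {θ : Euc d → M}
    {F : Euc d → Euc d} {z : Euc d}
    (hθ : MDifferentiableAt 𝓘(ℝ, Euc d) (𝓡 d) θ (F z))
    (hF : DifferentiableAt ℝ F z) (w : Euc d) :
    tmap (θ ∘ F) z w = tmap θ (F z) (fderiv ℝ F z w) := by
  unfold tmap tderiv
  rw [mfderiv_comp z hθ hF.mdifferentiableAt, mfderiv_eq_fderiv]
  rfl

theorem tmap_congr {θ θ' : Euc d → M} {z : Euc d}
    (h : θ =ᶠ[𝓝 z] θ') (w : Euc d) : tmap θ z w = tmap θ' z w := by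
  unfold tmap tderiv
  have := h.mfderiv_eq (I := 𝓘(ℝ, Euc d)) (I' := 𝓡 d)
  have h2 := h.eq_of_nhds
  congr 1
  rw [this]; rfl

theorem continuousOn_tmap {θ : Euc d → M} {O : Set (Euc d)}
    (hO : IsOpen O) (hθ : ContMDiffOn 𝓘(ℝ, Euc d) (𝓡 d) 1 θ O) :
    ContinuousOn (fun x : Euc d × Euc d =>
      tmap θ x.1 x.2) (O ×ˢ univ) := by
  have h1 := hθ.continuousOn_tangentMapWithin le_rfl hO.uniqueMDiffOn
  have h2 : Continuous (fun x : Euc d × Euc d =>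
      (⟨x.1, x.2⟩ : TangentBundle 𝓘(ℝ, Euc d) (Euc d))) :=
    (tangentBundleModelSpaceHomeomorph 𝓘(ℝ, Euc d)).symm.continuous
  have h3 := h1.comp (s := O ×ˢ univ) h2.continuousOn (fun x hx => hx.1)
  refine h3.congr ?_
  rintro ⟨z, w⟩ ⟨hz, -⟩
  unfold tmap tderiv
  simp only [Function.comp, tangentMapWithin]
  rw [mfderivWithin_of_isOpen hO hz]
  rfl

variable [RiemannianBundle (fun x : M => TangentSpace (𝓡 d) x)]

theorem norm_smul_tangent (x : M) (r : ℝ) (u : TangentSpace (𝓡 d) x) : ‖r • u‖ = |r| * ‖u‖ :=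
  norm_smul r u

theorem norm_add_tangent_le (x : M) (u u' : TangentSpace (𝓡 d) x) : ‖u + u'‖ ≤ ‖u‖ + ‖u'‖ :=
  norm_add_le u u'

theorem norm_tmap_smul (θ : Euc d → M) (z w : Euc d) (r : ℝ) :
    ‖(tmap θ z (r • w)).2‖ = |r| * ‖(tmap θ z w).2‖ := by
  simp only [tmap, map_smul]
  exact norm_smul_tangent _ _ _

theorem norm_tmap_add_le (θ : Euc d → M) (z w w' : Euc d) :
    ‖(tmap θ z (w + w')).2‖ ≤ ‖(tmap θ z w).2‖ + ‖(tmap θ z w').2‖ := by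
  simp only [tmap, map_add]
  exact norm_add_tangent_le _ _ _

theorem continuous_norm_snd [IsContinuousRiemannianBundle (Euc d)
      (fun x : M => TangentSpace (𝓡 d) x)] :
    Continuous (fun u : TangentBundle (𝓡 d) M => ‖u.2‖) := by
  have : Continuous (fun u : TangentBundle (𝓡 d) M => inner ℝ u.2 u.2) :=
    Continuous.inner_bundle (F := Euc d) (b := fun u : TangentBundle (𝓡 d) M => u.1)
      (v := fun u => u.2) (w := fun u => u.2) continuous_id continuous_id
  have h2 := this.sqrt
  refine h2.congr fun u => ?_
  rw [real_inner_self_eq_norm_sq, Real.sqrt_sq (norm_nonneg _)]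

end TangentMaps

/-! ### Upper bounds for the Sasaki distance -/

section SasakiDistance

variable {d : ℕ} {M : Type*} [TopologicalSpace M] [ChartedSpace (Euc d) M]
  [IsManifold (𝓡 d) ∞ M] [RiemannianBundle (fun x : M => TangentSpace (𝓡 d) x)]

theorem SasakiPath.trans {u v w : TangentBundle (𝓡 d) M} {ℓ ℓ' : ℝ≥0∞} (h : SasakiPath u v ℓ)
    (h' : SasakiPath v w ℓ') : SasakiPath u w (ℓ + ℓ') := by
  induction h' with
  | refl => simpa using h
  | step _ ha ih => rw [← add_assoc]; exact ih.step ha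

theorem sasakiEDist_self (u : TangentBundle (𝓡 d) M) : sasakiEDist u u = 0 :=
  le_antisymm (sInf_le (SasakiPath.refl u)) zero_le

theorem sasakiEDist_triangle (u v w : TangentBundle (𝓡 d) M) :
    sasakiEDist u w ≤ sasakiEDist u v + sasakiEDist v w := by
  unfold sasakiEDist
  rw [ENNReal.sInf_add]
  simp only [ENNReal.add_sInf]
  refine le_iInf₂ fun a ha => le_iInf₂ fun b hb => sInf_le (SasakiPath.trans ha hb)

theorem SasakiArc.sasakiEDist_le {u w : TangentBundle (𝓡 d) M} {ℓ : ℝ≥0∞} (h : SasakiArc u w ℓ) :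
    sasakiEDist u w ≤ ℓ := by
  have := (SasakiPath.refl u).step h
  rw [zero_add] at this
  exact sInf_le this

/-- The coordinates of tangent vectors of `M` at a point of the domain of a chart. -/
noncomputable def chartCoord (p : M) (x : M) (u : TangentSpace (𝓡 d) x) : Euc d :=
  mfderiv (𝓡 d) 𝓘(ℝ, Euc d) (extChartAt (𝓡 d) p) x u

theorem chartCoord_chartVector {p : M} {z : Euc d} (hz : z ∈ (extChartAt (𝓡 d) p).target)
    (w : Euc d) : chartCoord p _ (chartVector p z w) = w := by
  have := mfderiv_extChartAt_comp_mfderivWithin_extChartAt_symm hz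
  rw [show range (𝓡 d) = univ from by simp, mfderivWithin_univ] at this
  exact DFunLike.congr_fun this w

theorem chartVector_chartCoord {p : M} {z : Euc d} (hz : z ∈ (extChartAt (𝓡 d) p).target)
    (u : TangentSpace (𝓡 d) ((extChartAt (𝓡 d) p).symm z)) :
    chartVector p z (chartCoord p _ u) = u := by
  have := mfderivWithin_extChartAt_symm_comp_mfderiv_extChartAt hz
  rw [show range (𝓡 d) = univ from by simp, mfderivWithin_univ] at this
  exact DFunLike.congr_fun this u

theorem chartVector_sub (p : M) (z u v : Euc d) :
    chartVector p z (u - v) = chartVector p z u - chartVector p z v :=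
  (tderiv (extChartAt (𝓡 d) p).symm z).map_sub u v

theorem chartVector_zero (p : M) (z : Euc d) : chartVector p z 0 = 0 :=
  (tderiv (extChartAt (𝓡 d) p).symm z).map_zero

/-- The Riemannian metric in the coordinates of a chart, as a bilinear form. -/
noncomputable def chartForm (p : M) (z : Euc d) : Euc d →ₗ[ℝ] Euc d →ₗ[ℝ] ℝ :=
  (innerₗ (TangentSpace (𝓡 d) ((extChartAt (𝓡 d) p).symm z))).compl₁₂
    (tderiv (extChartAt (𝓡 d) p).symm z) (tderiv (extChartAt (𝓡 d) p).symm z)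

theorem chartMetric_eq (p : M) (z u v : Euc d) : chartMetric p z u v = chartForm p z u v := rfl

theorem chartMetric_self (p : M) (z u : Euc d) : chartMetric p z u u = ‖chartVector p z u‖ ^ 2 :=
  real_inner_self_eq_norm_sq _

/-- Moving a tangent vector inside its fibre costs at most the norm of the difference. -/
theorem sasakiEDist_vertical (x : M) (u w : TangentSpace (𝓡 d) x) :
    sasakiEDist (⟨x, u⟩ : TangentBundle (𝓡 d) M) ⟨x, w⟩ ≤ ENNReal.ofReal ‖w - u‖ := by
  have key : ∀ (p x : M) (hx : x ∈ (extChartAt (𝓡 d) p).source) (u w : TangentSpace (𝓡 d) x),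
      sasakiEDist (⟨x, u⟩ : TangentBundle (𝓡 d) M) ⟨x, w⟩ ≤ ENNReal.ofReal ‖w - u‖ := by
    clear u w x
    intro p x hx u w
    obtain ⟨z, hz, rfl⟩ : ∃ z ∈ (extChartAt (𝓡 d) p).target, (extChartAt (𝓡 d) p).symm z = x :=
      ⟨_, (extChartAt (𝓡 d) p).map_source hx, (extChartAt (𝓡 d) p).left_inv hx⟩
    rw [← chartVector_chartCoord hz u, ← chartVector_chartCoord hz w, ← chartVector_sub]
    set a := chartCoord p _ u
    set b := chartCoord p _ w
    refine SasakiArc.sasakiEDist_le ⟨p, fun _ => z, fun t => a + t • (b - a), fun _ => b - a,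
      contDiff_const, by fun_prop, fun _ _ => hz, by simp, by simp, ?_, ?_⟩
    · intro t _ w'
      have h1 : deriv (fun t : ℝ => a + t • (b - a)) t = b - a := by
        have : HasDerivAt (fun t : ℝ => a + t • (b - a)) ((1 : ℝ) • (b - a)) t :=
          ((hasDerivAt_id t).smul_const _).const_add a
        simpa using this.deriv
      have h2 : ∀ (y v : Euc d), chartMetric p y 0 v = 0 := by
        intro y v; rw [chartMetric_eq, map_zero]; rfl
      rw [h1, deriv_const]
      simp [chartChristoffel, h2]
    · have h0 : ‖chartVector p z 0‖ = 0 := by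
        rw [chartVector_zero]
        exact norm_zero (E := TangentSpace (𝓡 d) _)
      have h1 : ∀ x y : ℝ, x = 0 → 0 ≤ y → √(x ^ 2 + y ^ 2) = y := by
        intro x y hx hy
        rw [hx, zero_pow two_ne_zero, zero_add, Real.sqrt_sq hy]
      simp only [deriv_const, MeasureTheory.lintegral_const, MeasureTheory.Measure.restrict_apply,
        MeasurableSet.univ, univ_inter,
        Real.volume_Icc, sub_zero, ENNReal.ofReal_one, mul_one]
      have h2 : ∀ (x : M) (u : TangentSpace (𝓡 d) x), 0 ≤ ‖u‖ := fun x u => norm_nonneg u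
      rw [h1 _ _ h0 (h2 _ (chartVector p z (b - a)))]
  exact key x x (mem_extChartAt_source x) u w

end SasakiDistance

/-! ### Continuity of the metric in charts -/

section SasakiLocal

variable {d : ℕ} {M : Type*} [TopologicalSpace M] [ChartedSpace (Euc d) M]
  [IsManifold (𝓡 d) ∞ M] [RiemannianBundle (fun x : M => TangentSpace (𝓡 d) x)]

theorem isContMDiffRiemannianBundle_one
    [IsContMDiffRiemannianBundle (𝓡 d) ∞ (Euc d) (fun x : M => TangentSpace (𝓡 d) x)] :
    IsContMDiffRiemannianBundle (𝓡 d) 1 (Euc d) (fun x : M => TangentSpace (𝓡 d) x) :=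
  IsContMDiffRiemannianBundle.of_le (n := ∞) (by norm_cast)

theorem isContinuousRiemannianBundle_of_contMDiff
    [h : IsContMDiffRiemannianBundle (𝓡 d) 1 (Euc d) (fun x : M => TangentSpace (𝓡 d) x)] :
    IsContinuousRiemannianBundle (Euc d) (fun x : M => TangentSpace (𝓡 d) x) := by
  obtain ⟨g, hg, hg'⟩ := h.exists_contMDiff
  exact ⟨g, hg.continuous, hg'⟩

variable [IsContMDiffRiemannianBundle (𝓡 d) 1 (Euc d) (fun x : M => TangentSpace (𝓡 d) x)]
  [IsContinuousRiemannianBundle (Euc d) (fun x : M => TangentSpace (𝓡 d) x)]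

theorem continuousOn_norm_tmap {θ : Euc d → M} {O : Set (Euc d)} (hO : IsOpen O)
    (hθ : ContMDiffOn 𝓘(ℝ, Euc d) (𝓡 d) 1 θ O) :
    ContinuousOn (fun x : Euc d × Euc d => ‖(tmap θ x.1 x.2).2‖) (O ×ˢ univ) :=
  continuous_norm_snd.comp_continuousOn (continuousOn_tmap hO hθ)

theorem contDiffOn_chartMetric (p : M) (u v : Euc d) :
    ContDiffOn ℝ 1 (fun z => chartMetric p z u v) (extChartAt (𝓡 d) p).target := by
  have hO := isOpen_extChartAt_target (I := 𝓡 d) p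
  have key : ∀ w : Euc d, ContMDiffOn 𝓘(ℝ, Euc d) ((𝓡 d).prod 𝓘(ℝ, Euc d)) 1
      (fun z => (⟨(extChartAt (𝓡 d) p).symm z, chartVector p z w⟩ : TangentBundle (𝓡 d) M))
      (extChartAt (𝓡 d) p).target := by
    intro w
    have h1 : ContMDiffOn 𝓘(ℝ, Euc d) (𝓡 d) ∞ (extChartAt (𝓡 d) p).symm
      (extChartAt (𝓡 d) p).target := contMDiffOn_extChartAt_symm p
    have h2 := h1.contMDiffOn_tangentMapWithin (m := 1) (by norm_cast) hO.uniqueMDiffOn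
    have h3 : ContMDiff 𝓘(ℝ, Euc d) (𝓘(ℝ, Euc d).prod 𝓘(ℝ, Euc d)) 1
        (fun z : Euc d => (⟨z, w⟩ : TangentBundle 𝓘(ℝ, Euc d) (Euc d))) := by
      intro z
      exact contMDiffAt_vectorSpace_iff_contDiffAt.2 contDiffAt_const
    refine (h2.comp h3.contMDiffOn (fun z hz => hz)).congr ?_
    intro z hz
    simp only [Function.comp, tangentMapWithin]
    rw [mfderivWithin_of_isOpen hO hz]
    rfl
  have := ContMDiffOn.inner_bundle (F := Euc d) (IB := 𝓡 d) (key u) (key v)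
  exact this.contDiffOn

end SasakiLocal

/-! ### Local control of the Sasaki distance -/

theorem exists_upper_bound_of_homogeneous {E : Type*} [NormedAddCommGroup E] [NormedSpace ℝ E]
    [ProperSpace E] {K : Set E} (hK : IsCompact K) {N : E × E → ℝ}
    (hN : ContinuousOn N (K ×ˢ univ)) (hs : ∀ z w (r : ℝ), N (z, r • w) = |r| * N (z, w)) :
    ∃ L > 0, ∀ z ∈ K, ∀ w, N (z, w) ≤ L * ‖w‖ := by
  obtain ⟨L, hL⟩ := (hK.prod (isCompact_sphere (0 : E) 1)).bddAbove_image
    (hN.mono (prod_mono_right (subset_univ _)))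
  refine ⟨max L 1, by positivity, fun z hz w => ?_⟩
  rcases eq_or_ne w 0 with rfl | hw
  · have := hs z 0 0
    simp only [smul_zero, abs_zero, zero_mul] at this
    simp [this]
  · have h1 := hs z (‖w‖⁻¹ • w) ‖w‖
    rw [smul_smul, mul_inv_cancel₀ (norm_ne_zero_iff.2 hw), one_smul, abs_norm] at h1
    have h2 : N (z, ‖w‖⁻¹ • w) ≤ L := hL ⟨_, ⟨hz, by simp [norm_smul, hw]⟩, rfl⟩
    rw [h1, mul_comm]
    exact mul_le_mul_of_nonneg_right (h2.trans (le_max_left _ _)) (norm_nonneg _)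

theorem exists_lower_bound_of_homogeneous {E : Type*} [NormedAddCommGroup E] [NormedSpace ℝ E]
    [ProperSpace E] {K : Set E} (hK : IsCompact K) {N : E × E → ℝ}
    (hN : ContinuousOn N (K ×ˢ univ)) (hs : ∀ z w (r : ℝ), N (z, r • w) = |r| * N (z, w))
    (hpos : ∀ z ∈ K, ∀ w, w ≠ 0 → 0 < N (z, w)) :
    ∃ c > 0, ∀ z ∈ K, ∀ w, c * ‖w‖ ≤ N (z, w) := by
  have hc := hK.prod (isCompact_sphere (0 : E) 1)
  have key : ∃ c > 0, ∀ x ∈ K ×ˢ Metric.sphere (0 : E) 1, c ≤ N x := by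
    rcases (K ×ˢ Metric.sphere (0 : E) 1).eq_empty_or_nonempty with h | h
    · exact ⟨1, one_pos, by simp [h]⟩
    · obtain ⟨x, hx, hx'⟩ := hc.exists_isMinOn h (hN.mono (prod_mono_right (subset_univ _)))
      refine ⟨N x, hpos x.1 hx.1 x.2 ?_, fun y hy => hx' hy⟩
      exact ne_zero_of_mem_unit_sphere ⟨x.2, hx.2⟩
  obtain ⟨c, hc0, hc⟩ := key
  refine ⟨c, hc0, fun z hz w => ?_⟩
  rcases eq_or_ne w 0 with rfl | hw
  · have := hs z 0 0
    simp only [smul_zero, abs_zero, zero_mul] at this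
    simp [this]
  · have h1 := hs z (‖w‖⁻¹ • w) ‖w‖
    rw [smul_smul, mul_inv_cancel₀ (norm_ne_zero_iff.2 hw), one_smul, abs_norm] at h1
    have h2 : c ≤ N (z, ‖w‖⁻¹ • w) := hc _ ⟨hz, by simp [norm_smul, hw]⟩
    rw [h1, mul_comm c]
    exact mul_le_mul_of_nonneg_left h2 (norm_nonneg _)

section SasakiLocal

variable {d : ℕ} {M : Type*} [TopologicalSpace M] [ChartedSpace (Euc d) M]
  [IsManifold (𝓡 d) ∞ M] [RiemannianBundle (fun x : M => TangentSpace (𝓡 d) x)]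
  [IsContMDiffRiemannianBundle (𝓡 d) 1 (Euc d) (fun x : M => TangentSpace (𝓡 d) x)]
  [IsContinuousRiemannianBundle (Euc d) (fun x : M => TangentSpace (𝓡 d) x)]

theorem norm_chartVector_pos {p : M} {z : Euc d} (hz : z ∈ (extChartAt (𝓡 d) p).target)
    {w : Euc d} (hw : w ≠ 0) : 0 < ‖chartVector p z w‖ := by
  have key : ∀ (x : M) (u : TangentSpace (𝓡 d) x), u ≠ 0 → 0 < ‖u‖ := fun x u => norm_pos_iff.2
  refine key _ _ fun h => hw ?_
  rw [← chartCoord_chartVector hz w, h]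
  exact map_zero _

theorem exists_norm_chartVector_bounds (p : M) {K : Set (Euc d)} (hK : IsCompact K)
    (hKt : K ⊆ (extChartAt (𝓡 d) p).target) :
    ∃ L > 0, ∃ c > 0, ∀ z ∈ K, ∀ w, ‖chartVector p z w‖ ≤ L * ‖w‖ ∧
      c * ‖w‖ ≤ ‖chartVector p z w‖ := by
  have h1 := (continuousOn_norm_tmap (isOpen_extChartAt_target p)
    (contMDiffOn_extChartAt_symm (I := 𝓡 d) (n := 1) p)).mono
    (prod_mono_left (t := (univ : Set (Euc d))) hKt)
  obtain ⟨L, hL0, hL⟩ := exists_upper_bound_of_homogeneous hK h1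
    (fun z w r => norm_tmap_smul _ z w r)
  obtain ⟨c, hc0, hc⟩ := exists_lower_bound_of_homogeneous hK h1
    (fun z w r => norm_tmap_smul _ z w r) (fun z hz w hw => norm_chartVector_pos (hKt hz) hw)
  exact ⟨L, hL0, c, hc0, fun z hz w => ⟨hL z hz w, hc z hz w⟩⟩

theorem differentiableAt_chartMetric {p : M} {z : Euc d} (hz : z ∈ (extChartAt (𝓡 d) p).target)
    (u v : Euc d) : DifferentiableAt ℝ (fun y => chartMetric p y u v) z :=
  ((contDiffOn_chartMetric p u v).contDiffAt
    ((isOpen_extChartAt_target p).mem_nhds hz)).differentiableAt one_ne_zero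

theorem fderiv_chartMetric_eq_sum {p : M} {z : Euc d} (hz : z ∈ (extChartAt (𝓡 d) p).target)
    (u v : Euc d) : fderiv ℝ (fun y => chartMetric p y u v) z =
      ∑ i, ∑ j, (u i * v j) • fderiv ℝ (fun y => chartMetric p y (EuclideanSpace.single i 1)
        (EuclideanSpace.single j 1)) z := by
  have hexp : ∀ u : Euc d, u = ∑ i, u i • EuclideanSpace.single i (1 : ℝ) := by
    intro u
    simpa using ((EuclideanSpace.basisFun (Fin d) ℝ).sum_repr u).symm
  have h1 : (fun y => chartMetric p y u v) = fun y => ∑ i, ∑ j, (u i * v j) *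
      chartMetric p y (EuclideanSpace.single i 1) (EuclideanSpace.single j 1) := by
    funext y
    simp only [chartMetric_eq]
    conv_lhs => rw [hexp u, hexp v]
    simp only [map_sum, map_smul, LinearMap.sum_apply, LinearMap.smul_apply, smul_eq_mul,
      Finset.mul_sum]
    rw [Finset.sum_comm]
    refine Finset.sum_congr rfl fun i _ => Finset.sum_congr rfl fun j _ => by ring
  rw [h1]
  refine HasFDerivAt.fderiv ?_
  refine HasFDerivAt.fun_sum fun i _ => HasFDerivAt.fun_sum fun j _ => ?_
  exact (differentiableAt_chartMetric hz _ _).hasFDerivAt.const_mul _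

theorem exists_fderiv_chartMetric_bound (p : M) {K : Set (Euc d)} (hK : IsCompact K)
    (hKt : K ⊆ (extChartAt (𝓡 d) p).target) :
    ∃ L > 0, ∀ z ∈ K, ∀ h u v : Euc d,
      |fderiv ℝ (fun y => chartMetric p y u v) z h| ≤ L * (‖h‖ * ‖u‖ * ‖v‖) := by
  have h1 : ∀ i j : Fin d, ∃ B, ∀ z ∈ K, ‖fderiv ℝ (fun y => chartMetric p y
      (EuclideanSpace.single i 1) (EuclideanSpace.single j 1)) z‖ ≤ B := by
    intro i j
    have := ((contDiffOn_chartMetric p (EuclideanSpace.single i 1)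
      (EuclideanSpace.single j 1)).continuousOn_fderiv_of_isOpen
      (isOpen_extChartAt_target p) le_rfl).mono hKt
    exact hK.exists_bound_of_continuousOn this
  choose B hB using h1
  refine ⟨(∑ i, ∑ j, |B i j|) + 1, by positivity, fun z hz h u v => ?_⟩
  rw [fderiv_chartMetric_eq_sum (hKt hz)]
  simp only [sum_apply, smul_apply, smul_eq_mul]
  have h2 : ∀ i j : Fin d, |u i * v j * (fderiv ℝ (fun y => chartMetric p y
      (EuclideanSpace.single i 1) (EuclideanSpace.single j 1)) z) h| ≤
      |B i j| * (‖h‖ * ‖u‖ * ‖v‖) := by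
    intro i j
    rw [abs_mul, abs_mul]
    have a1 : |u i| ≤ ‖u‖ := PiLp.norm_apply_le u i
    have a2 : |v j| ≤ ‖v‖ := PiLp.norm_apply_le v j
    have a3 := (ContinuousLinearMap.le_opNorm (fderiv ℝ (fun y => chartMetric p y
      (EuclideanSpace.single i 1) (EuclideanSpace.single j 1)) z) h).trans
      (mul_le_mul_of_nonneg_right ((hB i j z hz).trans (le_abs_self _)) (norm_nonneg h))
    rw [Real.norm_eq_abs] at a3
    calc _ ≤ ‖u‖ * ‖v‖ * (|B i j| * ‖h‖) := by gcongr
      _ = _ := by ring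
  calc _ ≤ ∑ i, ∑ j, |B i j| * (‖h‖ * ‖u‖ * ‖v‖) :=
        (Finset.abs_sum_le_sum_abs _ _).trans (Finset.sum_le_sum fun i _ =>
          (Finset.abs_sum_le_sum_abs _ _).trans (Finset.sum_le_sum fun j _ => h2 i j))
    _ = (∑ i, ∑ j, |B i j|) * (‖h‖ * ‖u‖ * ‖v‖) := by
        simp only [Finset.sum_mul]
    _ ≤ _ := by gcongr; linarith

theorem exists_isChartCovDeriv {p : M} {z : Euc d} (hz : z ∈ (extChartAt (𝓡 d) p).target)
    (z' v v' : Euc d) : ∃ a, IsChartCovDeriv p z z' v v' a := by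
  have hinj : Function.Injective (chartForm p z) := by
    refine (injective_iff_map_eq_zero _).2 fun u hu => ?_
    by_contra hne
    have h1 : chartMetric p z u u = 0 := by rw [chartMetric_eq, hu]; rfl
    rw [chartMetric_self] at h1
    have := norm_chartVector_pos hz hne
    exact this.ne' (pow_eq_zero_iff two_ne_zero |>.1 h1)
  have hsurj : Function.Surjective (chartForm p z) :=
    (LinearMap.injective_iff_surjective_of_finrank_eq_finrank
      (Subspace.dual_finrank_eq (K := ℝ) (V := Euc d)).symm).1 hinj
  let lam : Euc d →ₗ[ℝ] ℝ :=
    { toFun := fun w => chartMetric p z v' w + chartChristoffel p z z' v w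
      map_add' := by
        intro w w'
        have e1 : ∀ u, fderiv ℝ (fun y => chartMetric p y u (w + w')) z
            = fderiv ℝ (fun y => chartMetric p y u w) z
              + fderiv ℝ (fun y => chartMetric p y u w') z := by
          intro u
          simp only [chartMetric_eq, map_add]
          exact fderiv_fun_add (differentiableAt_chartMetric hz u w)
            (differentiableAt_chartMetric hz u w')
        have e2 : chartMetric p z v' (w + w') = chartMetric p z v' w + chartMetric p z v' w' := by
          simp only [chartMetric_eq, map_add]
        simp only [chartChristoffel, e1, e2, map_add, add_apply]
        ring
      map_smul' := by
        intro r w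
        have e1 : ∀ u, fderiv ℝ (fun y => chartMetric p y u (r • w)) z
            = r • fderiv ℝ (fun y => chartMetric p y u w) z := by
          intro u
          simp only [chartMetric_eq, map_smul, smul_eq_mul]
          exact fderiv_const_mul (differentiableAt_chartMetric hz u w) r
        have e2 : chartMetric p z v' (r • w) = r * chartMetric p z v' w := by
          simp only [chartMetric_eq, map_smul, smul_eq_mul]
        simp only [chartChristoffel, e1, e2, map_smul, smul_eq_mul, smul_apply, RingHom.id_apply]
        ring }
  obtain ⟨a, ha⟩ := hsurj lam
  exact ⟨a, fun w => by rw [chartMetric_eq, ha]; rfl⟩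

theorem norm_covDeriv_le {p : M} {z : Euc d} {L c B : ℝ} (hc : 0 < c) (hB : 0 ≤ B)
    (hL : ∀ w, ‖chartVector p z w‖ ≤ L * ‖w‖) (hl : ∀ w, c * ‖w‖ ≤ ‖chartVector p z w‖)
    (hD : ∀ h u v : Euc d,
      |fderiv ℝ (fun y => chartMetric p y u v) z h| ≤ B * (‖h‖ * ‖u‖ * ‖v‖))
    {z' v v' a : Euc d} (ha : IsChartCovDeriv p z z' v v' a) :
    ‖chartVector p z a‖ ≤ L * ‖v'‖ + 2 * B / c * (‖z'‖ * ‖v‖) := by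
  have h1 := ha a
  rw [chartMetric_self] at h1
  have nn : ∀ (x : M) (u : TangentSpace (𝓡 d) x), 0 ≤ ‖u‖ := fun x u => norm_nonneg u
  have cs : ∀ (x : M) (u w : TangentSpace (𝓡 d) x), inner ℝ u w ≤ ‖u‖ * ‖w‖ :=
    fun x u w => real_inner_le_norm u w
  have h2 : chartMetric p z v' a ≤ L * ‖v'‖ * ‖chartVector p z a‖ :=
    (cs _ _ _).trans (mul_le_mul_of_nonneg_right (hL v') (nn _ _))
  have h3 : chartChristoffel p z z' v a ≤ 2 * B * (‖z'‖ * ‖v‖) * ‖a‖ := by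
    have d1 := (abs_le.1 (hD z' v a)).2
    have d2 := (abs_le.1 (hD v z' a)).2
    have d3 := (abs_le.1 (hD a z' v)).1
    have : 0 ≤ B * (‖z'‖ * ‖v‖ * ‖a‖) := by positivity
    unfold chartChristoffel
    nlinarith
  have h4 : ‖a‖ ≤ ‖chartVector p z a‖ / c := by
    rw [le_div_iff₀ hc, mul_comm]; exact hl a
  have h5 : 2 * B * (‖z'‖ * ‖v‖) * ‖a‖ ≤
      2 * B / c * (‖z'‖ * ‖v‖) * ‖chartVector p z a‖ := by
    calc _ ≤ 2 * B * (‖z'‖ * ‖v‖) * (‖chartVector p z a‖ / c) := by gcongr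
      _ = _ := by ring
  rcases (nn _ (chartVector p z a)).eq_or_lt with h0 | h0
  · rw [← h0]
    have := hL v'
    have := nn _ (chartVector p z v')
    have : 0 ≤ 2 * B / c * (‖z'‖ * ‖v‖) := by positivity
    linarith
  · refine le_of_mul_le_mul_right ?_ h0
    nlinarith

/-- In a chart, the Sasaki distance is controlled by the distance of the coordinates. -/
theorem exists_sasakiEDist_bound (p : M) {K : Set (Euc d)} (hK : IsCompact K) (hconv : Convex ℝ K)
    (hKt : K ⊆ (extChartAt (𝓡 d) p).target) :
    ∃ L > 0, ∀ z ∈ K, ∀ z' ∈ K, ∀ u u' : Euc d,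
      sasakiEDist (tmap (extChartAt (𝓡 d) p).symm z u) (tmap (extChartAt (𝓡 d) p).symm z' u') ≤
        ENNReal.ofReal (L * (‖z' - z‖ + ‖u' - u‖ + ‖z' - z‖ * (‖u‖ + ‖u'‖))) := by
  obtain ⟨L, hL0, c, hc, hLc⟩ := exists_norm_chartVector_bounds p hK hKt
  obtain ⟨B, hB0, hB⟩ := exists_fderiv_chartMetric_bound p hK hKt
  refine ⟨L + 2 * B / c, by positivity, fun z hz z' hz' u u' => ?_⟩
  set γ : ℝ → Euc d := fun t => z + t • (z' - z) with hγ
  set v : ℝ → Euc d := fun t => u + t • (u' - u) with hv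
  have hγK : ∀ t ∈ Icc (0 : ℝ) 1, γ t ∈ K := fun t ht => hconv.add_smul_sub_mem hz hz' ht
  have hder : ∀ (x y : Euc d) (t : ℝ), deriv (fun t : ℝ => x + t • (y - x)) t = y - x := by
    intro x y t
    have : HasDerivAt (fun t : ℝ => x + t • (y - x)) ((1 : ℝ) • (y - x)) t :=
      ((hasDerivAt_id t).smul_const _).const_add x
    simpa using this.deriv
  have hcov : ∀ t, ∃ a, t ∈ Icc (0 : ℝ) 1 →
      IsChartCovDeriv p (γ t) (deriv γ t) (v t) (deriv v t) a := by
    intro t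
    by_cases ht : t ∈ Icc (0 : ℝ) 1
    · obtain ⟨a, ha⟩ := exists_isChartCovDeriv (hKt (hγK t ht)) (deriv γ t) (v t) (deriv v t)
      exact ⟨a, fun _ => ha⟩
    · exact ⟨0, fun h => absurd h ht⟩
  choose a ha using hcov
  have g0 : γ 0 = z := by simp [hγ]
  have g1 : γ 1 = z' := by simp [hγ]
  have v0 : v 0 = u := by simp [hv]
  have v1 : v 1 = u' := by simp [hv]
  refine (SasakiArc.sasakiEDist_le ⟨p, γ, v, a, by fun_prop, by fun_prop,
    fun t ht => hKt (hγK t ht), by rw [g0, v0]; rfl, by rw [g1, v1]; rfl, ha, rfl⟩).trans ?_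
  have hbd : ∀ t ∈ Icc (0 : ℝ) 1, ENNReal.ofReal (Real.sqrt
      (‖chartVector p (γ t) (deriv γ t)‖ ^ 2 + ‖chartVector p (γ t) (a t)‖ ^ 2)) ≤
      ENNReal.ofReal ((L + 2 * B / c) * (‖z' - z‖ + ‖u' - u‖ + ‖z' - z‖ * (‖u‖ + ‖u'‖))) := by
    intro t ht
    refine ENNReal.ofReal_le_ofReal ?_
    have nn : ∀ (x : M) (u : TangentSpace (𝓡 d) x), 0 ≤ ‖u‖ := fun x u => norm_nonneg u
    have hs : ∀ x y : ℝ, 0 ≤ x → 0 ≤ y → √(x ^ 2 + y ^ 2) ≤ x + y := by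
      intro x y hx hy
      refine Real.sqrt_le_iff.2 ⟨by positivity, by nlinarith⟩
    refine (hs _ _ (nn _ _) (nn _ _)).trans ?_
    have e1 := (hLc _ (hγK t ht) (deriv γ t)).1
    have e2 := norm_covDeriv_le hc hB0.le (fun w => (hLc _ (hγK t ht) w).1)
      (fun w => (hLc _ (hγK t ht) w).2) (hB _ (hγK t ht)) (ha t ht)
    rw [hder z z' t] at e1 e2
    rw [hder u u' t] at e2
    have e3 : ‖v t‖ ≤ ‖u‖ + ‖u'‖ := by
      have : v t = (1 - t) • u + t • u' := by simp only [hv]; module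
      rw [this]
      refine (norm_add_le _ _).trans ?_
      rw [norm_smul, norm_smul, Real.norm_of_nonneg ht.1, Real.norm_of_nonneg (by linarith [ht.2])]
      nlinarith [norm_nonneg u, norm_nonneg u', ht.1, ht.2]
    have e4 : 2 * B / c * (‖z' - z‖ * ‖v t‖) ≤ 2 * B / c * (‖z' - z‖ * (‖u‖ + ‖u'‖)) := by gcongr
    have e5 : 0 ≤ 2 * B / c := by positivity
    have p1 := norm_nonneg (z' - z)
    have p2 := norm_nonneg (u' - u)
    have p3 : 0 ≤ ‖z' - z‖ * (‖u‖ + ‖u'‖) := by positivity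
    have q1 := mul_nonneg e5 p1
    have q2 := mul_nonneg e5 p2
    have q3 := mul_nonneg hL0.le p3
    rw [hder z z' t]
    linarith
  refine (MeasureTheory.setLIntegral_mono' measurableSet_Icc hbd).trans ?_
  simp

/-- The Sasaki distance is continuous on the diagonal. -/
theorem eventually_sasakiEDist_lt (u₀ : TangentBundle (𝓡 d) M) {η : ℝ} (hη : 0 < η) :
    ∀ᶠ x : TangentBundle (𝓡 d) M × TangentBundle (𝓡 d) M in 𝓝 (u₀, u₀),
      sasakiEDist x.1 x.2 < ENNReal.ofReal η := by
  set p := u₀.1 with hp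
  have ht := isOpen_extChartAt_target (I := 𝓡 d) p
  set z₀ := extChartAt (𝓡 d) p p
  have hz₀ : z₀ ∈ (extChartAt (𝓡 d) p).target := mem_extChartAt_target p
  obtain ⟨r, hr, hrt⟩ := Metric.nhds_basis_closedBall.mem_iff.1 (ht.mem_nhds hz₀)
  obtain ⟨L, hL0, hL⟩ := exists_sasakiEDist_bound p (isCompact_closedBall z₀ r)
    (convex_closedBall z₀ r) hrt
  set e : TangentBundle (𝓡 d) M → Euc d × Euc d :=
    fun u => (extChartAt (𝓡 d) p u.1, chartCoord p u.1 u.2) with he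
  have hsrc : IsOpen (extChartAt (𝓡 d) p).source := isOpen_extChartAt_source p
  have hmem : (π (Euc d) (TangentSpace (𝓡 d)) ⁻¹' (extChartAt (𝓡 d) p).source) ∈ 𝓝 u₀ := by
    refine (hsrc.preimage (FiberBundle.continuous_proj (Euc d) _)).mem_nhds ?_
    exact mem_extChartAt_source p
  have hecont : ContinuousAt e u₀ := by
    have h1 : ContMDiffOn (𝓡 d) 𝓘(ℝ, Euc d) 1 (extChartAt (𝓡 d) p) (extChartAt (𝓡 d) p).source := by
      rw [extChartAt_source]; exact contMDiffOn_extChartAt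
    have h2 := (h1.continuousOn_tangentMapWithin le_rfl hsrc.uniqueMDiffOn).continuousAt hmem
    have h3 := ((tangentBundleModelSpaceHomeomorph 𝓘(ℝ, Euc d)).continuous.continuousAt).comp h2
    refine h3.congr ?_
    filter_upwards [hmem] with u hu
    simp only [Function.comp, he, tangentMapWithin]
    rw [mfderivWithin_of_isOpen hsrc hu]
    rfl
  have hcont : ContinuousAt (fun x : TangentBundle (𝓡 d) M × TangentBundle (𝓡 d) M =>
      L * (‖(e x.2).1 - (e x.1).1‖ + ‖(e x.2).2 - (e x.1).2‖ +
        ‖(e x.2).1 - (e x.1).1‖ * (‖(e x.1).2‖ + ‖(e x.2).2‖))) (u₀, u₀) := by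
    have c1 : ContinuousAt (fun x : TangentBundle (𝓡 d) M × TangentBundle (𝓡 d) M => e x.1)
      (u₀, u₀) := ContinuousAt.comp (g := e) (f := Prod.fst) (x := (u₀, u₀)) hecont continuousAt_fst
    have c2 : ContinuousAt (fun x : TangentBundle (𝓡 d) M × TangentBundle (𝓡 d) M => e x.2)
      (u₀, u₀) := ContinuousAt.comp (g := e) (f := Prod.snd) (x := (u₀, u₀)) hecont continuousAt_snd
    fun_prop
  have hlt := hcont.eventually_lt (continuousAt_const (y := η)) (by simpa using hη)
  have hball : ∀ᶠ u in 𝓝 u₀, (e u).1 ∈ Metric.closedBall z₀ r :=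
    hecont.fst.eventually (Metric.closedBall_mem_nhds z₀ hr)
  have hgood : ∀ᶠ u in 𝓝 u₀, (e u).1 ∈ Metric.closedBall z₀ r ∧
      u = tmap (extChartAt (𝓡 d) p).symm (e u).1 (e u).2 := by
    filter_upwards [hball, hmem] with u hu hu'
    refine ⟨hu, ?_⟩
    have key : ∀ (x : M) (hx : x ∈ (extChartAt (𝓡 d) p).source) (w : TangentSpace (𝓡 d) x),
        (⟨x, w⟩ : TangentBundle (𝓡 d) M) =
          tmap (extChartAt (𝓡 d) p).symm (extChartAt (𝓡 d) p x) (chartCoord p x w) := by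
      intro x hx w
      obtain ⟨z, hz, rfl⟩ : ∃ z ∈ (extChartAt (𝓡 d) p).target, (extChartAt (𝓡 d) p).symm z = x :=
        ⟨_, (extChartAt (𝓡 d) p).map_source hx, (extChartAt (𝓡 d) p).left_inv hx⟩
      rw [(extChartAt (𝓡 d) p).right_inv hz]
      have := chartVector_chartCoord hz w
      conv_lhs => rw [← this]
      rfl
    exact key u.1 hu' u.2
  rw [nhds_prod_eq] at hlt ⊢
  filter_upwards [hlt, hgood.prod_inl _, hgood.prod_inr _] with x h1 h2 h3
  rw [h2.2, h3.2]
  refine (hL _ h2.1 _ h3.1 _ _).trans_lt ?_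
  exact (ENNReal.ofReal_lt_ofReal_iff hη).2 h1

end SasakiLocal

/-! ### Tidy perturbations of a tower -/

section Tidy

variable {M : Type*} [TopologicalSpace M]

theorem mem_iteratesUnion {f : M → M} {U : Set M} {N : ℕ} {x : M} :
    x ∈ iteratesUnion f U N ↔ ∃ i < N, ∃ y ∈ U, f^[i] y = x := by
  simp [iteratesUnion]

theorem Homeomorph.image_iterate_closure (f : M ≃ₜ M) (U : Set M) (i : ℕ) :
    f^[i] '' closure U = closure (f^[i] '' U) := by
  induction i with
  | zero => simp
  | succ i ih =>
    rw [Function.iterate_succ', image_comp, ih, f.image_closure, image_comp]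

theorem closure_iteratesUnion (f : M ≃ₜ M) (U : Set M) (N : ℕ) :
    closure (iteratesUnion f U N) = iteratesUnion f (closure U) N := by
  unfold iteratesUnion
  rw [Finset.closure_biUnion]
  simp only [f.image_iterate_closure]

/-- The orbit of `x` under `g` meets the complement of `S`. -/
def OrbitLeaves (g : M ≃ₜ M) (S : Set M) (x : M) : Prop := ∃ m : ℤ, (g ^ m) x ∉ S

theorem OrbitLeaves.of_apply {g : M ≃ₜ M} {S : Set M} {x : M} (h : OrbitLeaves g S (g x)) :
    OrbitLeaves g S x := by
  obtain ⟨m, hm⟩ := h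
  refine ⟨m + 1, ?_⟩
  rwa [zpow_add_one]

theorem OrbitLeaves.apply {g : M ≃ₜ M} {S : Set M} {x : M} (h : OrbitLeaves g S x) :
    OrbitLeaves g S (g x) := by
  obtain ⟨m, hm⟩ := h
  refine ⟨m - 1, ?_⟩
  have : (g ^ (m - 1)) (g x) = (g ^ (m - 1) * g) x := rfl
  rwa [this, ← zpow_add_one, sub_add_cancel]

theorem OrbitLeaves.of_iterate {g : M ≃ₜ M} {S : Set M} (i : ℕ) {x : M}
    (h : OrbitLeaves g S (g^[i] x)) : OrbitLeaves g S x := by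
  induction i generalizing x with
  | zero => exact h
  | succ i ih => exact OrbitLeaves.of_apply (ih h)

theorem OrbitLeaves.iterate {g : M ≃ₜ M} {S : Set M} (i : ℕ) {x : M}
    (h : OrbitLeaves g S x) : OrbitLeaves g S (g^[i] x) := by
  induction i generalizing x with
  | zero => exact h
  | succ i ih => exact ih h.apply

theorem OrbitLeaves.exists_iterate {f : M ≃ₜ M} {S : Set M} {x : M} (h : OrbitLeaves f S x) :
    ∃ m : ℕ, f^[m] x ∉ S ∨ f.symm^[m] x ∉ S := by
  have key : ∀ (g : M ≃ₜ M) (m : ℕ), (g ^ m) x = g^[m] x := by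
    intro g m
    induction m with
    | zero => rfl
    | succ m ih => rw [pow_succ', Function.iterate_succ', Function.comp, ← ih]; rfl
  obtain ⟨m, hm⟩ := h
  obtain ⟨k, rfl | rfl⟩ := m.eq_nat_or_neg
  · refine ⟨k, Or.inl ?_⟩
    rwa [zpow_natCast, key] at hm
  · refine ⟨k, Or.inr ?_⟩
    rw [zpow_neg, zpow_natCast, ← inv_pow] at hm
    rwa [← key f.symm k]

variable {f g : M ≃ₜ M} {U : Set M} {N : ℕ}

/-- A homeomorphism which follows `f`, up to a permutation of `U`, on `U, f(U), …, f^(N-1)(U)`,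
and whose `N`-th iterate is the one of `f` on `U`, is a tidy perturbation of `f`. -/
theorem isTidyPerturbation_of_return (hN : 1 ≤ N)
    (hdisj : ∀ i < N, ∀ j < N, i ≠ j → Disjoint (f^[i] '' closure U) (f^[j] '' closure U))
    (hexit : ∀ x, ∃ m : ℤ, (f ^ m) x ∉ closure (iteratesUnion f U N))
    (hoff : ∀ x ∉ iteratesUnion f U N, g x = f x)
    (hin : ∀ x ∈ U, ∀ i < N, g^[i] x ∈ f^[i] '' U)
    (hsurj : ∀ x ∈ U, ∀ i < N, ∃ y ∈ U, g^[i] y = f^[i] x)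
    (hret : ∀ x ∈ U, g^[N] x = f^[N] x) :
    IsTidyPerturbation f g (iteratesUnion f U N) := by
  set X := iteratesUnion f U N with hX
  have hsub : U ⊆ closure U := subset_closure
  have hmem : ∀ x ∈ U, ∀ i < N, f^[i] x ∈ X := fun x hx i hi => mem_iteratesUnion.2 ⟨i, hi, x, hx, rfl⟩
  -- two points of the closed tower on different levels are different
  have hne : ∀ i < N, ∀ j < N, ∀ x ∈ closure U, ∀ y ∈ closure U, f^[i] x = f^[j] y → i = j := by
    intro i hi j hj x hx y hy hxy
    by_contra hij
    exact Set.disjoint_left.1 (hdisj i hi j hj hij) ⟨x, hx, rfl⟩ ⟨y, hy, hxy.symm⟩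
  have henter : ∀ x ∉ X, f x ∉ X ∨ f x ∈ U := by
    intro x hx
    by_cases h : f x ∈ X
    · obtain ⟨i, hi, y, hy, hyx⟩ := mem_iteratesUnion.1 h
      rcases i with _ | i
      · right; rw [← hyx]; exact hy
      · exfalso
        rw [Function.iterate_succ_apply'] at hyx
        rw [← f.injective hyx] at hx
        exact hx (hmem y hy i (by omega))
    · exact Or.inl h
  have hleave : ∀ x ∈ U, f^[N] x ∉ X ∨ f^[N] x ∈ U := by
    intro x hx
    by_cases h : f^[N] x ∈ X
    · obtain ⟨i, hi, y, hy, hyx⟩ := mem_iteratesUnion.1 h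
      rcases i with _ | i
      · right; rw [← hyx]; exact hy
      · exfalso
        obtain ⟨N', rfl⟩ : ∃ N', N = N' + 1 := ⟨N - 1, by omega⟩
        rw [Function.iterate_succ_apply', Function.iterate_succ_apply'] at hyx
        have := hne i (by omega) N' (by omega) y (hsub hy) x (hsub hx) (f.injective hyx)
        omega
    · exact Or.inl h
  refine ⟨hoff, ?_, ?_, hexit, ?_⟩
  · have key : ∀ m : ℕ, ∀ x, (x ∉ X ∨ x ∈ U) → f^[m] x ∉ X → g^[m] x = f^[m] x := by
      intro m
      induction m using Nat.strong_induction_on with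
      | _ m ih =>
        intro x hx hm
        rcases hx with hx | hx
        · rcases m with _ | m
          · rfl
          · rw [Function.iterate_succ_apply, Function.iterate_succ_apply, hoff x hx]
            exact ih m (by omega) _ (henter x hx) hm
        · have hmN : N ≤ m := by
            by_contra h
            exact hm (hmem x hx m (by omega))
          obtain ⟨k, rfl⟩ := Nat.exists_eq_add_of_le' hmN
          rw [Function.iterate_add_apply] at hm ⊢
          rw [Function.iterate_add_apply, hret x hx]
          exact ih k (by omega) _ (hleave x hx) hm
    exact fun x hx m _ => key m x (Or.inl hx)
  · have key : ∀ m : ℕ, ∀ x, (x ∉ X ∨ x ∈ U) → g^[m] x ∉ X → g^[m] x = f^[m] x := by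
      intro m
      induction m using Nat.strong_induction_on with
      | _ m ih =>
        intro x hx hm
        rcases hx with hx | hx
        · rcases m with _ | m
          · rfl
          · rw [Function.iterate_succ_apply] at hm
            rw [Function.iterate_succ_apply, Function.iterate_succ_apply]
            rw [hoff x hx] at hm ⊢
            exact ih m (by omega) _ (henter x hx) hm
        · have hmN : N ≤ m := by
            by_contra h
            obtain ⟨y, hy, hyx⟩ := hin x hx m (by omega)
            exact hm (hyx ▸ hmem y hy m (by omega))
          obtain ⟨k, rfl⟩ := Nat.exists_eq_add_of_le' hmN
          rw [Function.iterate_add_apply] at hm ⊢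
          rw [Function.iterate_add_apply]
          rw [hret x hx] at hm ⊢
          exact ih k (by omega) _ (hleave x hx) hm
    exact fun x hx m _ => key m x (Or.inl hx)
  · -- points of the boundary of `U` follow their `f`-orbits
    have hbd : ∀ x ∈ closure U, x ∉ U → ∀ i ≤ N, g^[i] x = f^[i] x := by
      intro x hx hxU i
      induction i with
      | zero => intro _; rfl
      | succ i ih =>
        intro hi
        rw [Function.iterate_succ_apply', Function.iterate_succ_apply', ih (by omega)]
        refine hoff _ fun h => ?_
        obtain ⟨j, hj, y, hy, hyx⟩ := mem_iteratesUnion.1 h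
        obtain rfl := hne j hj i (by omega) y (hsub hy) x hx hyx
        exact hxU (f.injective.iterate j hyx ▸ hy)
    have hret' : ∀ x ∈ closure U, g^[N] x = f^[N] x := by
      intro x hx
      by_cases hxU : x ∈ U
      · exact hret x hxU
      · exact hbd x hx hxU N le_rfl
    have hcl : ∀ x, x ∈ closure X ↔ ∃ i < N, ∃ y ∈ closure U, f^[i] y = x := by
      intro x
      rw [hX, closure_iteratesUnion]; exact mem_iteratesUnion
    have hfwd : ∀ m : ℕ, ∀ x ∈ closure U, f^[m] x ∉ closure X → OrbitLeaves g (closure X) x := by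
      intro m
      induction m using Nat.strong_induction_on with
      | _ m ih =>
        intro x hx hm
        have hmN : N ≤ m := by
          by_contra h
          exact hm ((hcl _).2 ⟨m, by omega, x, hx, rfl⟩)
        obtain ⟨k, rfl⟩ := Nat.exists_eq_add_of_le' hmN
        rw [Function.iterate_add_apply] at hm
        refine OrbitLeaves.of_iterate N ?_
        rw [hret' x hx]
        by_cases h : f^[N] x ∈ closure X
        · obtain ⟨i, hi, y, hy, hyx⟩ := (hcl _).1 h
          rcases i with _ | i
          · refine ih k (by omega) _ ?_ hm
            rw [← hyx]; exact hy
          · exfalso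
            obtain ⟨N', rfl⟩ : ∃ N', N = N' + 1 := ⟨N - 1, by omega⟩
            rw [Function.iterate_succ_apply', Function.iterate_succ_apply'] at hyx
            have := hne i (by omega) N' (by omega) y hy x hx (f.injective hyx)
            omega
        · exact ⟨0, h⟩
    have hbwd : ∀ m : ℕ, ∀ x ∈ closure U, f.symm^[m] x ∉ closure X →
        OrbitLeaves g (closure X) x := by
      intro m
      induction m using Nat.strong_induction_on with
      | _ m ih =>
        intro x hx hm
        have hm0 : m ≠ 0 := by
          rintro rfl
          exact hm ((hcl _).2 ⟨0, by omega, x, hx, rfl⟩)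
        by_cases h : f.symm x ∈ closure X
        · obtain ⟨j, hj, y, hy, hyx⟩ := (hcl _).1 h
          have hyx' : f^[j + 1] y = x := by
            rw [Function.iterate_succ_apply', hyx, f.apply_symm_apply]
          have hjN : j + 1 = N := by
            by_contra hne'
            have := hne (j + 1) (by omega) 0 (by omega) y hy x hx hyx'
            omega
          rw [hjN] at hyx'
          have hinv : ∀ k (y : M), f.symm^[k] (f^[k] y) = y := fun k =>
            Function.LeftInverse.iterate f.symm_apply_apply k
          rcases le_or_gt m N with hle | hlt
          · exfalso
            obtain ⟨k, hk⟩ := Nat.exists_eq_add_of_le hle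
            rw [← hyx', hk, Function.iterate_add_apply, hinv] at hm
            exact hm ((hcl _).2 ⟨k, by omega, y, hy, rfl⟩)
          · obtain ⟨k, rfl⟩ := Nat.exists_eq_add_of_le' hlt.le
            rw [← hyx', Function.iterate_add_apply, hinv] at hm
            have := (ih k (by omega) y hy hm).iterate N
            rwa [hret' y hy, hyx'] at this
        · have h1 : g (f.symm x) = x := by
            rw [hoff _ fun h' => h (subset_closure h'), f.apply_symm_apply]
          have h2 : OrbitLeaves g (closure X) (f.symm x) := ⟨0, h⟩
          have := h2.apply
          rwa [h1] at this
    have hbase : ∀ x ∈ closure U, OrbitLeaves g (closure X) x := by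
      intro x hx
      obtain ⟨m, hm | hm⟩ := OrbitLeaves.exists_iterate (hexit x)
      · exact hfwd m x hx hm
      · exact hbwd m x hx hm
    intro x
    by_cases h : x ∈ closure X
    · obtain ⟨i, hi, y, hy, rfl⟩ := (hcl _).1 h
      by_cases hyU : y ∈ U
      · obtain ⟨y', hy', hyy⟩ := hsurj y hyU i hi
        rw [← hyy]
        exact (hbase y' (hsub hy')).iterate i
      · rw [← hbd y hy hyU i hi.le]
        exact (hbase y hy).iterate i
    · exact ⟨0, h⟩

end Tidy

/-! ### Construction of diffeomorphisms -/

section Shear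

variable {E : Type*} [NormedAddCommGroup E] [NormedSpace ℝ E] [CompleteSpace E]

/-- The inverse of `w ↦ w + L w • v`, when `1 + L v ≠ 0`. -/
noncomputable def shearEquiv (L : E →L[ℝ] ℝ) (v : E) (h : 1 + L v ≠ 0) : E ≃L[ℝ] E :=
  ContinuousLinearEquiv.equivOfInverse (ContinuousLinearMap.id ℝ E + L.smulRight v)
    (ContinuousLinearMap.id ℝ E - ((1 + L v)⁻¹ • L).smulRight v)
    (fun w => by
      simp only [add_apply, sub_apply, smul_apply,
        ContinuousLinearMap.id_apply, ContinuousLinearMap.smulRight_apply, map_add, map_smul,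
        smul_eq_mul]
      match_scalars
      · ring
      · field_simp
        ring)
    (fun w => by
      simp only [add_apply, sub_apply, smul_apply,
        ContinuousLinearMap.id_apply, ContinuousLinearMap.smulRight_apply, map_sub, map_smul,
        smul_eq_mul]
      match_scalars
      · ring
      · field_simp
        ring)

/-- A map moving the points in one direction `v`, by a quantity whose derivative in that direction
is larger than `-1`, is a diffeomorphism. -/
theorem exists_diffeomorph_add_smul {ψ : E → ℝ} (hψ : ContDiff ℝ 1 ψ) {B : ℝ}
    (hB : ∀ z, |ψ z| ≤ B) (v : E) (hv : ∀ z, 0 < 1 + fderiv ℝ ψ z v) :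
    ∃ F : E ≃ₘ^1⟮𝓘(ℝ, E), 𝓘(ℝ, E)⟯ E, ∀ z, F z = z + ψ z • v := by
  set F : E → E := fun z => z + ψ z • v with hF
  have hd : ∀ z, HasFDerivAt ψ (fderiv ℝ ψ z) z := fun z =>
    (hψ.differentiable one_ne_zero z).hasFDerivAt
  have hline : ∀ z (t : ℝ), HasDerivAt (fun t : ℝ => t + ψ (z + t • v))
      (1 + fderiv ℝ ψ (z + t • v) v) t := by
    intro z t
    have h1 : HasDerivAt (fun t : ℝ => z + t • v) v t := by
      simpa using ((hasDerivAt_id t).smul_const v).const_add z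
    exact (hasDerivAt_id t).add ((hd _).comp_hasDerivAt t h1)
  have hmono : ∀ z, StrictMono (fun t : ℝ => t + ψ (z + t • v)) := fun z =>
    strictMono_of_deriv_pos fun t => by rw [(hline z t).deriv]; exact hv _
  have hinj : Function.Injective F := by
    intro z z' hzz
    have h1 : z' = z + (ψ z - ψ z') • v := by
      simp only [hF] at hzz
      rw [sub_smul, ← add_sub_assoc, hzz]; abel
    have h2 : ψ z - ψ z' = 0 := by
      apply (hmono z).injective
      change ψ z - ψ z' + ψ (z + (ψ z - ψ z') • v) = 0 + ψ (z + (0 : ℝ) • v)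
      rw [← h1]; simp
    rw [h1, h2]; simp
  have hsurj : Function.Surjective F := by
    intro y
    have hc : Continuous (fun t : ℝ => t + ψ (y + t • v)) :=
      continuous_iff_continuousAt.2 fun t => (hline y t).continuousAt
    obtain ⟨t, ht⟩ : (0 : ℝ) ∈ range (fun t : ℝ => t + ψ (y + t • v)) := by
      refine mem_range_of_exists_le_of_exists_ge hc ⟨-B, ?_⟩ ⟨B, ?_⟩
      · have := (abs_le.1 (hB (y + -B • v))).2
        linarith
      · have := (abs_le.1 (hB (y + B • v))).1
        linarith
    refine ⟨y + t • v, ?_⟩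
    simp only at ht
    change y + t • v + ψ (y + t • v) • v = y
    rw [add_assoc, ← add_smul, ht]; simp
  have hFd : ∀ z, HasFDerivAt F (shearEquiv (fderiv ℝ ψ z) v (hv z).ne' : E →L[ℝ] E) z :=
    fun z => (hasFDerivAt_id z).add ((hd z).smul_const v)
  have hFc : ContDiff ℝ 1 F := contDiff_id.add (hψ.smul contDiff_const)
  have hopen : IsOpenMap F := by
    rw [isOpenMap_iff_nhds_le]
    intro z
    exact ((hFc.contDiffAt.hasStrictFDerivAt' (hFd z) one_ne_zero).map_nhds_eq_of_equiv).ge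
  let e : E ≃ₜ E := (Equiv.ofBijective F ⟨hinj, hsurj⟩).toHomeomorphOfContinuousOpen
    hFc.continuous hopen
  have hsymm : ContDiff ℝ 1 e.symm := e.contDiff_symm hFd hFc
  exact ⟨⟨e.toEquiv, hFc.contMDiff, hsymm.contMDiff⟩, fun z => rfl⟩

end Shear

section Diffeos

variable {d : ℕ} {M : Type*} [TopologicalSpace M] [ChartedSpace (Euc d) M]

/-- A `C¹` diffeomorphism of the model space which is the identity outside of a compact subset of
the target of a chart extends to a `C¹` diffeomorphism of `M`. -/
theorem exists_diffeomorph_of_chart [T2Space M] [IsManifold (𝓡 d) ∞ M] (q : M) {k : Set (Euc d)}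
    (hk : IsCompact k) (hkt : k ⊆ (extChartAt (𝓡 d) q).target)
    (F : Euc d ≃ₘ^1⟮𝓘(ℝ, Euc d), 𝓘(ℝ, Euc d)⟯ Euc d) (hF : ∀ z ∉ k, F z = z) :
    ∃ Ψ : M ≃ₘ^1⟮𝓡 d, 𝓡 d⟯ M,
      (∀ z ∈ (extChartAt (𝓡 d) q).target,
        Ψ ((extChartAt (𝓡 d) q).symm z) = (extChartAt (𝓡 d) q).symm (F z)) ∧
      ∀ x ∉ (extChartAt (𝓡 d) q).symm '' k, Ψ x = x := by
  classical
  set c := extChartAt (𝓡 d) q with hc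
  have hs : IsOpen c.source := isOpen_extChartAt_source q
  have hcs : ContMDiffOn (𝓡 d) 𝓘(ℝ, Euc d) 1 c c.source := by
    rw [hc, extChartAt_source]; exact contMDiffOn_extChartAt
  have hct : ContMDiffOn 𝓘(ℝ, Euc d) (𝓡 d) 1 c.symm c.target := contMDiffOn_extChartAt_symm q
  have hKc : IsClosed (c.symm '' k) :=
    (hk.image_of_continuousOn (hct.continuousOn.mono hkt)).isClosed
  let ext : (Euc d → Euc d) → M → M := fun G x => if x ∈ c.source then c.symm (G (c x)) else x
  have hmaps : ∀ G : Euc d ≃ Euc d, (∀ z ∉ k, G z = z) → ∀ z ∈ c.target, G z ∈ c.target := by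
    intro G hG z hz
    by_contra h
    have h1 := hG (G z) fun h' => h (hkt h')
    rw [G.injective h1] at h
    exact h hz
  have hval : ∀ (G : Euc d → Euc d) (z), z ∈ c.target → ext G (c.symm z) = c.symm (G z) := by
    intro G z hz
    simp only [ext, if_pos (c.map_target hz), c.right_inv hz]
  have hoff : ∀ (G : Euc d → Euc d), (∀ z ∉ k, G z = z) → ∀ x ∉ c.symm '' k, ext G x = x := by
    intro G hG x hx
    by_cases h : x ∈ c.source
    · have : c x ∉ k := fun h' => hx ⟨_, h', c.left_inv h⟩
      simp only [ext, if_pos h, hG _ this, c.left_inv h]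
    · simp only [ext, if_neg h]
  have hsmooth : ∀ G : Euc d ≃ Euc d, ContDiff ℝ 1 G → (∀ z ∉ k, G z = z) →
      ContMDiff (𝓡 d) (𝓡 d) 1 (ext G) := by
    intro G hGc hG x
    by_cases h : x ∈ c.source
    · have h1 : ContMDiffOn (𝓡 d) (𝓡 d) 1 (fun x => c.symm (G (c x))) c.source :=
        hct.comp (hGc.contMDiff.comp_contMDiffOn hcs)
          fun x hx => hmaps G hG _ (c.map_source hx)
      refine (h1.contMDiffAt (hs.mem_nhds h)).congr_of_eventuallyEq ?_
      filter_upwards [hs.mem_nhds h] with y hy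
      simp only [ext, if_pos hy]
    · have hx : x ∈ (c.symm '' k)ᶜ := by
        rintro ⟨z, hz, rfl⟩
        exact h (c.map_target (hkt hz))
      refine (contMDiffAt_id).congr_of_eventuallyEq ?_
      filter_upwards [hKc.isOpen_compl.mem_nhds hx] with y hy
      exact hoff G hG y hy
  have hF' : ∀ z ∉ k, F.symm z = z := by
    intro z hz
    conv_lhs => rw [← hF z hz]
    exact F.symm_apply_apply z
  have hinv : ∀ G H : Euc d ≃ Euc d, (∀ z ∉ k, G z = z) → (∀ z, H (G z) = z) →
      ∀ x, ext H (ext G x) = x := by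
    intro G H hG hGH x
    by_cases h : x ∈ c.source
    · conv_lhs => rw [← c.left_inv h]
      rw [hval G _ (c.map_source h), hval H _ (hmaps G hG _ (c.map_source h)), hGH, c.left_inv h]
    · simp only [ext, if_neg h]
  refine ⟨⟨⟨ext F, ext F.symm, hinv F.toEquiv F.symm.toEquiv hF F.symm_apply_apply,
    hinv F.symm.toEquiv F.toEquiv hF' F.apply_symm_apply⟩, hsmooth F.toEquiv F.contDiff hF,
    hsmooth F.symm.toEquiv F.symm.contDiff hF'⟩, fun z hz => hval F z hz, hoff F hF⟩

/-- The iterates of a diffeomorphism. -/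
noncomputable def iterateDiffeo (f : M ≃ₘ^1⟮𝓡 d, 𝓡 d⟯ M) : ℕ → (M ≃ₘ^1⟮𝓡 d, 𝓡 d⟯ M)
  | 0 => Diffeomorph.refl (𝓡 d) M 1
  | n + 1 => (iterateDiffeo f n).trans f

@[simp] theorem coe_iterateDiffeo (f : M ≃ₘ^1⟮𝓡 d, 𝓡 d⟯ M) (n : ℕ) :
    ⇑(iterateDiffeo f n) = f^[n] := by
  induction n with
  | zero => rfl
  | succ n ih => rw [Function.iterate_succ', ← ih]; rfl

/-- Diffeomorphisms with disjoint supports can be glued. The sets `V j` need not be open: the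
glued map is the composition of the given ones. -/
theorem exists_diffeomorph_of_disjoint (φ : ℕ → (M ≃ₘ^1⟮𝓡 d, 𝓡 d⟯ M)) {V K : ℕ → Set M}
    (hKV : ∀ j, K j ⊆ V j) (hφ : ∀ j, ∀ x ∉ K j, φ j x = x) (N : ℕ)
    (hV : ∀ i < N, ∀ j < N, i ≠ j → Disjoint (V i) (V j)) :
    ∃ Φ : M ≃ₘ^1⟮𝓡 d, 𝓡 d⟯ M, (∀ j < N, ∀ x ∈ V j, Φ x = φ j x) ∧
      ∀ x, (∀ j < N, x ∉ K j) → Φ x = x := by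
  induction N with
  | zero => exact ⟨Diffeomorph.refl (𝓡 d) M 1, by simp, by simp⟩
  | succ N ih =>
    obtain ⟨Φ, h1, h2⟩ := ih fun i hi j hj hij => hV i (by omega) j (by omega) hij
    have hmaps : ∀ x ∈ V N, φ N x ∈ V N := by
      intro x hx
      by_contra h
      have := hφ N _ fun h' => h (hKV N h')
      rw [(φ N).injective this] at h
      exact h hx
    refine ⟨(φ N).trans Φ, fun j hj x hx => ?_, fun x hx => ?_⟩
    · rw [Diffeomorph.coe_trans, Function.comp]
      rcases Nat.lt_succ_iff_lt_or_eq.1 hj with hj' | rfl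
      · rw [hφ N x fun h => Set.disjoint_left.1 (hV j hj N (by omega) (by omega)) hx (hKV N h)]
        exact h1 j hj' x hx
      · refine h2 _ fun i hi h => ?_
        exact Set.disjoint_left.1 (hV i (by omega) j hj (by omega)) (hKV i h) (hmaps x hx)
    · rw [Diffeomorph.coe_trans, Function.comp, hφ N x (hx N (by omega))]
      exact h2 x fun j hj => hx j (by omega)

/-- A perturbation of `f` along the tower `U, f(U), …, f^(N-1)(U)` is prescribed by
diffeomorphisms `Ψ i` supported in `U`: its `i`-th iterate on `U` is `f^i ∘ Ψ i`. -/
theorem exists_tower_perturbation (f : M ≃ₘ^1⟮𝓡 d, 𝓡 d⟯ M) (Ψ : ℕ → (M ≃ₘ^1⟮𝓡 d, 𝓡 d⟯ M))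
    {U K : Set M} (hKU : K ⊆ U) (hΨ : ∀ i, ∀ x ∉ K, Ψ i x = x) (h0 : ∀ x, Ψ 0 x = x) (N : ℕ)
    (hdisj : ∀ i < N, ∀ j < N, i ≠ j → Disjoint (f^[i] '' U) (f^[j] '' U)) :
    ∃ g : M ≃ₘ^1⟮𝓡 d, 𝓡 d⟯ M,
      (∀ y ∈ U, ∀ i < N, g (f^[i] (Ψ i y)) = f^[i + 1] (Ψ (i + 1) y)) ∧
      (∀ y ∈ U, ∀ i ≤ N, g^[i] y = f^[i] (Ψ i y)) ∧
      ∀ x, (∀ j < N, x ∉ f^[j] '' K) → g x = f x := by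
  set φ : ℕ → (M ≃ₘ^1⟮𝓡 d, 𝓡 d⟯ M) := fun i =>
    (iterateDiffeo f i).symm.trans
      (((Ψ i).symm.trans (Ψ (i + 1))).trans (iterateDiffeo f i)) with hφ
  have hmaps : ∀ i, ∀ x ∈ U, Ψ i x ∈ U := by
    intro i x hx
    by_contra h
    have := hΨ i _ fun h' => h (hKU h')
    rw [(Ψ i).injective this] at h
    exact h hx
  have hφ1 : ∀ i y, φ i (f^[i] (Ψ i y)) = f^[i] (Ψ (i + 1) y) := by
    intro i y
    simp only [hφ, Diffeomorph.coe_trans, Function.comp, ← coe_iterateDiffeo,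
      Diffeomorph.symm_apply_apply]
  have hφ2 : ∀ i, ∀ x ∉ f^[i] '' K, φ i x = x := by
    intro i x hx
    obtain ⟨y, rfl⟩ : ∃ y, f^[i] y = x := (f.bijective.iterate i).2 x
    have hy : y ∉ K := fun h => hx ⟨y, h, rfl⟩
    have := hφ1 i y
    rwa [hΨ i y hy, hΨ (i + 1) y hy] at this
  obtain ⟨Φ, hΦ1, hΦ2⟩ := exists_diffeomorph_of_disjoint φ (V := fun j => f^[j] '' U)
    (K := fun j => f^[j] '' K) (fun j => image_mono hKU) hφ2 N hdisj
  have hstep : ∀ y ∈ U, ∀ i < N, (Φ.trans f) (f^[i] (Ψ i y)) = f^[i + 1] (Ψ (i + 1) y) := by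
    intro y hy i hi
    rw [Diffeomorph.coe_trans, Function.comp, hΦ1 i hi _ ⟨_, hmaps i y hy, rfl⟩, hφ1,
      Function.iterate_succ_apply']
  refine ⟨Φ.trans f, hstep, fun y hy i => ?_, fun x hx => ?_⟩
  · induction i with
    | zero => intro _; exact (h0 y).symm
    | succ i ih =>
      intro hi
      rw [Function.iterate_succ_apply', ih (by omega), hstep y hy i (by omega)]
  · rw [Diffeomorph.coe_trans, Function.comp, hΦ2 x hx]

end Diffeos

/-! ### Shears with a cutoff -/

section ShearFamily

variable {E : Type*} [NormedAddCommGroup E] [NormedSpace ℝ E]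

/-- A localized ridge function: the profile `σ`, evaluated on `ℓ` at scale `s`, is cut off by `χ`.
-/
noncomputable def ridge (χ : E → ℝ) (ℓ : E →L[ℝ] ℝ) (s : ℝ) (σ : ℝ → ℝ) (z : E) : ℝ :=
  s * χ z * σ (ℓ z / s)

theorem contDiff_ridge {χ : E → ℝ} (hχ : ContDiff ℝ 1 χ) (ℓ : E →L[ℝ] ℝ) (s : ℝ) {σ : ℝ → ℝ}
    (hσ : ContDiff ℝ 1 σ) : ContDiff ℝ 1 (ridge χ ℓ s σ) :=
  (contDiff_const.mul hχ).mul (hσ.comp (ℓ.contDiff.div_const s))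

theorem fderiv_ridge_apply {χ : E → ℝ} (hχ : ContDiff ℝ 1 χ) (ℓ : E →L[ℝ] ℝ) {s : ℝ} (hs : 0 < s)
    {σ : ℝ → ℝ} (hσ : ContDiff ℝ 1 σ) (z w : E) :
    fderiv ℝ (ridge χ ℓ s σ) z w =
      s * σ (ℓ z / s) * fderiv ℝ χ z w + χ z * deriv σ (ℓ z / s) * ℓ w := by
  have h1 := (hχ.differentiable one_ne_zero z).hasFDerivAt
  have h2 : HasFDerivAt (fun y => ℓ y / s) (s⁻¹ • ℓ) z := by
    have := ℓ.hasFDerivAt (x := z).const_mul s⁻¹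
    refine this.congr_of_eventuallyEq ?_
    filter_upwards with y
    rw [div_eq_inv_mul]
  have h3 := ((hσ.differentiable one_ne_zero (ℓ z / s)).hasDerivAt).comp_hasFDerivAt z h2
  have h4 := (h1.const_mul s).mul h3
  have h5 : HasFDerivAt (ridge χ ℓ s σ) _ z := h4
  rw [h5.fderiv]
  simp only [add_apply, smul_apply, smul_eq_mul, Function.comp]
  field_simp
  ring

variable {χ : E → ℝ} {ℓ : E →L[ℝ] ℝ} {v : E} {S B D δ : ℝ}

/-- The shear defined by a ridge function preserves the orientation of the lines parallel to `v`.
-/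
theorem ridge_deriv_lower (hχ : ContDiff ℝ 1 χ) (hχ0 : ∀ z, 0 ≤ χ z) (hχ1 : ∀ z, χ z ≤ 1)
    (hD : ∀ z, ‖fderiv ℝ χ z‖ ≤ D) {s : ℝ} (hs : 0 < s) {σ : ℝ → ℝ} (hσ : ContDiff ℝ 1 σ)
    (hS : ∀ u, |σ u| ≤ S) (hδ1 : 2 * δ ≤ 1) (hδσ : ∀ u, 2 * δ ≤ 1 + deriv σ u * ℓ v)
    (hsv : s * S * D * ‖v‖ ≤ δ) (z : E) : δ ≤ 1 + fderiv ℝ (ridge χ ℓ s σ) z v := by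
  rw [fderiv_ridge_apply hχ ℓ hs hσ]
  have h1 : |s * σ (ℓ z / s) * fderiv ℝ χ z v| ≤ s * S * D * ‖v‖ := by
    rw [abs_mul, abs_mul, abs_of_pos hs]
    have a1 := hS (ℓ z / s)
    have a2 : |fderiv ℝ χ z v| ≤ D * ‖v‖ := by
      rw [← Real.norm_eq_abs]
      exact ((fderiv ℝ χ z).le_opNorm v).trans (by gcongr; exact hD z)
    calc _ ≤ s * S * (D * ‖v‖) := by
          gcongr
          exact mul_nonneg hs.le ((abs_nonneg _).trans a1)
      _ = _ := by ring
  have h2 := (abs_le.1 h1).1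
  have h3 := hδσ (ℓ z / s)
  nlinarith [hχ0 z, hχ1 z]

/-- The difference of the derivatives of two ridge functions, in terms of the image of a vector
under the shear defined by a third one. -/
theorem ridge_deriv_sub_le (hχ : ContDiff ℝ 1 χ) (hχ0 : ∀ z, 0 ≤ χ z) (hχ1 : ∀ z, χ z ≤ 1)
    (hD : ∀ z, ‖fderiv ℝ χ z‖ ≤ D) {s : ℝ} (hs : 0 < s) {σ₁ σ₂ σ : ℝ → ℝ} (hσ₁ : ContDiff ℝ 1 σ₁)
    (hσ₂ : ContDiff ℝ 1 σ₂) (hσ : ContDiff ℝ 1 σ)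
    (hS₁ : ∀ u, |σ₁ u| ≤ S) (hS₂ : ∀ u, |σ₂ u| ≤ S) (hS : ∀ u, |σ u| ≤ S)
    (hB : ∀ u, |deriv σ u| ≤ B) (hδ0 : 0 < δ) (hδ1 : 2 * δ ≤ 1)
    (hδσ : ∀ u, 2 * δ ≤ 1 + deriv σ u * ℓ v)
    {b : ℝ} (hb : ∀ u, |deriv σ₂ u - deriv σ₁ u| ≤ b)
    (hs1 : s * S * D ≤ 1) (hsv : s * S * D * ‖v‖ ≤ δ) {z w' w : E}
    (hw : w = w' + fderiv ℝ (ridge χ ℓ s σ) z w' • v) :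
    |fderiv ℝ (ridge χ ℓ s σ₂) z w' - fderiv ℝ (ridge χ ℓ s σ₁) z w'| ≤
      b / (2 * δ) * |ℓ w| + s * S * D *
        ((b * |ℓ v| / (2 * δ) + 2) * (1 + (B * ‖ℓ‖ + 1) * ‖v‖ / δ)) * ‖w‖ := by
  have hS0 : 0 ≤ S := (abs_nonneg _).trans (hS 0)
  have hD0 : 0 ≤ D := (norm_nonneg _).trans (hD 0)
  have hb0 : 0 ≤ b := (abs_nonneg _).trans (hb 0)
  have hB0 : 0 ≤ B := (abs_nonneg _).trans (hB 0)
  set T := s * S * D with hT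
  have hT0 : 0 ≤ T := by positivity
  have hcut : ∀ (τ : ℝ → ℝ), (∀ u, |τ u| ≤ S) → ∀ x : E,
      |s * τ (ℓ z / s) * fderiv ℝ χ z x| ≤ T * ‖x‖ := by
    intro τ hτ x
    rw [abs_mul, abs_mul, abs_of_pos hs]
    have a2 : |fderiv ℝ χ z x| ≤ D * ‖x‖ := by
      rw [← Real.norm_eq_abs]
      exact ((fderiv ℝ χ z).le_opNorm x).trans (by gcongr; exact hD z)
    calc _ ≤ s * S * (D * ‖x‖) := by gcongr; exact hτ _
      _ = _ := by rw [hT]; ring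
  have hℓ : ∀ x : E, |ℓ x| ≤ ‖ℓ‖ * ‖x‖ := fun x => by
    rw [← Real.norm_eq_abs]; exact ℓ.le_opNorm x
  set c := fderiv ℝ (ridge χ ℓ s σ) z w' with hc
  have hlow := ridge_deriv_lower hχ hχ0 hχ1 hD hs hσ hS hδ1 hδσ hsv z
  -- the norm of `w'` is controlled by the norm of `w`
  have hcw : |c| ≤ (B * ‖ℓ‖ + 1) * ‖w‖ / δ := by
    have e1 : fderiv ℝ (ridge χ ℓ s σ) z w = c * (1 + fderiv ℝ (ridge χ ℓ s σ) z v) := by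
      rw [hw, map_add, map_smul, smul_eq_mul, ← hc]; ring
    have e2 : |fderiv ℝ (ridge χ ℓ s σ) z w| ≤ (B * ‖ℓ‖ + 1) * ‖w‖ := by
      rw [fderiv_ridge_apply hχ ℓ hs hσ]
      have a1 := hcut σ hS w
      have a2 : |χ z * deriv σ (ℓ z / s) * ℓ w| ≤ 1 * B * (‖ℓ‖ * ‖w‖) := by
        rw [abs_mul, abs_mul, abs_of_nonneg (hχ0 z)]
        gcongr
        · exact hχ1 z
        · exact hB _
        · exact hℓ w
      have a3 : T * ‖w‖ ≤ 1 * ‖w‖ := by gcongr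
      refine (abs_add_le _ _).trans ?_
      linarith
    rw [e1, abs_mul, abs_of_pos (hδ0.trans_le hlow)] at e2
    rw [le_div_iff₀ hδ0]
    refine le_trans ?_ e2
    gcongr
  have hw' : ‖w'‖ ≤ (1 + (B * ‖ℓ‖ + 1) * ‖v‖ / δ) * ‖w‖ := by
    have e : w' = w - c • v := by rw [hw]; abel
    rw [e]
    refine (norm_sub_le _ _).trans ?_
    rw [norm_smul, Real.norm_eq_abs]
    have : |c| * ‖v‖ ≤ (B * ‖ℓ‖ + 1) * ‖w‖ / δ * ‖v‖ := by gcongr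
    calc _ ≤ ‖w‖ + (B * ‖ℓ‖ + 1) * ‖w‖ / δ * ‖v‖ := by linarith
      _ = _ := by ring
  -- so is the value of `ℓ`, with a sharper constant
  have hℓw' : |ℓ w'| ≤ (|ℓ w| + T * ‖w'‖ * |ℓ v|) / (2 * δ) := by
    rw [le_div_iff₀ (by positivity)]
    set A := χ z * deriv σ (ℓ z / s) with hA
    set e := s * σ (ℓ z / s) * fderiv ℝ χ z w' with he
    have hA1 : 2 * δ ≤ 1 + A * ℓ v := by
      have := hδσ (ℓ z / s)
      rw [hA]
      nlinarith [hχ0 z, hχ1 z]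
    have e1 : ℓ w' * (1 + A * ℓ v) = ℓ w - e * ℓ v := by
      have : c = e + A * ℓ w' := fderiv_ridge_apply hχ ℓ hs hσ z w'
      rw [hw, map_add, map_smul, smul_eq_mul, this]; ring
    have e2 : |ℓ w'| * (1 + A * ℓ v) = |ℓ w - e * ℓ v| := by
      rw [← e1, abs_mul, abs_of_pos (lt_of_lt_of_le (by positivity) hA1)]
    have e3 : |ℓ w - e * ℓ v| ≤ |ℓ w| + |e| * |ℓ v| := by
      rw [← abs_mul]; exact abs_sub _ _
    have e4 : |e| * |ℓ v| ≤ T * ‖w'‖ * |ℓ v| := by gcongr; exact hcut σ hS w'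
    have e5 : |ℓ w'| * (2 * δ) ≤ |ℓ w'| * (1 + A * ℓ v) := by gcongr
    linarith
  have hmain : |fderiv ℝ (ridge χ ℓ s σ₂) z w' - fderiv ℝ (ridge χ ℓ s σ₁) z w'| ≤
      b * |ℓ w'| + 2 * T * ‖w'‖ := by
    rw [fderiv_ridge_apply hχ ℓ hs hσ₁, fderiv_ridge_apply hχ ℓ hs hσ₂]
    have a1 := hcut σ₁ hS₁ w'
    have a2 := hcut σ₂ hS₂ w'
    have a3 : |χ z * (deriv σ₂ (ℓ z / s) - deriv σ₁ (ℓ z / s)) * ℓ w'| ≤ 1 * b * |ℓ w'| := by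
      rw [abs_mul, abs_mul, abs_of_nonneg (hχ0 z)]
      gcongr
      · exact hχ1 z
      · exact hb _
    rw [abs_le] at a1 a2 a3 ⊢
    constructor <;> nlinarith
  calc _ ≤ b * |ℓ w'| + 2 * T * ‖w'‖ := hmain
    _ ≤ b * ((|ℓ w| + T * ‖w'‖ * |ℓ v|) / (2 * δ)) + 2 * T * ‖w'‖ := by gcongr
    _ = b / (2 * δ) * |ℓ w| + T * (b * |ℓ v| / (2 * δ) + 2) * ‖w'‖ := by ring
    _ ≤ b / (2 * δ) * |ℓ w| + T * (b * |ℓ v| / (2 * δ) + 2) *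
        ((1 + (B * ‖ℓ‖ + 1) * ‖v‖ / δ) * ‖w‖) := by gcongr
    _ = _ := by ring

end ShearFamily

/-- A family of `C¹` functions of one variable, which are the profiles of a family of shears in
the direction `v`, the size of the displacement being a function of the linear form `ℓ`: the
numbers `b i` bound the variation of the derivatives, and `2 δ` bounds from below the factor by
which the shears act in the direction `v`. -/
structure ShearProfile {E : Type*} [NormedAddCommGroup E] [NormedSpace ℝ E] (ℓ : E →L[ℝ] ℝ) (v : E)
    (σ : ℕ → ℝ → ℝ) (b : ℕ → ℝ) (S B δ : ℝ) : Prop where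
  contDiff : ∀ i, ContDiff ℝ 1 (σ i)
  bound : ∀ i u, |σ i u| ≤ S
  deriv_bound : ∀ i u, |deriv (σ i) u| ≤ B
  variation : ∀ i u, |deriv (σ (i + 1)) u - deriv (σ i) u| ≤ b i
  variation_le : ∀ i, b i ≤ B
  pos : 0 < δ
  le_one : 2 * δ ≤ 1
  lower : ∀ i u, 2 * δ ≤ 1 + deriv (σ i) u * ℓ v

/-- The shears with given profiles, cut off by `χ`, are diffeomorphisms when the scale is small
enough, and the effect of the cutoff on the variation of their derivatives is arbitrarily small.
-/
theorem ShearProfile.exists_diffeomorph {E : Type*} [NormedAddCommGroup E] [NormedSpace ℝ E]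
    [CompleteSpace E] {ℓ : E →L[ℝ] ℝ} {v : E} {σ : ℕ → ℝ → ℝ} {b : ℕ → ℝ} {S B δ : ℝ}
    (h : ShearProfile ℓ v σ b S B δ) {χ : E → ℝ} (hχ : ContDiff ℝ 1 χ) (hχ0 : ∀ z, 0 ≤ χ z)
    (hχ1 : ∀ z, χ z ≤ 1) {D : ℝ} (hD : ∀ z, ‖fderiv ℝ χ z‖ ≤ D) {η : ℝ} (hη : 0 < η) :
    ∃ s > 0, ∃ F : ℕ → (E ≃ₘ^1⟮𝓘(ℝ, E), 𝓘(ℝ, E)⟯ E),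
      (∀ i z, F i z = z + ridge χ ℓ s (σ i) z • v) ∧
      (∀ i z w', ∃ Δ : ℝ, fderiv ℝ (F (i + 1)) z w' = fderiv ℝ (F i) z w' + Δ • v ∧
        ∀ j, |Δ| ≤ b i / (2 * δ) * |ℓ (fderiv ℝ (F j) z w')| + η * ‖fderiv ℝ (F j) z w'‖) ∧
      ∀ z, χ =ᶠ[𝓝 z] 1 → ∀ i w,
        fderiv ℝ (F i) z w = w + (deriv (σ i) (ℓ z / s) * ℓ w) • v := by
  have hδ := h.pos
  have hS0 : 0 ≤ S := (abs_nonneg _).trans (h.bound 0 0)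
  have hD0 : 0 ≤ D := (norm_nonneg _).trans (hD 0)
  have hB0 : 0 ≤ B := (abs_nonneg _).trans (h.deriv_bound 0 0)
  set R := (B * |ℓ v| / (2 * δ) + 2) * (1 + (B * ‖ℓ‖ + 1) * ‖v‖ / δ) with hR
  have hR0 : 0 ≤ R := by positivity
  obtain ⟨τ, hτ0, hτ1, hτv, hτη⟩ : ∃ τ : ℝ, 0 < τ ∧ τ ≤ 1 ∧ τ * ‖v‖ ≤ δ ∧ τ * R ≤ η := by
    refine ⟨min 1 (min (δ / (‖v‖ + 1)) (η / (R + 1))), by positivity, min_le_left _ _, ?_, ?_⟩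
    · calc _ ≤ δ / (‖v‖ + 1) * ‖v‖ := by
            gcongr; exact (min_le_right _ _).trans (min_le_left _ _)
        _ ≤ δ / (‖v‖ + 1) * (‖v‖ + 1) := by gcongr; linarith
        _ = δ := by field_simp
    · calc _ ≤ η / (R + 1) * R := by
            gcongr; exact (min_le_right _ _).trans (min_le_right _ _)
        _ ≤ η / (R + 1) * (R + 1) := by gcongr; linarith
        _ = η := by field_simp
  set s := τ / (S * D + 1) with hs
  have hs0 : 0 < s := by positivity
  have hT : s * S * D ≤ τ := by
    rw [mul_assoc, hs, div_mul_eq_mul_div, div_le_iff₀ (by positivity)]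
    nlinarith
  have hT0 : 0 ≤ s * S * D := by positivity
  have hsv : s * S * D * ‖v‖ ≤ δ := (by gcongr : s * S * D * ‖v‖ ≤ τ * ‖v‖).trans hτv
  have hlow := fun i => ridge_deriv_lower hχ hχ0 hχ1 hD hs0 (h.contDiff i) (h.bound i) h.le_one
    (h.lower i) hsv
  have hF : ∀ i, ∃ F : E ≃ₘ^1⟮𝓘(ℝ, E), 𝓘(ℝ, E)⟯ E, ∀ z, F z = z + ridge χ ℓ s (σ i) z • v := by
    intro i
    refine exists_diffeomorph_add_smul (contDiff_ridge hχ ℓ s (h.contDiff i)) (B := s * 1 * S)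
      (fun z => ?_) v fun z => hδ.trans_le (hlow i z)
    unfold ridge
    rw [abs_mul, abs_mul, abs_of_pos hs0, abs_of_nonneg (hχ0 z)]
    gcongr
    · exact hχ1 z
    · exact h.bound i _
  choose F hF using hF
  have hFd : ∀ i z w, fderiv ℝ (F i) z w = w + fderiv ℝ (ridge χ ℓ s (σ i)) z w • v := by
    intro i z w
    have e : ⇑(F i) = fun z => z + ridge χ ℓ s (σ i) z • v := funext (hF i)
    have h1 : HasFDerivAt (ridge χ ℓ s (σ i)) (fderiv ℝ (ridge χ ℓ s (σ i)) z) z :=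
      ((contDiff_ridge hχ ℓ s (h.contDiff i)).differentiable one_ne_zero z).hasFDerivAt
    have h2 : HasFDerivAt (fun z => z + ridge χ ℓ s (σ i) z • v) _ z :=
      (hasFDerivAt_id z).add (h1.smul_const v)
    rw [e, h2.fderiv]
    simp
  refine ⟨s, hs0, F, hF, fun i z w' => ⟨fderiv ℝ (ridge χ ℓ s (σ (i + 1))) z w' -
    fderiv ℝ (ridge χ ℓ s (σ i)) z w', ?_, fun j => ?_⟩, fun z hz i w => ?_⟩
  · rw [hFd, hFd]; module
  · have := ridge_deriv_sub_le hχ hχ0 hχ1 hD hs0 (h.contDiff i) (h.contDiff (i + 1)) (h.contDiff j)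
      (h.bound i) (h.bound (i + 1)) (h.bound j) (h.deriv_bound j) hδ h.le_one (h.lower j)
      (h.variation i) (hT.trans hτ1) hsv (hFd j z w')
    have hbi := h.variation_le i
    refine this.trans ?_
    have hle : s * S * D * ((b i * |ℓ v| / (2 * δ) + 2) * (1 + (B * ‖ℓ‖ + 1) * ‖v‖ / δ)) ≤ η := by
      refine le_trans ?_ hτη
      rw [hR]
      gcongr
      have : 0 ≤ b i := (abs_nonneg _).trans (h.variation i 0)
      positivity
    gcongr
  · rw [hFd, fderiv_ridge_apply hχ ℓ hs0 (h.contDiff i)]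
    rw [hz.fderiv_eq, hz.eq_of_nhds]
    have : fderiv ℝ (1 : E → ℝ) z = 0 := by simp
    rw [this]
    simp

/-! ### The cost of a shear along an orbit -/

section LocalEstimates

variable {d : ℕ} {M : Type*} [TopologicalSpace M] [ChartedSpace (Euc d) M]
  [IsManifold (𝓡 d) ∞ M] [RiemannianBundle (fun x : M => TangentSpace (𝓡 d) x)]
  [IsContMDiffRiemannianBundle (𝓡 d) 1 (Euc d) (fun x : M => TangentSpace (𝓡 d) x)]
  [IsContinuousRiemannianBundle (Euc d) (fun x : M => TangentSpace (𝓡 d) x)]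

theorem continuousAt_norm_tmap {θ : Euc d → M} {O : Set (Euc d)} (hO : IsOpen O)
    (hθ : ContMDiffOn 𝓘(ℝ, Euc d) (𝓡 d) 1 θ O) {z : Euc d} (hz : z ∈ O) (w : Euc d) :
    ContinuousAt (fun x : Euc d × Euc d => ‖(tmap θ x.1 x.2).2‖) (z, w) :=
  (continuousOn_norm_tmap hO hθ).continuousAt ((hO.prod isOpen_univ).mem_nhds ⟨hz, mem_univ _⟩)

theorem eventually_forall_sasakiEDist_tmap_lt {θ : Euc d → M} {O : Set (Euc d)} (hO : IsOpen O)
    (hθ : ContMDiffOn 𝓘(ℝ, Euc d) (𝓡 d) 1 θ O) {z₀ : Euc d} (hz₀ : z₀ ∈ O) (R : ℝ) {η : ℝ}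
    (hη : 0 < η) :
    ∀ᶠ x : Euc d × Euc d in 𝓝 (z₀, z₀), ∀ w ∈ Metric.closedBall (0 : Euc d) R,
      sasakiEDist (tmap θ x.1 w) (tmap θ x.2 w) < ENNReal.ofReal η := by
  refine (isCompact_closedBall (0 : Euc d) R).eventually_forall_of_forall_eventually
    fun w _ => ?_
  have hT : ContinuousAt (fun x : Euc d × Euc d => tmap θ x.1 x.2) (z₀, w) :=
    (continuousOn_tmap hO hθ).continuousAt ((hO.prod isOpen_univ).mem_nhds ⟨hz₀, mem_univ _⟩)
  have h1 : ContinuousAt (fun y : (Euc d × Euc d) × Euc d => tmap θ y.1.1 y.2) ((z₀, z₀), w) :=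
    ContinuousAt.comp (g := fun x : Euc d × Euc d => tmap θ x.1 x.2)
      (f := fun y : (Euc d × Euc d) × Euc d => (y.1.1, y.2)) (x := ((z₀, z₀), w)) hT (by fun_prop)
  have h2 : ContinuousAt (fun y : (Euc d × Euc d) × Euc d => tmap θ y.1.2 y.2) ((z₀, z₀), w) :=
    ContinuousAt.comp (g := fun x : Euc d × Euc d => tmap θ x.1 x.2)
      (f := fun y : (Euc d × Euc d) × Euc d => (y.1.2, y.2)) (x := ((z₀, z₀), w)) hT (by fun_prop)
  exact (h1.prodMk h2).eventually (eventually_sasakiEDist_lt (tmap θ z₀ w) hη)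

theorem eventually_forall_lower_bound {θ : Euc d → M} {O : Set (Euc d)} (hO : IsOpen O)
    (hθ : ContMDiffOn 𝓘(ℝ, Euc d) (𝓡 d) 1 θ O)
    (hpos : ∀ z ∈ O, ∀ w, w ≠ 0 → 0 < ‖(tmap θ z w).2‖) {z₀ : Euc d} (hz₀ : z₀ ∈ O) :
    ∃ c > 0, ∀ᶠ z in 𝓝 z₀, ∀ w, c * ‖w‖ ≤ ‖(tmap θ z w).2‖ := by
  obtain ⟨r, hr, hrO⟩ := Metric.nhds_basis_closedBall.mem_iff.1 (hO.mem_nhds hz₀)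
  obtain ⟨c, hc0, hc⟩ := exists_lower_bound_of_homogeneous (isCompact_closedBall z₀ r)
    ((continuousOn_norm_tmap hO hθ).mono (prod_mono_left hrO))
    (fun z w r => norm_tmap_smul θ z w r) (fun z hz => hpos z (hrO hz))
  exact ⟨c, hc0, Filter.eventually_of_mem (Metric.closedBall_mem_nhds z₀ hr) hc⟩

/-- The bound on the size of a shear at `z₀` persists, up to a factor `2`, near `z₀`, even if the
two sides are computed at different points. -/
theorem eventually_forall_form_mul_le {θ : Euc d → M} {O : Set (Euc d)} (hO : IsOpen O)
    (hθ : ContMDiffOn 𝓘(ℝ, Euc d) (𝓡 d) 1 θ O)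
    (hpos : ∀ z ∈ O, ∀ w, w ≠ 0 → 0 < ‖(tmap θ z w).2‖) {z₀ : Euc d} (hz₀ : z₀ ∈ O)
    (ℓ : Euc d →L[ℝ] ℝ) (v : Euc d) {β ε₁ : ℝ} (hε₁ : 0 < ε₁)
    (hsize : ∀ w, β * |ℓ w| * ‖(tmap θ z₀ v).2‖ ≤ ε₁ * ‖(tmap θ z₀ w).2‖) :
    ∀ᶠ x : Euc d × Euc d in 𝓝 (z₀, z₀), ∀ w,
      β * |ℓ w| * ‖(tmap θ x.2 v).2‖ ≤ 2 * ε₁ * ‖(tmap θ x.1 w).2‖ := by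
  have key : ∀ᶠ x : Euc d × Euc d in 𝓝 (z₀, z₀), ∀ w ∈ Metric.sphere (0 : Euc d) 1,
      β * |ℓ w| * ‖(tmap θ x.2 v).2‖ ≤ 2 * ε₁ * ‖(tmap θ x.1 w).2‖ := by
    refine (isCompact_sphere (0 : Euc d) 1).eventually_forall_of_forall_eventually fun w hw => ?_
    have h1 : ContinuousAt (fun y : (Euc d × Euc d) × Euc d => ‖(tmap θ y.1.1 y.2).2‖)
        ((z₀, z₀), w) :=
      ContinuousAt.comp (g := fun x : Euc d × Euc d => ‖(tmap θ x.1 x.2).2‖)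
        (f := fun y : (Euc d × Euc d) × Euc d => (y.1.1, y.2)) (x := ((z₀, z₀), w))
        (continuousAt_norm_tmap hO hθ hz₀ w) (by fun_prop)
    have h2 : ContinuousAt (fun y : (Euc d × Euc d) × Euc d => ‖(tmap θ y.1.2 v).2‖)
        ((z₀, z₀), w) :=
      ContinuousAt.comp (g := fun x : Euc d × Euc d => ‖(tmap θ x.1 x.2).2‖)
        (f := fun y : (Euc d × Euc d) × Euc d => (y.1.2, v)) (x := ((z₀, z₀), w))
        (continuousAt_norm_tmap hO hθ hz₀ v) (by fun_prop)
    have h3 : ContinuousAt (fun y : (Euc d × Euc d) × Euc d => β * |ℓ y.2|) ((z₀, z₀), w) := by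
      fun_prop
    refine ((h3.mul h2).eventually_lt (h1.const_mul (2 * ε₁)) ?_).mono fun y hy => hy.le
    have := hpos z₀ hz₀ w (ne_zero_of_mem_unit_sphere ⟨w, hw⟩)
    have := hsize w
    change β * |ℓ w| * ‖(tmap θ z₀ v).2‖ < 2 * ε₁ * ‖(tmap θ z₀ w).2‖
    nlinarith
  filter_upwards [key] with x hx w
  rcases eq_or_ne w 0 with rfl | hw
  · have nn : ∀ (x : M) (u : TangentSpace (𝓡 d) x), 0 ≤ ‖u‖ := fun x u => norm_nonneg u
    have := nn _ (tmap θ x.1 0).2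
    simp only [map_zero, abs_zero, mul_zero, zero_mul]
    positivity
  · have h1 := hx (‖w‖⁻¹ • w) (by simp [norm_smul, hw])
    rw [norm_tmap_smul, map_smul, smul_eq_mul, abs_mul, abs_of_pos (by positivity)] at h1
    have h2 : 0 < ‖w‖⁻¹ := by positivity
    refine le_of_mul_le_mul_left ?_ h2
    linarith

/-- Local form of the estimate on the size of the perturbation: changing slightly the base point
in the source of `θ'`, and the vector by a small multiple of `v`, changes its image only slightly.
-/
theorem eventually_sasakiEDist_tmap_add_le {θ θ' : Euc d → M} {O : Set (Euc d)} (hO : IsOpen O)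
    (hθ : ContMDiffOn 𝓘(ℝ, Euc d) (𝓡 d) 1 θ O) (hθ' : ContMDiffOn 𝓘(ℝ, Euc d) (𝓡 d) 1 θ' O)
    (hpos : ∀ z ∈ O, ∀ w, w ≠ 0 → 0 < ‖(tmap θ z w).2‖) {z₀ : Euc d} (hz₀ : z₀ ∈ O)
    {A C : ℝ} (hA : 0 < A) (hC : 0 < C)
    (hθθ' : ∀ z ∈ O, ∀ w, ‖(tmap θ' z w).2‖ ≤ C * ‖(tmap θ z w).2‖)
    (ℓ : Euc d →L[ℝ] ℝ) (v : Euc d) {β ε₁ ε' : ℝ} (hε₁ : 0 < ε₁) (hε' : 0 < ε')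
    (hsize : ∀ w, β * |ℓ w| * ‖(tmap θ z₀ v).2‖ ≤ ε₁ * ‖(tmap θ z₀ w).2‖) :
    ∃ η > 0, ∀ᶠ x : Euc d × Euc d in 𝓝 (z₀, z₀), ∀ (w : Euc d) (Δ : ℝ),
      ‖(tmap θ x.1 w).2‖ ≤ A → |Δ| ≤ β * |ℓ w| + η * ‖w‖ →
      sasakiEDist (tmap θ' x.1 w) (tmap θ' x.2 (w + Δ • v)) ≤
        ENNReal.ofReal (2 * ε₁ * A * C + ε') := by
  obtain ⟨c, hc0, hc⟩ := eventually_forall_lower_bound hO hθ hpos hz₀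
  have nn : ∀ (x : M) (u : TangentSpace (𝓡 d) x), 0 ≤ ‖u‖ := fun x u => norm_nonneg u
  set R₂ := ‖(tmap θ z₀ v).2‖ + 1 with hR₂
  have hR₂0 : 0 < R₂ := by have := nn _ (tmap θ z₀ v).2; positivity
  have hv : ∀ᶠ z in 𝓝 z₀, ‖(tmap θ z v).2‖ ≤ R₂ := by
    have h1 : ContinuousAt (fun z : Euc d => ‖(tmap θ z v).2‖) z₀ :=
      ContinuousAt.comp (g := fun x : Euc d × Euc d => ‖(tmap θ x.1 x.2).2‖)
        (f := fun z : Euc d => (z, v)) (x := z₀) (continuousAt_norm_tmap hO hθ hz₀ v) (by fun_prop)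
    exact (h1.eventually_lt continuousAt_const (lt_add_one _)).mono fun z hz => hz.le
  set η := ε' / (2 * (A / c) * C * R₂) with hη
  have hη0 : 0 < η := by positivity
  refine ⟨η, hη0, ?_⟩
  have hS := eventually_forall_sasakiEDist_tmap_lt hO hθ' hz₀ (A / c) (half_pos hε')
  have hF := eventually_forall_form_mul_le hO hθ hpos hz₀ ℓ v hε₁ hsize
  have hOe : ∀ᶠ z in 𝓝 z₀, z ∈ O := hO.mem_nhds hz₀
  rw [nhds_prod_eq] at hS hF ⊢
  filter_upwards [hS, hF, hc.prod_inl _, hv.prod_inr _, hOe.prod_inr _]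
    with x h1 h2 h3 h4 h5 w Δ hw hΔ
  have hwR : ‖w‖ ≤ A / c := by
    rw [le_div_iff₀ hc0, mul_comm]; exact (h3 w).trans hw
  refine (sasakiEDist_triangle _ (tmap θ' x.2 w) _).trans ?_
  have e1 := h1 w (by simpa using hwR)
  have e2 : sasakiEDist (tmap θ' x.2 w) (tmap θ' x.2 (w + Δ • v)) ≤
      ENNReal.ofReal (|Δ| * ‖(tmap θ' x.2 v).2‖) := by
    refine (sasakiEDist_vertical (θ' x.2) (tderiv θ' x.2 w) (tderiv θ' x.2 (w + Δ • v))).trans ?_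
    rw [← map_sub, add_sub_cancel_left, ← norm_tmap_smul]
    exact le_rfl
  refine (add_le_add e1.le e2).trans ?_
  have nv := nn _ (tmap θ' x.2 v).2
  rw [← ENNReal.ofReal_add (by positivity) (by positivity)]
  refine ENNReal.ofReal_le_ofReal ?_
  have e3 : |Δ| * ‖(tmap θ' x.2 v).2‖ ≤
      (β * |ℓ w| + η * ‖w‖) * (C * ‖(tmap θ x.2 v).2‖) :=
    mul_le_mul hΔ (hθθ' _ h5 v) nv ((abs_nonneg _).trans hΔ)
  have e4 := h2 w
  have e5 : 2 * ε₁ * ‖(tmap θ x.1 w).2‖ * C ≤ 2 * ε₁ * A * C := by gcongr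
  have e6 : η * ‖w‖ * C * ‖(tmap θ x.2 v).2‖ ≤ η * (A / c) * C * R₂ := by
    gcongr
  have e7 : η * (A / c) * C * R₂ = ε' / 2 := by rw [hη]; field_simp
  have e8 : β * |ℓ w| * ‖(tmap θ x.2 v).2‖ * C ≤ 2 * ε₁ * ‖(tmap θ x.1 w).2‖ * C := by gcongr
  nlinarith

end LocalEstimates

/-! ### Iterates read in a chart -/

section ChartOrbit

variable {d : ℕ} {M : Type*} [TopologicalSpace M] [ChartedSpace (Euc d) M]
  [IsManifold (𝓡 d) ∞ M]

/-- The `i`-th iterate of `f`, read from the chart around `q`. -/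
noncomputable def chartOrbit (f : M ≃ₘ^1⟮𝓡 d, 𝓡 d⟯ M) (q : M) (i : ℕ) : Euc d → M :=
  f^[i] ∘ (extChartAt (𝓡 d) q).symm

variable (f : M ≃ₘ^1⟮𝓡 d, 𝓡 d⟯ M) (q : M)

theorem contMDiff_iterate (i : ℕ) : ContMDiff (𝓡 d) (𝓡 d) 1 f^[i] := by
  rw [← coe_iterateDiffeo]; exact (iterateDiffeo f i).contMDiff

theorem mdifferentiable_iterate (i : ℕ) : MDifferentiable (𝓡 d) (𝓡 d) f^[i] :=
  (contMDiff_iterate f i).mdifferentiable one_ne_zero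

theorem contMDiffOn_chartOrbit (i : ℕ) :
    ContMDiffOn 𝓘(ℝ, Euc d) (𝓡 d) 1 (chartOrbit f q i) (extChartAt (𝓡 d) q).target :=
  (contMDiff_iterate f i).comp_contMDiffOn (contMDiffOn_extChartAt_symm q)

variable {q}

theorem mdifferentiableAt_chartOrbit (i : ℕ) {z : Euc d} (hz : z ∈ (extChartAt (𝓡 d) q).target) :
    MDifferentiableAt 𝓘(ℝ, Euc d) (𝓡 d) (chartOrbit f q i) z :=
  ((contMDiffOn_chartOrbit f q i).contMDiffAt
    ((isOpen_extChartAt_target q).mem_nhds hz)).mdifferentiableAt one_ne_zero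

theorem tmap_chartOrbit_add (i j : ℕ) {z : Euc d} (hz : z ∈ (extChartAt (𝓡 d) q).target)
    (w : Euc d) : tmap (chartOrbit f q (j + i)) z w =
      tangentMap (𝓡 d) (𝓡 d) f^[j] (tmap (chartOrbit f q i) z w) := by
  rw [← tmap_comp (mdifferentiable_iterate f j _) (mdifferentiableAt_chartOrbit f i hz)]
  congr 1
  funext y
  simp only [chartOrbit, Function.comp, Function.iterate_add_apply]

theorem tmap_chartOrbit_succ (i : ℕ) {z : Euc d} (hz : z ∈ (extChartAt (𝓡 d) q).target)
    (w : Euc d) : tmap (chartOrbit f q (i + 1)) z w =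
      tangentMap (𝓡 d) (𝓡 d) f (tmap (chartOrbit f q i) z w) := by
  rw [add_comm, tmap_chartOrbit_add f i 1 hz]; rfl

theorem tangentMap_symm_iterate (j : ℕ) (u : TangentBundle (𝓡 d) M) :
    tangentMap (𝓡 d) (𝓡 d) f.symm^[j] (tangentMap (𝓡 d) (𝓡 d) f^[j] u) = u := by
  have h1 := tangentMap_comp_at (I := 𝓡 d) (I' := 𝓡 d) (I'' := 𝓡 d) (f := f^[j])
    (g := f.symm^[j]) u (mdifferentiable_iterate f.symm j _) (mdifferentiable_iterate f j _)
  rw [← h1, (Function.LeftInverse.id (Function.LeftInverse.iterate f.symm_apply_apply j) :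
    f.symm^[j] ∘ f^[j] = id), tangentMap_id]
  rfl

theorem tangentMap_symm_apply (u : TangentBundle (𝓡 d) M) :
    tangentMap (𝓡 d) (𝓡 d) f.symm (tangentMap (𝓡 d) (𝓡 d) f u) = u :=
  tangentMap_symm_iterate f 1 u

theorem tderiv_comp_eq_zero {θ : Euc d → M} {z w : Euc d} (h : tderiv θ z w = 0) {g : M → M}
    (hg : MDifferentiableAt (𝓡 d) (𝓡 d) g (θ z))
    (hθ : MDifferentiableAt 𝓘(ℝ, Euc d) (𝓡 d) θ z) : tderiv (g ∘ θ) z w = 0 := by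
  have : tderiv (g ∘ θ) z w = mfderiv (𝓡 d) (𝓡 d) g (θ z) (tderiv θ z w) := by
    unfold tderiv
    rw [mfderiv_comp z hg hθ]
    rfl
  rw [this, h]
  exact map_zero _

variable [RiemannianBundle (fun x : M => TangentSpace (𝓡 d) x)]

theorem tderiv_chartOrbit_injective (i : ℕ) {z : Euc d}
    (hz : z ∈ (extChartAt (𝓡 d) q).target) :
    Function.Injective (tderiv (chartOrbit f q i) z) := by
  refine (injective_iff_map_eq_zero _).2 fun w hw => ?_
  have h1 := tderiv_comp_eq_zero hw (mdifferentiable_iterate f.symm i _)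
    (mdifferentiableAt_chartOrbit f i hz)
  have h2 : f.symm^[i] ∘ chartOrbit f q i = (extChartAt (𝓡 d) q).symm := by
    funext y
    exact Function.LeftInverse.iterate f.symm_apply_apply i _
  rw [← chartCoord_chartVector hz w]
  have h3 : chartVector q z w = 0 := by
    have := congrArg (fun θ : Euc d → M => (tderiv θ z w : Euc d)) h2
    exact (this.symm.trans h1 :)
  rw [h3]
  exact map_zero _

theorem exists_eq_tmap_chartOrbit (i : ℕ) {z : Euc d}
    (hz : z ∈ (extChartAt (𝓡 d) q).target) (u : TangentBundle (𝓡 d) M)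
    (hu : u.1 = chartOrbit f q i z) : ∃ w, u = tmap (chartOrbit f q i) z w := by
  obtain ⟨x, u⟩ := u
  obtain rfl : x = chartOrbit f q i z := hu
  let L : Euc d →ₗ[ℝ] Euc d := tderiv (chartOrbit f q i) z
  have hL : Function.Surjective L :=
    LinearMap.injective_iff_surjective.1 (tderiv_chartOrbit_injective f i hz)
  obtain ⟨w, hw⟩ := hL u
  exact ⟨w, by rw [tmap]; congr 1; exact hw.symm⟩

theorem norm_tmap_chartOrbit_pos (i : ℕ) {z : Euc d}
    (hz : z ∈ (extChartAt (𝓡 d) q).target) {w : Euc d} (hw : w ≠ 0) :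
    0 < ‖(tmap (chartOrbit f q i) z w).2‖ := by
  have key : ∀ (x : M) (u : TangentSpace (𝓡 d) x), u ≠ 0 → 0 < ‖u‖ := fun x u => norm_pos_iff.2
  refine key _ _ fun h => hw ?_
  exact (injective_iff_map_eq_zero _).1 (tderiv_chartOrbit_injective f i hz) w h

theorem norm_tangentMap_le {g : M → M} {C : ℝ}
    (hC : ∀ x, ‖mfderiv (𝓡 d) (𝓡 d) g x‖ ≤ C) (u : TangentBundle (𝓡 d) M) :
    ‖(tangentMap (𝓡 d) (𝓡 d) g u).2‖ ≤ C * ‖u.2‖ :=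
  (mfderiv (𝓡 d) (𝓡 d) g u.1).le_of_opNorm_le (hC u.1) u.2

theorem lt_norm_mfderiv {g : M → M} {K : ℝ} {u : TangentBundle (𝓡 d) M}
    (h : K * ‖u.2‖ < ‖(tangentMap (𝓡 d) (𝓡 d) g u).2‖) : K < ‖mfderiv (𝓡 d) (𝓡 d) g u.1‖ := by
  by_contra hle
  exact absurd ((mfderiv (𝓡 d) (𝓡 d) g u.1).le_of_opNorm_le (not_lt.1 hle) u.2) (not_le.2 h)

end ChartOrbit

/-! ### Perturbations supported on a tower -/

section Cutoff

/-- Smooth cutoff functions, with a bound on their derivatives. -/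
theorem exists_cutoff {d : ℕ} {Δ U : Set (Euc d)} (hΔ : IsCompact Δ) (hU : IsOpen U)
    (hΔU : Δ ⊆ U) :
    ∃ (χ : Euc d → ℝ) (L : Set (Euc d)) (D : ℝ), ContDiff ℝ 1 χ ∧ IsCompact L ∧ L ⊆ U ∧
      (∀ z, 0 ≤ χ z) ∧ (∀ z, χ z ≤ 1) ∧ (∀ z, ‖fderiv ℝ χ z‖ ≤ D) ∧ (∀ z ∉ L, χ z = 0) ∧
      ∀ z ∈ Δ, χ =ᶠ[𝓝 z] 1 := by
  obtain ⟨L, hL, hΔL, hLU⟩ := exists_compact_between hΔ hU hΔU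
  obtain ⟨χ, h1, h0, h01⟩ := exists_contMDiffMap_one_nhds_of_subset_interior
    (I := 𝓘(ℝ, Euc d)) (n := 1) hΔ.isClosed hΔL
  have hχ : ContDiff ℝ 1 χ := χ.contMDiff.contDiff
  have hs : HasCompactSupport χ := HasCompactSupport.intro hL h0
  obtain ⟨D, hD⟩ := (hs.fderiv (𝕜 := ℝ)).exists_bound_of_continuous
    (hχ.continuous_fderiv one_ne_zero)
  exact ⟨χ, L, D, hχ, hL, hLU, fun z => (h01 z).1, fun z => (h01 z).2, hD, h0,
    fun z hz => (h1.filter_mono (nhds_le_nhdsSet hz) :)⟩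

end Cutoff

section Tower

variable {d : ℕ} {M : Type*} [TopologicalSpace M] [ChartedSpace (Euc d) M]
  [IsManifold (𝓡 d) ∞ M]

theorem tangentMap_congr {f g : M → M} (u : TangentBundle (𝓡 d) M) (h : f =ᶠ[𝓝 u.1] g) :
    tangentMap (𝓡 d) (𝓡 d) f u = tangentMap (𝓡 d) (𝓡 d) g u := by
  unfold tangentMap
  have h1 := h.mfderiv_eq (I := 𝓡 d) (I' := 𝓡 d)
  have h2 := h.eq_of_nhds
  congr 1
  rw [h1]; rfl

theorem Diffeomorph.symm_eventuallyEq {f g : M ≃ₘ^1⟮𝓡 d, 𝓡 d⟯ M} {x : M}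
    (h : f =ᶠ[𝓝 (f.symm x)] g) : f.symm =ᶠ[𝓝 x] g.symm := by
  filter_upwards [f.symm.continuous.continuousAt.eventually h] with y hy
  rw [f.apply_symm_apply] at hy
  have h1 : g.symm y = f.symm y := by conv_lhs => rw [hy, g.symm_apply_apply]
  exact h1.symm

theorem Diffeomorph.fderiv_surjective (F : Euc d ≃ₘ^1⟮𝓘(ℝ, Euc d), 𝓘(ℝ, Euc d)⟯ Euc d) (z : Euc d) :
    Function.Surjective (fderiv ℝ F z) := by
  have hF : ∀ F : Euc d ≃ₘ^1⟮𝓘(ℝ, Euc d), 𝓘(ℝ, Euc d)⟯ Euc d, Differentiable ℝ F := fun F =>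
    F.contMDiff.contDiff.differentiable one_ne_zero
  intro w
  refine ⟨fderiv ℝ F.symm (F z) w, ?_⟩
  have h1 : HasFDerivAt (F ∘ F.symm) ((fderiv ℝ F z).comp (fderiv ℝ F.symm (F z))) (F z) := by
    refine HasFDerivAt.comp (F z) ?_ (hF F.symm _).hasFDerivAt
    rw [F.symm_apply_apply]
    exact (hF F z).hasFDerivAt
  have h2 : F ∘ F.symm = id := funext F.apply_symm_apply
  rw [h2] at h1
  have h3 := h1.unique (hasFDerivAt_id _)
  exact DFunLike.congr_fun h3 w

/-- `g` acts on the tower `U ∪ f(U) ∪ ⋯ ∪ f^(N-1)(U)` through the diffeomorphisms `F i`, read in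
the chart around `q`: it maps `f^i (F i z)` to `f^(i+1) (F (i+1) z)`. Off the tower it is `f`. -/
structure IsTowerPerturbation (f g : M ≃ₘ^1⟮𝓡 d, 𝓡 d⟯ M) (q : M) (U : Set (Euc d)) (N : ℕ)
    (F : ℕ → (Euc d ≃ₘ^1⟮𝓘(ℝ, Euc d), 𝓘(ℝ, Euc d)⟯ Euc d)) : Prop where
  step : ∀ z ∈ U, ∀ i < N, g (chartOrbit f q i (F i z)) = chartOrbit f q (i + 1) (F (i + 1) z)
  iterate : ∀ z ∈ U, ∀ i ≤ N, g^[i] ((extChartAt (𝓡 d) q).symm z) = chartOrbit f q i (F i z)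
  off : ∀ x, (∀ i < N, ∀ z ∈ U, chartOrbit f q i z ≠ x) → f =ᶠ[𝓝 x] g
  maps : ∀ i, ∀ z ∈ U, F i z ∈ U
  maps_symm : ∀ i, ∀ z ∈ U, (F i).symm z ∈ U

theorem exists_isTowerPerturbation [T2Space M] (f : M ≃ₘ^1⟮𝓡 d, 𝓡 d⟯ M) (q : M) {U k : Set (Euc d)}
    (hUt : U ⊆ (extChartAt (𝓡 d) q).target) (hk : IsCompact k) (hkU : k ⊆ U)
    (F : ℕ → (Euc d ≃ₘ^1⟮𝓘(ℝ, Euc d), 𝓘(ℝ, Euc d)⟯ Euc d)) (hF : ∀ i, ∀ z ∉ k, F i z = z)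
    (h0 : ∀ z, F 0 z = z) (N : ℕ)
    (hdisj : ∀ i < N, ∀ j < N, i ≠ j →
      Disjoint (f^[i] '' ((extChartAt (𝓡 d) q).symm '' U))
        (f^[j] '' ((extChartAt (𝓡 d) q).symm '' U))) :
    ∃ g, IsTowerPerturbation f g q U N F := by
  choose Ψ hΨ1 hΨ2 using fun i => exists_diffeomorph_of_chart q hk (hkU.trans hUt) (F i) (hF i)
  have hsurj : ∀ x, x ∈ (extChartAt (𝓡 d) q).symm '' U → Ψ 0 x = x := by
    rintro _ ⟨z, hz, rfl⟩
    rw [hΨ1 0 z (hUt hz), h0]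
  obtain ⟨g, hg1, hg2, hg3⟩ := exists_tower_perturbation f Ψ (image_mono hkU) hΨ2
    (fun x => by
      by_cases hx : x ∈ (extChartAt (𝓡 d) q).symm '' k
      · exact hsurj x (image_mono hkU hx)
      · exact hΨ2 0 x hx) N hdisj
  have hmaps : ∀ i, ∀ z ∈ U, F i z ∈ U := by
    intro i z hz
    by_contra h
    have := hF i _ fun h' => h (hkU h')
    rw [(F i).injective this] at h
    exact h hz
  refine ⟨g, fun z hz i hi => ?_, fun z hz i hi => ?_, fun x hx => ?_, hmaps, fun i z hz => ?_⟩
  · have := hg1 _ ⟨z, hz, rfl⟩ i hi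
    rwa [hΨ1 i z (hUt hz), hΨ1 (i + 1) z (hUt hz)] at this
  · have := hg2 _ ⟨z, hz, rfl⟩ i hi
    rwa [hΨ1 i z (hUt hz)] at this
  · have hcl : IsClosed (⋃ j ∈ Finset.range N, f^[j] '' ((extChartAt (𝓡 d) q).symm '' k)) := by
      refine isClosed_biUnion_finset fun j _ => (IsCompact.image ?_ ?_).isClosed
      · exact hk.image_of_continuousOn
          ((continuousOn_extChartAt_symm q).mono (hkU.trans hUt))
      · exact f.continuous.iterate j
    have hxc : x ∉ ⋃ j ∈ Finset.range N, f^[j] '' ((extChartAt (𝓡 d) q).symm '' k) := by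
      simp only [mem_iUnion, not_exists, Finset.mem_range]
      rintro j hj ⟨_, ⟨z, hz, rfl⟩, hzx⟩
      exact hx j hj z (hkU hz) hzx
    filter_upwards [hcl.isOpen_compl.mem_nhds hxc] with y hy
    refine (hg3 y fun j hj hyj => hy ?_).symm
    exact mem_biUnion (Finset.mem_coe.2 (Finset.mem_range.2 hj)) hyj
  · by_contra h
    have := hF i _ fun h' => h (hkU h')
    rw [(F i).apply_symm_apply] at this
    rw [← this] at h
    exact h hz

variable {f g : M ≃ₘ^1⟮𝓡 d, 𝓡 d⟯ M} {q : M} {U : Set (Euc d)} {N : ℕ}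
  {F : ℕ → (Euc d ≃ₘ^1⟮𝓘(ℝ, Euc d), 𝓘(ℝ, Euc d)⟯ Euc d)}

namespace IsTowerPerturbation

theorem tmap_step (h : IsTowerPerturbation f g q U N F) (hU : IsOpen U)
    (hUt : U ⊆ (extChartAt (𝓡 d) q).target) {z : Euc d} (hz : z ∈ U) {i : ℕ} (hi : i < N)
    (w : Euc d) :
    tangentMap (𝓡 d) (𝓡 d) g (tmap (chartOrbit f q i) (F i z) (fderiv ℝ (F i) z w)) =
      tmap (chartOrbit f q (i + 1)) (F (i + 1) z) (fderiv ℝ (F (i + 1)) z w) := by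
  have hFd : ∀ i, DifferentiableAt ℝ (F i) z := fun i =>
    (F i).contMDiff.contDiff.differentiable one_ne_zero z
  have ht : ∀ i, F i z ∈ (extChartAt (𝓡 d) q).target := fun i => hUt (h.maps i z hz)
  rw [← tmap_comp_right (mdifferentiableAt_chartOrbit f i (ht i)) (hFd i),
    ← tmap_comp_right (mdifferentiableAt_chartOrbit f (i + 1) (ht (i + 1))) (hFd (i + 1)),
    ← tmap_comp (g.contMDiff.mdifferentiable one_ne_zero _)
      ((mdifferentiableAt_chartOrbit f i (ht i)).comp z (hFd i).mdifferentiableAt)]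
  refine tmap_congr ?_ w
  filter_upwards [hU.mem_nhds hz] with y hy
  exact h.step y hy i hi

theorem tmap_iterate (h : IsTowerPerturbation f g q U N F) (hU : IsOpen U)
    (hUt : U ⊆ (extChartAt (𝓡 d) q).target) {z : Euc d} (hz : z ∈ U) {i : ℕ} (hi : i ≤ N)
    (w : Euc d) :
    tangentMap (𝓡 d) (𝓡 d) g^[i] (tmap (extChartAt (𝓡 d) q).symm z w) =
      tmap (chartOrbit f q i) (F i z) (fderiv ℝ (F i) z w) := by
  have hFd : DifferentiableAt ℝ (F i) z :=
    (F i).contMDiff.contDiff.differentiable one_ne_zero z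
  have ht : F i z ∈ (extChartAt (𝓡 d) q).target := hUt (h.maps i z hz)
  rw [← tmap_comp_right (mdifferentiableAt_chartOrbit f i ht) hFd,
    ← tmap_comp (θ := (extChartAt (𝓡 d) q).symm) (mdifferentiable_iterate g i _)
      (mdifferentiableAt_chartOrbit f 0 (hUt hz))]
  refine tmap_congr ?_ w
  filter_upwards [hU.mem_nhds hz] with y hy
  exact h.iterate y hy i hi

theorem isTidyPerturbation (h : IsTowerPerturbation f g q U N F) (hN : 1 ≤ N)
    (hend : ∀ z, F N z = z)
    (hdisj : ∀ i < N, ∀ j < N, i ≠ j →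
      Disjoint (f^[i] '' closure ((extChartAt (𝓡 d) q).symm '' U))
        (f^[j] '' closure ((extChartAt (𝓡 d) q).symm '' U)))
    (hexit : ∀ x, ∃ m : ℤ, (f.toHomeomorph ^ m) x ∉
      closure (iteratesUnion f ((extChartAt (𝓡 d) q).symm '' U) N)) :
    IsTidyPerturbation f.toHomeomorph g.toHomeomorph
      (iteratesUnion f ((extChartAt (𝓡 d) q).symm '' U) N) := by
  refine isTidyPerturbation_of_return (f := f.toHomeomorph) (g := g.toHomeomorph) hN hdisj hexit
    (fun x hx => ?_) ?_ ?_ ?_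
  · refine ((h.off x fun i hi z hz hzx => hx ?_).eq_of_nhds).symm
    exact mem_iteratesUnion.2 ⟨i, hi, _, ⟨z, hz, rfl⟩, hzx⟩
  · rintro _ ⟨z, hz, rfl⟩ i hi
    exact ⟨_, ⟨F i z, h.maps i z hz, rfl⟩, (h.iterate z hz i hi.le).symm⟩
  · rintro _ ⟨z, hz, rfl⟩ i hi
    refine ⟨_, ⟨(F i).symm z, h.maps_symm i z hz, rfl⟩, ?_⟩
    have := h.iterate _ (h.maps_symm i z hz) i hi.le
    rw [(F i).apply_symm_apply] at this
    exact this
  · rintro _ ⟨z, hz, rfl⟩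
    have := h.iterate z hz N le_rfl
    rw [hend] at this
    exact this

variable [RiemannianBundle (fun x : M => TangentSpace (𝓡 d) x)]

/-- The `C¹` distance between `f` and `g` is controlled by what happens along the tower. -/
theorem c1EDist_le (h : IsTowerPerturbation f g q U N F) (hU : IsOpen U)
    (hUt : U ⊆ (extChartAt (𝓡 d) q).target) {C : ℝ}
    (hC0 : 0 ≤ C)
    (hC : ∀ u : TangentBundle (𝓡 d) M, ‖(tangentMap (𝓡 d) (𝓡 d) f.symm u).2‖ ≤ C * ‖u.2‖)
    {r : ℝ≥0∞}
    (hfwd : ∀ i < N, ∀ z ∈ U, ∀ w, ‖(tmap (chartOrbit f q i) (F i z) (fderiv ℝ (F i) z w)).2‖ ≤ 1 →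
      sasakiEDist (tmap (chartOrbit f q (i + 1)) (F i z) (fderiv ℝ (F i) z w))
        (tmap (chartOrbit f q (i + 1)) (F (i + 1) z) (fderiv ℝ (F (i + 1)) z w)) ≤ r)
    (hbwd : ∀ i < N, ∀ z ∈ U, ∀ w,
      ‖(tmap (chartOrbit f q i) (F (i + 1) z) (fderiv ℝ (F (i + 1)) z w)).2‖ ≤ C →
      sasakiEDist (tmap (chartOrbit f q i) (F (i + 1) z) (fderiv ℝ (F (i + 1)) z w))
        (tmap (chartOrbit f q i) (F i z) (fderiv ℝ (F i) z w)) ≤ r) :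
    c1EDist f g ≤ r + r := by
  refine add_le_add (iSup₂_le fun u hu => ?_) (iSup₂_le fun u hu => ?_)
  · by_cases hx : ∃ i < N, ∃ z ∈ U, chartOrbit f q i z = u.1
    · obtain ⟨i, hi, z', hz', hx⟩ := hx
      obtain ⟨w', rfl⟩ := exists_eq_tmap_chartOrbit f i (hUt hz') u hx.symm
      obtain ⟨z, hz, rfl⟩ : ∃ z ∈ U, F i z = z' :=
        ⟨_, h.maps_symm i z' hz', (F i).apply_symm_apply z'⟩
      obtain ⟨w, rfl⟩ := (F i).fderiv_surjective z w'
      rw [h.tmap_step hU hUt hz hi, ← tmap_chartOrbit_succ f i (hUt hz')]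
      exact hfwd i hi z hz w hu
    · push Not at hx
      rw [tangentMap_congr u (h.off u.1 hx), sasakiEDist_self]
      exact zero_le
  · by_cases hx : ∃ i < N, ∃ z ∈ U, chartOrbit f q (i + 1) z = u.1
    · obtain ⟨i, hi, z', hz', hx⟩ := hx
      obtain ⟨w', rfl⟩ := exists_eq_tmap_chartOrbit f (i + 1) (hUt hz') u hx.symm
      obtain ⟨z, hz, rfl⟩ : ∃ z ∈ U, F (i + 1) z = z' :=
        ⟨_, h.maps_symm (i + 1) z' hz', (F (i + 1)).apply_symm_apply z'⟩
      obtain ⟨w, rfl⟩ := (F (i + 1)).fderiv_surjective z w'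
      have e1 := tmap_chartOrbit_succ f i (hUt hz') (fderiv ℝ (F (i + 1)) z w)
      have e2 := h.tmap_step hU hUt hz hi w
      have e3 := congrArg (tangentMap (𝓡 d) (𝓡 d) f.symm) e1
      have e4 := congrArg (tangentMap (𝓡 d) (𝓡 d) g.symm) e2
      rw [tangentMap_symm_apply] at e3 e4
      have h5 := hC (tmap (chartOrbit f q (i + 1)) (F (i + 1) z) (fderiv ℝ (F (i + 1)) z w))
      rw [e3] at h5 ⊢
      rw [← e4]
      refine hbwd i hi z hz w (h5.trans ?_)
      nlinarith
    · push Not at hx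
      have : f =ᶠ[𝓝 (f.symm u.1)] g := by
        refine h.off _ fun i hi z hz hzx => hx i hi z hz ?_
        rw [← f.apply_symm_apply u.1, ← hzx]
        simp only [chartOrbit, Function.comp, Function.iterate_succ_apply']
      rw [tangentMap_congr u (Diffeomorph.symm_eventuallyEq this), sasakiEDist_self]
      exact zero_le

end IsTowerPerturbation

end Tower

/-! ### Inserting a family of shears -/

section Engine

variable {d : ℕ} {M : Type*} [TopologicalSpace M] [T2Space M] [ChartedSpace (Euc d) M]
  [IsManifold (𝓡 d) ∞ M] [RiemannianBundle (fun x : M => TangentSpace (𝓡 d) x)]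
  [IsContMDiffRiemannianBundle (𝓡 d) 1 (Euc d) (fun x : M => TangentSpace (𝓡 d) x)]
  [IsContinuousRiemannianBundle (Euc d) (fun x : M => TangentSpace (𝓡 d) x)]

/-- Near the orbit of `q`, moving the base point and adding to a tangent vector a small multiple
of `v` has a small cost for the Sasaki distance, before and after applying `f`. -/
theorem exists_forall_sasakiEDist_shear_le (f : M ≃ₘ^1⟮𝓡 d, 𝓡 d⟯ M) (q : M) (N : ℕ)
    {C ε : ℝ} (hC : 0 < C)
    (hε : 0 < ε)
    (hf : ∀ u : TangentBundle (𝓡 d) M, ‖(tangentMap (𝓡 d) (𝓡 d) f u).2‖ ≤ C * ‖u.2‖)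
    {ℓ : Euc d →L[ℝ] ℝ} {v : Euc d} {b : ℕ → ℝ} {δ : ℝ}
    (hsize : ∀ i < N, ∀ w, b i / (2 * δ) * |ℓ w| *
        ‖(tmap (chartOrbit f q i) (extChartAt (𝓡 d) q q) v).2‖ ≤
      ε / (16 * C) * ‖(tmap (chartOrbit f q i) (extChartAt (𝓡 d) q q) w).2‖) :
    ∃ η > 0, ∀ᶠ x : Euc d × Euc d in 𝓝 (extChartAt (𝓡 d) q q, extChartAt (𝓡 d) q q),
      ∀ i < N, ∀ (w : Euc d) (Δ : ℝ), |Δ| ≤ b i / (2 * δ) * |ℓ w| + η * ‖w‖ →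
        (‖(tmap (chartOrbit f q i) x.1 w).2‖ ≤ 1 →
          sasakiEDist (tmap (chartOrbit f q (i + 1)) x.1 w)
            (tmap (chartOrbit f q (i + 1)) x.2 (w + Δ • v)) ≤ ENNReal.ofReal (ε / 4)) ∧
        (‖(tmap (chartOrbit f q i) x.1 w).2‖ ≤ C →
          sasakiEDist (tmap (chartOrbit f q i) x.1 w)
            (tmap (chartOrbit f q i) x.2 (w + Δ • v)) ≤ ENNReal.ofReal (ε / 4)) := by
  have hO : IsOpen (extChartAt (𝓡 d) q).target := isOpen_extChartAt_target q
  have key : ∀ i < N, ∀ᶠ η in 𝓝[>] (0 : ℝ),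
      ∀ᶠ x : Euc d × Euc d in 𝓝 (extChartAt (𝓡 d) q q, extChartAt (𝓡 d) q q),
      ∀ (w : Euc d) (Δ : ℝ), |Δ| ≤ b i / (2 * δ) * |ℓ w| + η * ‖w‖ →
        (‖(tmap (chartOrbit f q i) x.1 w).2‖ ≤ 1 →
          sasakiEDist (tmap (chartOrbit f q (i + 1)) x.1 w)
            (tmap (chartOrbit f q (i + 1)) x.2 (w + Δ • v)) ≤ ENNReal.ofReal (ε / 4)) ∧
        (‖(tmap (chartOrbit f q i) x.1 w).2‖ ≤ C →
          sasakiEDist (tmap (chartOrbit f q i) x.1 w)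
            (tmap (chartOrbit f q i) x.2 (w + Δ • v)) ≤ ENNReal.ofReal (ε / 4)) := by
    intro i hi
    have hpos : ∀ z ∈ (extChartAt (𝓡 d) q).target, ∀ w, w ≠ 0 →
        0 < ‖(tmap (chartOrbit f q i) z w).2‖ := fun z hz w => norm_tmap_chartOrbit_pos f i hz
    obtain ⟨η₁, hη₁, h1⟩ := eventually_sasakiEDist_tmap_add_le hO (contMDiffOn_chartOrbit f q i)
      (contMDiffOn_chartOrbit f q (i + 1)) hpos (mem_extChartAt_target q) one_pos hC
      (fun z hz w => by rw [tmap_chartOrbit_succ f i hz]; exact hf _) ℓ v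
      (by positivity : 0 < ε / (16 * C)) (by positivity : 0 < ε / 8) (hsize i hi)
    obtain ⟨η₂, hη₂, h2⟩ := eventually_sasakiEDist_tmap_add_le hO (contMDiffOn_chartOrbit f q i)
      (contMDiffOn_chartOrbit f q i) hpos (mem_extChartAt_target q) hC one_pos
      (fun z hz w => (one_mul _).ge) ℓ v
      (by positivity : 0 < ε / (16 * C)) (by positivity : 0 < ε / 8) (hsize i hi)
    have e1 : 2 * (ε / (16 * C)) * 1 * C + ε / 8 = ε / 4 := by field_simp; norm_num
    have e2 : 2 * (ε / (16 * C)) * C * 1 + ε / 8 = ε / 4 := by field_simp; norm_num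
    rw [e1] at h1
    rw [e2] at h2
    filter_upwards [Ioo_mem_nhdsGT (lt_min hη₁ hη₂)] with η hη
    filter_upwards [h1, h2] with x hx1 hx2 w Δ hΔ
    refine ⟨fun hw => hx1 w Δ hw (hΔ.trans ?_), fun hw => hx2 w Δ hw (hΔ.trans ?_)⟩
    · gcongr; exact (hη.2.le.trans (min_le_left _ _))
    · gcongr; exact (hη.2.le.trans (min_le_right _ _))
  have key2 := (Filter.eventually_all_finset (Finset.range N)).2
    fun i hi => key i (Finset.mem_range.1 hi)
  obtain ⟨η, hη, hη0⟩ := (key2.and self_mem_nhdsWithin).exists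
  refine ⟨η, hη0, ?_⟩
  filter_upwards [(Filter.eventually_all_finset (Finset.range N)).2 hη] with x hx i hi
  exact hx i (Finset.mem_range.2 hi)

/-- Near a point `q`, the diffeomorphism `f` can be perturbed by inserting a family of shears with
given profiles along its orbits: over a given compact set `Δ` the iterates of the perturbation are
exactly those of `f`, composed with linear shears. -/
theorem ShearProfile.exists_perturbation (f : M ≃ₘ^1⟮𝓡 d, 𝓡 d⟯ M) (q : M) {N : ℕ} (hN : 1 ≤ N)
    {C ε : ℝ} (hC : 0 < C) (hε : 0 < ε)
    (hf : ∀ u : TangentBundle (𝓡 d) M, ‖(tangentMap (𝓡 d) (𝓡 d) f u).2‖ ≤ C * ‖u.2‖)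
    (hf' : ∀ u : TangentBundle (𝓡 d) M, ‖(tangentMap (𝓡 d) (𝓡 d) f.symm u).2‖ ≤ C * ‖u.2‖)
    {ℓ : Euc d →L[ℝ] ℝ} {v : Euc d} {σ : ℕ → ℝ → ℝ} {b : ℕ → ℝ} {S B δ : ℝ}
    (h : ShearProfile ℓ v σ b S B δ) (h0 : ∀ u, σ 0 u = 0) (h1 : ∀ u, σ N u = 0)
    (hsize : ∀ i < N, ∀ w, b i / (2 * δ) * |ℓ w| *
        ‖(tmap (chartOrbit f q i) (extChartAt (𝓡 d) q q) v).2‖ ≤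
      ε / (16 * C) * ‖(tmap (chartOrbit f q i) (extChartAt (𝓡 d) q q) w).2‖)
    {O : Set (Euc d)} (hO : O ∈ 𝓝 (extChartAt (𝓡 d) q q)) :
    ∃ W : Set M, IsOpen W ∧ q ∈ W ∧ ∀ U ⊆ W, IsOpen U →
      (∀ i < N, ∀ j < N, i ≠ j → Disjoint (f^[i] '' closure U) (f^[j] '' closure U)) →
      (∀ x : M, ∃ m : ℤ, (f.toHomeomorph ^ m) x ∉ closure (iteratesUnion f U N)) →
      ∀ Δ ⊆ U, IsCompact Δ → ∃ g : M ≃ₘ^1⟮𝓡 d, 𝓡 d⟯ M,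
        c1EDist f g < ENNReal.ofReal ε ∧
        IsTidyPerturbation f.toHomeomorph g.toHomeomorph (iteratesUnion f U N) ∧
        ∀ x ∈ Δ, ∃ z ∈ O, z ∈ (extChartAt (𝓡 d) q).target ∧ (extChartAt (𝓡 d) q).symm z = x ∧
          ∃ t : ℝ, ∀ i ≤ N, ∃ z' ∈ O, z' ∈ (extChartAt (𝓡 d) q).target ∧ ∀ w,
            tangentMap (𝓡 d) (𝓡 d) g^[i] (tmap (extChartAt (𝓡 d) q).symm z w) =
              tmap (chartOrbit f q i) z' (w + (deriv (σ i) t * ℓ w) • v) := by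
  set c := extChartAt (𝓡 d) q with hc
  obtain ⟨η, hη, hev⟩ := exists_forall_sasakiEDist_shear_le f q N hC hε hf hsize
  rw [nhds_prod_eq] at hev
  obtain ⟨t, ht, htev⟩ := Filter.mem_prod_same_iff.1 hev
  obtain ⟨T, hT, hTo, hqT⟩ := mem_nhds_iff.1 (Filter.inter_mem ht hO)
  refine ⟨c.source ∩ c ⁻¹' T, isOpen_extChartAt_preimage' q hTo,
    ⟨mem_extChartAt_source q, hqT⟩, fun U hUW hU hdisj hexit Δ hΔU hΔ => ?_⟩
  set U' := c.target ∩ c.symm ⁻¹' U with hU'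
  have hU'o : IsOpen U' :=
    (continuousOn_extChartAt_symm q).isOpen_inter_preimage (isOpen_extChartAt_target q) hU
  have hU't : U' ⊆ c.target := inter_subset_left
  have hU'T : U' ⊆ T := by
    rintro z ⟨hz, hzU⟩
    have := (hUW hzU).2
    rwa [mem_preimage, c.right_inv hz] at this
  have himg : c.symm '' U' = U := by
    ext x
    constructor
    · rintro ⟨z, hz, rfl⟩; exact hz.2
    · intro hx
      have hxs := (hUW hx).1
      exact ⟨c x, ⟨c.map_source hxs, by rwa [mem_preimage, c.left_inv hxs]⟩, c.left_inv hxs⟩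
  have hΔ' : IsCompact (c '' Δ) :=
    hΔ.image_of_continuousOn ((continuousOn_extChartAt q).mono fun x hx => (hUW (hΔU hx)).1)
  have hΔ'U : c '' Δ ⊆ U' := by
    rintro _ ⟨x, hx, rfl⟩
    have hxs := (hUW (hΔU hx)).1
    exact ⟨c.map_source hxs, by rw [mem_preimage, c.left_inv hxs]; exact hΔU hx⟩
  obtain ⟨χ, L, D, hχ, hL, hLU, hχ0, hχ1, hD, hχL, hχΔ⟩ := exists_cutoff hΔ' hU'o hΔ'U
  obtain ⟨s, hs, F, hF, hFvar, hFΔ⟩ := h.exists_diffeomorph hχ hχ0 hχ1 hD hη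
  have hFL : ∀ i, ∀ z ∉ L, F i z = z := by
    intro i z hz
    rw [hF, ridge, hχL z hz]
    simp
  have hF0 : ∀ z, F 0 z = z := fun z => by rw [hF, ridge, h0]; simp
  have hFN : ∀ z, F N z = z := fun z => by rw [hF, ridge, h1]; simp
  obtain ⟨g, hg⟩ := exists_isTowerPerturbation f q hU't hL hLU F hFL hF0 N (by
    rw [← hc, himg]
    exact fun i hi j hj hij =>
      (hdisj i hi j hj hij).mono (image_mono subset_closure) (image_mono subset_closure))
  have hmem : ∀ i j, ∀ z ∈ U', (F i z, F j z) ∈ t ×ˢ t := fun i j z hz =>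
    ⟨(hT (hU'T (hg.maps i z hz))).1, (hT (hU'T (hg.maps j z hz))).1⟩
  refine ⟨g, ?_, ?_, ?_⟩
  · refine (hg.c1EDist_le hU'o hU't hC.le hf' (r := ENNReal.ofReal (ε / 4)) ?_ ?_).trans_lt ?_
    · intro i hi z hz w hw
      obtain ⟨Δ, hΔ1, hΔ2⟩ := hFvar i z w
      rw [hΔ1]
      exact (htev (hmem i (i + 1) z hz) i hi _ Δ (hΔ2 i)).1 hw
    · intro i hi z hz w hw
      obtain ⟨Δ, hΔ1, hΔ2⟩ := hFvar i z w
      have e : fderiv ℝ (F i) z w = fderiv ℝ (F (i + 1)) z w + (-Δ) • v := by rw [hΔ1]; module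
      rw [e]
      exact (htev (hmem (i + 1) i z hz) i hi _ (-Δ) (by rw [abs_neg]; exact hΔ2 (i + 1))).2 hw
    · rw [← ENNReal.ofReal_add (by positivity) (by positivity)]
      exact (ENNReal.ofReal_lt_ofReal_iff hε).2 (by linarith)
  · have := hg.isTidyPerturbation hN hFN
    rw [← hc, himg] at this
    exact this hdisj hexit
  · intro x hx
    have hz := hΔ'U ⟨x, hx, rfl⟩
    refine ⟨c x, (hT (hU'T hz)).2, hU't hz, c.left_inv (hUW (hΔU hx)).1, ℓ (c x) / s,
      fun i hi => ⟨F i (c x), (hT (hU'T (hg.maps i _ hz))).2, hU't (hg.maps i _ hz), fun w => ?_⟩⟩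
    rw [hg.tmap_iterate hU'o hU't hz hi, hFΔ (c x) (hχΔ _ ⟨x, hx, rfl⟩)]

end Engine

/-! ### Schedules and profiles of the shears -/

section Schedule

/-- The piecewise linear sequence which grows from `0` to `1` between the times `s` and `s + m`.
-/
noncomputable def ramp (m s i : ℕ) : ℝ := max 0 (min 1 (((i : ℝ) - s) / m))

theorem ramp_nonneg (m s i : ℕ) : 0 ≤ ramp m s i := le_max_left _ _

theorem ramp_le_one (m s i : ℕ) : ramp m s i ≤ 1 := max_le zero_le_one (min_le_left _ _)

theorem ramp_anti (m : ℕ) {s s' : ℕ} (h : s ≤ s') (i : ℕ) : ramp m s' i ≤ ramp m s i := by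
  unfold ramp
  have : (s : ℝ) ≤ s' := by exact_mod_cast h
  gcongr

theorem ramp_of_le {m s i : ℕ} (h : i ≤ s) : ramp m s i = 0 := by
  have h1 : (i : ℝ) ≤ s := by exact_mod_cast h
  have h2 : ((i : ℝ) - s) / m ≤ 0 := div_nonpos_of_nonpos_of_nonneg (by linarith) (by positivity)
  exact max_eq_left ((min_le_right _ _).trans h2)

theorem ramp_of_ge {m s i : ℕ} (hm : 1 ≤ m) (h : s + m ≤ i) : ramp m s i = 1 := by
  have h0 : (0 : ℝ) < m := by exact_mod_cast hm
  have h1 : (s : ℝ) + m ≤ i := by exact_mod_cast h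
  have h2 : 1 ≤ ((i : ℝ) - s) / m := by rw [le_div_iff₀ h0]; linarith
  unfold ramp
  rw [min_eq_left h2, max_eq_right zero_le_one]

theorem abs_ramp_succ_sub_le {m s i : ℕ} (hm : 1 ≤ m) :
    |ramp m s (i + 1) - ramp m s i| ≤ 1 / m := by
  have h0 : (0 : ℝ) < m := by exact_mod_cast hm
  have e : (((i + 1 : ℕ) : ℝ) - s) / m = ((i : ℝ) - s) / m + 1 / m := by push_cast; ring
  unfold ramp
  rw [e]
  have h1 : 0 < 1 / (m : ℝ) := by positivity
  rw [abs_le]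
  constructor <;> simp only [max_def, min_def] <;> split_ifs <;> linarith

/-- The sequence which grows from `0` to `1` between the times `s` and `s + m`, and comes back to
`0` between the times `s + n` and `s + n + m`. -/
noncomputable def trapezoid (m n s i : ℕ) : ℝ := ramp m s i - ramp m (s + n) i

theorem trapezoid_succ_eq {m n s i : ℕ} (hm : 1 ≤ m)
    (h : ∀ j ≤ 1, ∀ t < m, i ≠ s + t + j * n) :
    trapezoid m n s (i + 1) = trapezoid m n s i := by
  have key : ∀ s', (∀ t < m, i ≠ s' + t) → ramp m s' (i + 1) = ramp m s' i := by
    intro s' h'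
    rcases lt_or_ge i s' with hi | hi
    · rw [ramp_of_le hi.le, ramp_of_le hi]
    · have : s' + m ≤ i := by
        by_contra hlt
        exact h' (i - s') (by omega) (by omega)
      rw [ramp_of_ge hm this, ramp_of_ge hm (by omega)]
  unfold trapezoid
  rw [key s fun t ht => by simpa using h 0 (by omega) t ht,
    key (s + n) fun t ht => by have := h 1 (by omega) t ht; omega]

theorem abs_trapezoid_succ_sub_le {m n s i : ℕ} (hm : 1 ≤ m) (hmn : m ≤ n) :
    |trapezoid m n s (i + 1) - trapezoid m n s i| ≤ 1 / m := by
  unfold trapezoid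
  rcases le_or_gt (s + m) i with hi | hi
  · rw [ramp_of_ge hm hi, ramp_of_ge hm (hi.trans (Nat.le_succ i)), sub_sub_sub_cancel_left,
      abs_sub_comm]
    exact abs_ramp_succ_sub_le hm
  · rw [ramp_of_le (show i ≤ s + n by omega), ramp_of_le (show i + 1 ≤ s + n by omega), sub_zero,
      sub_zero]
    exact abs_ramp_succ_sub_le hm

/-- Two profiles can be used one after the other: the first one is fully inserted at time `n` and
removed at time `2 n`, the second one is fully inserted at time `3 n` and removed at time `4 n`.
The profiles vary only at times congruent to one of `a, …, a + m - 1` modulo `n`. -/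
theorem exists_shearProfile {E : Type*} [NormedAddCommGroup E] [NormedSpace ℝ E] {ℓ : E →L[ℝ] ℝ}
    {v : E} {σ₀ σ₁ : ℝ → ℝ} {S B δ : ℝ} (h₀ : ContDiff ℝ 1 σ₀) (h₁ : ContDiff ℝ 1 σ₁)
    (hS₀ : ∀ u, |σ₀ u| ≤ S) (hS₁ : ∀ u, |σ₁ u| ≤ S) (hB₀ : ∀ u, |deriv σ₀ u| ≤ B)
    (hB₁ : ∀ u, |deriv σ₁ u| ≤ B) (hδ : 0 < δ) (hδ1 : 2 * δ ≤ 1)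
    (hl₀ : ∀ u, 2 * δ ≤ 1 + deriv σ₀ u * ℓ v) (hl₁ : ∀ u, 2 * δ ≤ 1 + deriv σ₁ u * ℓ v)
    {a m n : ℕ} (hm : 1 ≤ m) (hamn : a + m ≤ n) :
    ∃ (σ : ℕ → ℝ → ℝ) (b : ℕ → ℝ), ShearProfile ℓ v σ b S (2 * B) δ ∧
      σ 0 = 0 ∧ σ n = σ₀ ∧ σ (2 * n) = 0 ∧ σ (3 * n) = σ₁ ∧ (∀ i, 4 * n ≤ i → σ i = 0) ∧
      ∀ i, b i = 0 ∨ b i = 2 * B / m ∧ ∃ j ≤ 3, ∃ t < m, i = a + t + j * n := by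
  classical
  have hB : 0 ≤ B := (abs_nonneg _).trans (hB₀ 0)
  have hm0 : (1 : ℝ) ≤ m := by exact_mod_cast hm
  set τ₀ := trapezoid m n a with hτ₀
  set τ₁ := trapezoid m n (a + 2 * n) with hτ₁
  have p₀ : ∀ i, 0 ≤ τ₀ i := fun i => sub_nonneg.2 (ramp_anti m (by omega) i)
  have p₁ : ∀ i, 0 ≤ τ₁ i := fun i => sub_nonneg.2 (ramp_anti m (by omega) i)
  have p₂ : ∀ i, τ₀ i + τ₁ i ≤ 1 := by
    intro i
    have e1 := ramp_anti m (show a + n ≤ a + 2 * n by omega) i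
    have e2 := ramp_le_one m a i
    have e3 := ramp_nonneg m (a + 2 * n + n) i
    simp only [hτ₀, hτ₁, trapezoid]
    linarith
  let σ : ℕ → ℝ → ℝ := fun i u => τ₀ i * σ₀ u + τ₁ i * σ₁ u
  let b : ℕ → ℝ := fun i => if ∃ j ≤ 3, ∃ t < m, i = a + t + j * n then 2 * B / m else 0
  have hσd : ∀ i u, deriv (σ i) u = τ₀ i * deriv σ₀ u + τ₁ i * deriv σ₁ u := by
    intro i u
    exact (((h₀.differentiable one_ne_zero u).hasDerivAt.const_mul _).add
      ((h₁.differentiable one_ne_zero u).hasDerivAt.const_mul _)).deriv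
  have comb : ∀ (i : ℕ) (x y R : ℝ), |x| ≤ R → |y| ≤ R → |τ₀ i * x + τ₁ i * y| ≤ R := by
    intro i x y R hx hy
    have := p₀ i
    have := p₁ i
    have := p₂ i
    have hR := (abs_nonneg _).trans hx
    rw [abs_le] at hx hy ⊢
    constructor <;> nlinarith
  refine ⟨σ, b, ⟨fun i => (contDiff_const.mul h₀).add (contDiff_const.mul h₁),
    fun i u => comb i _ _ _ (hS₀ u) (hS₁ u), fun i u => ?_, fun i u => ?_, fun i => ?_, hδ, hδ1,
    fun i u => ?_⟩, ?_, ?_, ?_, ?_, fun i hi => ?_, fun i => ?_⟩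
  · rw [hσd]
    have := comb i _ _ _ (hB₀ u) (hB₁ u)
    linarith
  · rw [hσd, hσd]
    by_cases hi : ∃ j ≤ 3, ∃ t < m, i = a + t + j * n
    · simp only [b, if_pos hi]
      have e₀ : |τ₀ (i + 1) - τ₀ i| ≤ 1 / m := abs_trapezoid_succ_sub_le hm (by omega)
      have e₁ : |τ₁ (i + 1) - τ₁ i| ≤ 1 / m := abs_trapezoid_succ_sub_le hm (by omega)
      calc _ = |(τ₀ (i + 1) - τ₀ i) * deriv σ₀ u + (τ₁ (i + 1) - τ₁ i) * deriv σ₁ u| := by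
            congr 1; ring
        _ ≤ |τ₀ (i + 1) - τ₀ i| * |deriv σ₀ u| + |τ₁ (i + 1) - τ₁ i| * |deriv σ₁ u| := by
            rw [← abs_mul, ← abs_mul]; exact abs_add_le _ _
        _ ≤ 1 / m * B + 1 / m * B := by
            gcongr
            · exact hB₀ u
            · exact hB₁ u
        _ = 2 * B / m := by ring
    · simp only [b, if_neg hi]
      push Not at hi
      have e₀ : τ₀ (i + 1) = τ₀ i :=
        trapezoid_succ_eq hm fun j hj t ht => hi j (by omega) t ht
      have e₁ : τ₁ (i + 1) = τ₁ i := by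
        refine trapezoid_succ_eq hm fun j hj t ht h => hi (j + 2) (by omega) t ht ?_
        rw [h]; ring
      rw [e₀, e₁, sub_self, abs_zero]
  · simp only [b]
    split_ifs
    · exact div_le_self (by positivity) hm0
    · positivity
  · rw [hσd]
    have := p₀ i
    have := p₁ i
    have := p₂ i
    have := hl₀ u
    have := hl₁ u
    nlinarith
  · funext u
    simp [σ, hτ₀, hτ₁, trapezoid, ramp_of_le]
  · funext u
    simp only [σ, hτ₀, hτ₁, trapezoid]
    rw [ramp_of_ge hm hamn, ramp_of_le (by omega), ramp_of_le (by omega), ramp_of_le (by omega)]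
    ring
  · funext u
    simp only [σ, hτ₀, hτ₁, trapezoid]
    rw [ramp_of_ge hm (by omega), ramp_of_ge hm (by omega), ramp_of_le (by omega),
      ramp_of_le (by omega)]
    simp
  · funext u
    simp only [σ, hτ₀, hτ₁, trapezoid]
    rw [ramp_of_ge hm (by omega), ramp_of_ge hm (by omega), ramp_of_ge hm (by omega),
      ramp_of_le (by omega)]
    ring
  · funext u
    simp only [σ, hτ₀, hτ₁, trapezoid]
    rw [ramp_of_ge hm (by omega), ramp_of_ge hm (by omega), ramp_of_ge hm (by omega),
      ramp_of_ge hm (by omega)]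
    simp
  · by_cases hi : ∃ j ≤ 3, ∃ t < m, i = a + t + j * n
    · exact Or.inr ⟨if_pos hi, hi⟩
    · exact Or.inl (if_neg hi)

end Schedule

section Profiles

theorem half_le_abs_sin_or_abs_cos (t : ℝ) : 1 / 2 ≤ |Real.cos t| ∨ 1 / 2 ≤ |Real.sin t| := by
  by_contra! h
  have h1 := Real.sin_sq_add_cos_sq t
  have h2 := sq_lt_sq' (by linarith [abs_nonneg (Real.cos t)]) h.1
  have h3 := sq_lt_sq' (by linarith [abs_nonneg (Real.sin t)]) h.2
  rw [sq_abs] at h2 h3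
  linarith

/-- The displacement of the projective action of the matrix `diag (Λ, 1)`: the map
`u ↦ u + projProfile Λ u` is a lift to the line of the action on directions, where `u` is the
angle of a direction. -/
noncomputable def projProfile (Λ u : ℝ) : ℝ :=
  Real.arctan ((1 - Λ) * (Real.sin u * Real.cos u) / (Λ * Real.cos u ^ 2 + Real.sin u ^ 2))

variable {Λ : ℝ}

theorem projProfile_denom_pos (hΛ : 0 < Λ) (u : ℝ) : 0 < Λ * Real.cos u ^ 2 + Real.sin u ^ 2 := by
  have h1 := Real.sin_sq_add_cos_sq u
  rcases eq_or_ne (Real.cos u) 0 with h | h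
  · rw [h] at h1 ⊢; linarith
  · positivity

theorem contDiff_projProfile (hΛ : 0 < Λ) : ContDiff ℝ 1 (projProfile Λ) := by
  refine Real.contDiff_arctan.comp (ContDiff.div ?_ ?_ fun u => (projProfile_denom_pos hΛ u).ne')
  · exact contDiff_const.mul (Real.contDiff_sin.mul Real.contDiff_cos)
  · exact (contDiff_const.mul (Real.contDiff_cos.pow 2)).add (Real.contDiff_sin.pow 2)

theorem abs_projProfile_le (Λ u : ℝ) : |projProfile Λ u| ≤ 2 := by
  have h1 := Real.arctan_lt_pi_div_two
    ((1 - Λ) * (Real.sin u * Real.cos u) / (Λ * Real.cos u ^ 2 + Real.sin u ^ 2))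
  have h2 := Real.neg_pi_div_two_lt_arctan
    ((1 - Λ) * (Real.sin u * Real.cos u) / (Λ * Real.cos u ^ 2 + Real.sin u ^ 2))
  have h3 := Real.pi_le_four
  unfold projProfile
  rw [abs_le]
  constructor <;> linarith

theorem one_add_deriv_projProfile (hΛ : 0 < Λ) (u : ℝ) :
    1 + deriv (projProfile Λ) u = Λ / (Λ ^ 2 * Real.cos u ^ 2 + Real.sin u ^ 2) := by
  set s := Real.sin u with hs
  set c := Real.cos u with hc
  set p := (1 - Λ) * (s * c) with hp
  set Q := Λ * c ^ 2 + s ^ 2 with hQ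
  have hQ0 : 0 < Q := projProfile_denom_pos hΛ u
  have h3 : s ^ 2 + c ^ 2 = 1 := Real.sin_sq_add_cos_sq u
  have hR0 : 0 < Λ ^ 2 * c ^ 2 + s ^ 2 := projProfile_denom_pos (pow_pos hΛ 2) u
  have dp : HasDerivAt (fun u => (1 - Λ) * (Real.sin u * Real.cos u))
      ((1 - Λ) * (c ^ 2 - s ^ 2)) u :=
    (((Real.hasDerivAt_sin u).mul (Real.hasDerivAt_cos u)).const_mul (1 - Λ)).congr_deriv
      (by rw [← hs, ← hc]; ring)
  have dQ : HasDerivAt (fun u => Λ * Real.cos u ^ 2 + Real.sin u ^ 2) (2 * (1 - Λ) * (s * c)) u :=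
    ((((Real.hasDerivAt_cos u).pow 2).const_mul Λ).add ((Real.hasDerivAt_sin u).pow 2)).congr_deriv
      (by rw [← hs, ← hc]; push_cast; ring)
  have h2 : HasDerivAt (projProfile Λ) (1 / (1 + (p / Q) ^ 2) *
      (((1 - Λ) * (c ^ 2 - s ^ 2) * Q - p * (2 * (1 - Λ) * (s * c))) / Q ^ 2)) u :=
    (dp.div dQ hQ0.ne').arctan
  have e : 1 + (p / Q) ^ 2 = (Λ ^ 2 * c ^ 2 + s ^ 2) / Q ^ 2 := by
    field_simp
    rw [hp, hQ]
    linear_combination (Λ ^ 2 * c ^ 2 + s ^ 2) * h3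
  rw [h2.deriv, e]
  field_simp
  rw [hp, hQ]
  linear_combination ((1 - Λ) * (Λ * c ^ 2 - s ^ 2) + Λ) * h3

theorem inv_le_one_add_deriv_projProfile (hΛ : 1 ≤ Λ) (u : ℝ) :
    1 / Λ ≤ 1 + deriv (projProfile Λ) u := by
  have h0 : 0 < Λ := by linarith
  have h1 := Real.sin_sq_add_cos_sq u
  rw [one_add_deriv_projProfile h0, div_le_div_iff₀ h0 (projProfile_denom_pos (pow_pos h0 2) u)]
  have : 1 ≤ Λ ^ 2 := one_le_pow₀ hΛ
  nlinarith [sq_nonneg (Real.sin u)]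

theorem abs_deriv_projProfile_le (hΛ : 1 ≤ Λ) (u : ℝ) : |deriv (projProfile Λ) u| ≤ Λ := by
  have h0 : 0 < Λ := by linarith
  have h1 := Real.sin_sq_add_cos_sq u
  have h2 : 1 + deriv (projProfile Λ) u ≤ Λ := by
    rw [one_add_deriv_projProfile h0, div_le_iff₀ (projProfile_denom_pos (pow_pos h0 2) u)]
    have : 1 ≤ Λ ^ 2 := one_le_pow₀ hΛ
    have : 1 ≤ Λ ^ 2 * Real.cos u ^ 2 + Real.sin u ^ 2 := by nlinarith [sq_nonneg (Real.cos u)]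
    nlinarith
  have h3 := inv_le_one_add_deriv_projProfile hΛ u
  have h4 : 0 < 1 / Λ := by positivity
  rw [abs_le]
  constructor <;> linarith

/-- Directions close to the one contracted by the projective action are contracted. -/
theorem one_add_deriv_projProfile_le (hΛ : 1 ≤ Λ) {u : ℝ} (hu : 1 / 2 ≤ Real.cos u ^ 2) :
    1 + deriv (projProfile Λ) u ≤ 2 / Λ := by
  have h0 : 0 < Λ := by linarith
  rw [one_add_deriv_projProfile h0, div_le_div_iff₀ (projProfile_denom_pos (pow_pos h0 2) u) h0]
  nlinarith [sq_nonneg (Real.sin u), mul_le_mul_of_nonneg_left hu (sq_nonneg Λ)]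

end Profiles

/-! ### Large derivatives near a point -/

section LocalTheorem

variable {d : ℕ} {M : Type*} [TopologicalSpace M] [ChartedSpace (Euc d) M]
  [IsManifold (𝓡 d) ∞ M] [RiemannianBundle (fun x : M => TangentSpace (𝓡 d) x)]

theorem c1EDistAux_self {f : M → M} : c1EDistAux (d := d) f f = 0 := by
  simp only [c1EDistAux, sasakiEDist_self, ENNReal.iSup_zero]

theorem c1EDist_self (f : M ≃ₘ^1⟮𝓡 d, 𝓡 d⟯ M) : c1EDist f f = 0 := by
  rw [c1EDist, c1EDistAux_self, c1EDistAux_self, add_zero]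

theorem isTidyPerturbation_self {f : M ≃ₜ M} {X : Set M}
    (h : ∀ x, ∃ m : ℤ, (f ^ m) x ∉ closure X) : IsTidyPerturbation f f X :=
  ⟨fun _ _ => rfl, fun _ _ _ _ _ => rfl, fun _ _ _ _ _ => rfl, h, h⟩

/-- The orthogonal projection to the line spanned by the image of `v`, read in the model space. -/
theorem exists_form_le (θ : Euc d → M) (z : Euc d) {v : Euc d} (hv : 0 < ‖(tmap θ z v).2‖) :
    ∃ ℓ : Euc d →L[ℝ] ℝ, ℓ v = 1 ∧ ∀ w, |ℓ w| * ‖(tmap θ z v).2‖ ≤ ‖(tmap θ z w).2‖ := by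
  have cs : ∀ (x : M) (u u' : TangentSpace (𝓡 d) x), |inner ℝ u u'| ≤ ‖u‖ * ‖u'‖ :=
    fun x u u' => abs_real_inner_le_norm u u'
  have sq : ∀ (x : M) (u : TangentSpace (𝓡 d) x), inner ℝ u u = ‖u‖ ^ 2 :=
    fun x u => real_inner_self_eq_norm_sq u
  let L : Euc d →ₗ[ℝ] ℝ := innerₗ (TangentSpace (𝓡 d) (θ z)) (tderiv θ z v) ∘ₗ tderiv θ z
  have hL : ∀ w, L w = inner ℝ (tmap θ z v).2 (tmap θ z w).2 := fun w => rfl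
  set r := ‖(tmap θ z v).2‖ with hr
  refine ⟨(r ^ 2)⁻¹ • LinearMap.toContinuousLinearMap L, ?_, fun w => ?_⟩
  · change (r ^ 2)⁻¹ * L v = 1
    rw [hL, sq _ (tmap θ z v).2, ← hr]
    field_simp
  · change |(r ^ 2)⁻¹ * L w| * r ≤ _
    have h1 : |L w| ≤ r * ‖(tmap θ z w).2‖ := cs _ (tmap θ z v).2 (tmap θ z w).2
    rw [abs_mul, abs_of_pos (by positivity)]
    calc _ ≤ (r ^ 2)⁻¹ * (r * ‖(tmap θ z w).2‖) * r := by gcongr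
      _ = ‖(tmap θ z w).2‖ := by field_simp

theorem exists_largeDerivative_of_growth (f : M ≃ₘ^1⟮𝓡 d, 𝓡 d⟯ M) {n N : ℕ} {K : ℝ} {x : M} {j : ℕ}
    (hj : j + n ≤ N) {u u' : TangentBundle (𝓡 d) M} (hu : u.1 = f^[j] x)
    (huu' : tangentMap (𝓡 d) (𝓡 d) f^[n] u = u')
    (h : K * ‖u.2‖ < ‖u'.2‖ ∨ K * ‖u'.2‖ < ‖u.2‖) :
    ∃ j : ℕ, j ≤ N - n ∧ K < max ‖mfderiv (𝓡 d) (𝓡 d) f^[n] (f^[j] x)‖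
      ‖mfderiv (𝓡 d) (𝓡 d) f.symm^[n] (f^[j + n] x)‖ := by
  refine ⟨j, by omega, ?_⟩
  rcases h with h | h
  · rw [← huu'] at h
    have := lt_norm_mfderiv h
    rw [hu] at this
    exact lt_max_of_lt_left this
  · have e : u'.1 = f^[j + n] x := by
      rw [← huu', add_comm, Function.iterate_add_apply, ← hu]
      rfl
    rw [show u = tangentMap (𝓡 d) (𝓡 d) f.symm^[n] u' by
      rw [← huu', tangentMap_symm_iterate]] at h
    have := lt_norm_mfderiv h
    rw [e] at this
    exact lt_max_of_lt_right this

variable [T2Space M]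
  [IsContMDiffRiemannianBundle (𝓡 d) 1 (Euc d) (fun x : M => TangentSpace (𝓡 d) x)]
  [IsContinuousRiemannianBundle (Euc d) (fun x : M => TangentSpace (𝓡 d) x)]

/-- Near `q`, the diffeomorphism `f` can be perturbed along long towers, in such a way that points
of a given compact set see a large derivative. -/
def IsPerturbableAt (f : M ≃ₘ^1⟮𝓡 d, 𝓡 d⟯ M) (n N : ℕ) (K ε : ℝ) (q : M) : Prop :=
  ∃ W : Set M, IsOpen W ∧ q ∈ W ∧ ∀ U ⊆ W, IsOpen U →
    (∀ i < N, ∀ j < N, i ≠ j → Disjoint (f^[i] '' closure U) (f^[j] '' closure U)) →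
    (∀ x : M, ∃ m : ℤ, (f.toHomeomorph ^ m) x ∉ closure (iteratesUnion f U N)) →
    ∀ Δ ⊆ U, IsCompact Δ → ∃ g : M ≃ₘ^1⟮𝓡 d, 𝓡 d⟯ M,
      c1EDist f g < ENNReal.ofReal ε ∧
      IsTidyPerturbation f.toHomeomorph g.toHomeomorph (iteratesUnion f U N) ∧
      ∀ x ∈ Δ, ∃ j : ℕ, j ≤ N - n ∧
        K < max ‖mfderiv (𝓡 d) (𝓡 d) (g^[n]) (g^[j] x)‖
          ‖mfderiv (𝓡 d) (𝓡 d) (g.symm^[n]) (g^[j + n] x)‖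

theorem exists_nhds_forall_lt {X : Type*} [TopologicalSpace X] {φ ψ : X → ℝ} {x : X}
    (hφ : ContinuousAt φ x) (hψ : ContinuousAt ψ x) (h : φ x < ψ x) :
    ∃ O ∈ 𝓝 x, ∀ z ∈ O, ∀ z' ∈ O, φ z < ψ z' := by
  obtain ⟨r, h1, h2⟩ := exists_between h
  exact ⟨_, (hφ.eventually_lt continuousAt_const h1).and
    (continuousAt_const.eventually_lt hψ h2), fun z hz z' hz' => hz.1.trans hz'.2⟩

theorem continuousAt_norm_tmap_chartOrbit (f : M ≃ₘ^1⟮𝓡 d, 𝓡 d⟯ M) (q : M) (i : ℕ) (w : Euc d) :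
    ContinuousAt (fun z => ‖(tmap (chartOrbit f q i) z w).2‖) (extChartAt (𝓡 d) q q) :=
  ContinuousAt.comp (g := fun x : Euc d × Euc d => ‖(tmap (chartOrbit f q i) x.1 x.2).2‖)
    (f := fun z : Euc d => (z, w)) (x := extChartAt (𝓡 d) q q)
    (continuousAt_norm_tmap (isOpen_extChartAt_target q) (contMDiffOn_chartOrbit f q i)
      (mem_extChartAt_target q) w) (by fun_prop)

/-- If some derivative of `f` along the orbit of `q` is already large, no perturbation is needed.
-/
theorem isPerturbableAt_of_lt (f : M ≃ₘ^1⟮𝓡 d, 𝓡 d⟯ M) (q : M) {n N : ℕ} {K ε : ℝ} (hε : 0 < ε)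
    {j : ℕ} (hj : j + n ≤ N) {w : Euc d}
    (h : K * ‖(tmap (chartOrbit f q j) (extChartAt (𝓡 d) q q) w).2‖ <
        ‖(tmap (chartOrbit f q (j + n)) (extChartAt (𝓡 d) q q) w).2‖ ∨
      K * ‖(tmap (chartOrbit f q (j + n)) (extChartAt (𝓡 d) q q) w).2‖ <
        ‖(tmap (chartOrbit f q j) (extChartAt (𝓡 d) q q) w).2‖) :
    IsPerturbableAt f n N K ε q := by
  have c1 := continuousAt_norm_tmap_chartOrbit f q j w
  have c2 := continuousAt_norm_tmap_chartOrbit f q (j + n) w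
  have hev : ∀ᶠ z in 𝓝 (extChartAt (𝓡 d) q q),
      K * ‖(tmap (chartOrbit f q j) z w).2‖ < ‖(tmap (chartOrbit f q (j + n)) z w).2‖ ∨
      K * ‖(tmap (chartOrbit f q (j + n)) z w).2‖ < ‖(tmap (chartOrbit f q j) z w).2‖ := by
    rcases h with h | h
    · exact ((c1.const_mul K).eventually_lt c2 h).mono fun z => Or.inl
    · exact ((c2.const_mul K).eventually_lt c1 h).mono fun z => Or.inr
  have hev2 := ((continuousAt_extChartAt (I := 𝓡 d) q).eventually hev).and
    (extChartAt_source_mem_nhds (I := 𝓡 d) q)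
  obtain ⟨W, hW, hWo, hqW⟩ := eventually_nhds_iff.1 hev2
  refine ⟨W, hWo, hqW, fun U hU _ _ hexit Δ hΔ _ => ⟨f, ?_, isTidyPerturbation_self hexit,
    fun x hx => ?_⟩⟩
  · rw [c1EDist_self]; exact ENNReal.ofReal_pos.2 hε
  · obtain ⟨h1, hxs⟩ := hW x (hU (hΔ hx))
    refine exists_largeDerivative_of_growth f hj
      (u := tmap (chartOrbit f q j) (extChartAt (𝓡 d) q x) w) ?_ ?_ h1
    · change f^[j] ((extChartAt (𝓡 d) q).symm (extChartAt (𝓡 d) q x)) = _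
      rw [(extChartAt (𝓡 d) q).left_inv hxs]
    · rw [← tmap_chartOrbit_add f j n ((extChartAt (𝓡 d) q).map_source hxs), add_comm]

/-- Inserting shears produces large derivatives if, for each value `t` of the phase, there is a
window `[j, j + n]` and a vector whose image under the sheared derivatives grows or shrinks. -/
theorem ShearProfile.isPerturbableAt (f : M ≃ₘ^1⟮𝓡 d, 𝓡 d⟯ M) (q : M) {n N : ℕ} (hN : 1 ≤ N)
    {C K ε : ℝ} (hC : 0 < C) (hε : 0 < ε)
    (hf : ∀ u : TangentBundle (𝓡 d) M, ‖(tangentMap (𝓡 d) (𝓡 d) f u).2‖ ≤ C * ‖u.2‖)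
    (hf' : ∀ u : TangentBundle (𝓡 d) M, ‖(tangentMap (𝓡 d) (𝓡 d) f.symm u).2‖ ≤ C * ‖u.2‖)
    {ℓ : Euc d →L[ℝ] ℝ} {v : Euc d} {σ : ℕ → ℝ → ℝ} {b : ℕ → ℝ} {S B δ : ℝ}
    (h : ShearProfile ℓ v σ b S B δ) (h0 : σ 0 = 0) (h1 : σ N = 0)
    (hsize : ∀ i < N, ∀ w, b i / (2 * δ) * |ℓ w| *
        ‖(tmap (chartOrbit f q i) (extChartAt (𝓡 d) q q) v).2‖ ≤
      ε / (16 * C) * ‖(tmap (chartOrbit f q i) (extChartAt (𝓡 d) q q) w).2‖)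
    {O : Set (Euc d)} (hO : O ∈ 𝓝 (extChartAt (𝓡 d) q q))
    (hgood : ∀ t : ℝ, ∃ j : ℕ, j + n ≤ N ∧ ∃ w, ∀ z ∈ O, ∀ z' ∈ O,
        K * ‖(tmap (chartOrbit f q j) z (w + (deriv (σ j) t * ℓ w) • v)).2‖ <
          ‖(tmap (chartOrbit f q (j + n)) z' (w + (deriv (σ (j + n)) t * ℓ w) • v)).2‖ ∨
        K * ‖(tmap (chartOrbit f q (j + n)) z' (w + (deriv (σ (j + n)) t * ℓ w) • v)).2‖ <
          ‖(tmap (chartOrbit f q j) z (w + (deriv (σ j) t * ℓ w) • v)).2‖) :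
    IsPerturbableAt f n N K ε q := by
  obtain ⟨W, hW, hqW, hpert⟩ := h.exists_perturbation f q hN hC hε hf hf'
    (fun u => congrFun h0 u) (fun u => congrFun h1 u) hsize hO
  refine ⟨W, hW, hqW, fun U hUW hU hdisj hexit Δ hΔU hΔ => ?_⟩
  obtain ⟨g, hg1, hg2, hg3⟩ := hpert U hUW hU hdisj hexit Δ hΔU hΔ
  refine ⟨g, hg1, hg2, fun x hx => ?_⟩
  obtain ⟨z, hzO, hzt, hzx, t, ht⟩ := hg3 x hx
  obtain ⟨j, hj, w, hw⟩ := hgood t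
  obtain ⟨z₁, hz₁, -, e₁⟩ := ht j (by omega)
  obtain ⟨z₂, hz₂, -, e₂⟩ := ht (j + n) hj
  have hgrowth := hw z₁ hz₁ z₂ hz₂
  rw [← e₁, ← e₂] at hgrowth
  refine exists_largeDerivative_of_growth g hj
    (u := tangentMap (𝓡 d) (𝓡 d) g^[j] (tmap (extChartAt (𝓡 d) q).symm z w)) ?_ ?_ hgrowth
  · rw [← hzx]; rfl
  · rw [add_comm j n, Function.iterate_add,
      ← tangentMap_comp_at _ (mdifferentiable_iterate g n _) (mdifferentiable_iterate g j _)]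

theorem iterate_growth_le {E : Type*} {ν : ℕ → E → ℝ} {n N : ℕ} {K : ℝ} (hK : 1 ≤ K)
    (hn : ∀ j, j + n ≤ N → ∀ w, ν (j + n) w ≤ K * ν j w ∧ ν j w ≤ K * ν (j + n) w) {i j : ℕ}
    (hj : i + j * n ≤ N) (w : E) :
    ν (i + j * n) w ≤ K ^ j * ν i w ∧ ν i w ≤ K ^ j * ν (i + j * n) w := by
  induction j with
  | zero => simp
  | succ j ih =>
    have e : i + (j + 1) * n = i + j * n + n := by ring
    rw [e] at hj ⊢
    obtain ⟨h1, h2⟩ := ih (by omega)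
    obtain ⟨h3, h4⟩ := hn _ hj w
    have hKj : 0 ≤ K ^ j := by positivity
    constructor
    · calc _ ≤ K * ν (i + j * n) w := h3
        _ ≤ K * (K ^ j * ν i w) := by gcongr
        _ = _ := by ring
    · calc _ ≤ K ^ j * ν (i + j * n) w := h2
        _ ≤ K ^ j * (K * ν (i + j * n + n) w) := by gcongr
        _ = _ := by ring

/-- A bound on the size of a shear at the times `a, …, a + m - 1` persists, up to a constant, at
the corresponding times of the next three windows of length `n`, if the derivatives of the `n`-th
iterate and of its inverse are bounded by `K`. -/
theorem shear_size_le {E : Type*} {ν : ℕ → E → ℝ} (hν : ∀ i w, 0 ≤ ν i w) {n N : ℕ}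
    {K : ℝ} (hK : 1 ≤ K)
    (hn : ∀ j, j + n ≤ N → ∀ w, ν (j + n) w ≤ K * ν j w ∧ ν j w ≤ K * ν (j + n) w) (hnN : 4 * n ≤ N)
    {ℓ : E → ℝ} {v : E} {b : ℕ → ℝ} {B X r δ : ℝ} {a m : ℕ} (hamn : a + m ≤ n)
    (hb : ∀ i, b i = 0 ∨ b i = 2 * B / m ∧ ∃ j ≤ 3, ∃ t < m, i = a + t + j * n)
    (hX : ∀ t < m, ∀ w, |ℓ w| * ν (a + t) v ≤ X * ν (a + t) w) (hB : 0 ≤ B) (hX0 : 0 ≤ X)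
    (hδ : 0 < δ) (hr : 2 * B / m / (2 * δ) * (K ^ 6 * X) ≤ r) (i : ℕ) (w : E) :
    b i / (2 * δ) * |ℓ w| * ν i v ≤ r * ν i w := by
  have h0 : 0 ≤ 2 * B / m / (2 * δ) := by positivity
  have hr0 : 0 ≤ r := le_trans (by positivity) hr
  rcases hb i with hi | ⟨hi, j, hj, t, ht, rfl⟩
  · rw [hi, zero_div, zero_mul, zero_mul]
    exact mul_nonneg hr0 (hν _ _)
  · have hjn : j * n ≤ 3 * n := Nat.mul_le_mul_right n hj
    have h1 := (iterate_growth_le hK hn (i := a + t) (j := j) (by omega) v).1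
    have h2 := (iterate_growth_le hK hn (i := a + t) (j := j) (by omega) w).2
    have h3 := hX t ht w
    have hKj : K ^ j * K ^ j ≤ K ^ 6 := by
      rw [← pow_add]; exact pow_le_pow_right₀ hK (by omega)
    have h4 : |ℓ w| * ν (a + t + j * n) v ≤ K ^ 6 * X * ν (a + t + j * n) w := by
      calc _ ≤ |ℓ w| * (K ^ j * ν (a + t) v) := by gcongr
        _ = K ^ j * (|ℓ w| * ν (a + t) v) := by ring
        _ ≤ K ^ j * (X * ν (a + t) w) := by gcongr
        _ ≤ K ^ j * (X * (K ^ j * ν (a + t + j * n) w)) := by gcongr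
        _ = K ^ j * K ^ j * X * ν (a + t + j * n) w := by ring
        _ ≤ _ := by gcongr; exact hν _ _
    rw [hi, mul_assoc]
    calc _ ≤ 2 * B / m / (2 * δ) * (K ^ 6 * X * ν (a + t + j * n) w) := by gcongr
      _ = 2 * B / m / (2 * δ) * (K ^ 6 * X) * ν (a + t + j * n) w := by ring
      _ ≤ _ := by gcongr; exact hν _ _

section Cases

variable (f : M ≃ₘ^1⟮𝓡 d, 𝓡 d⟯ M) (q : M) {n N : ℕ} {C K ε : ℝ}

/-- The norm of the image under the derivative of `f^i` of the tangent vector at `q` whose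
coordinates in the chart around `q` are `w`. -/
noncomputable def orbitNorm (i : ℕ) (w : Euc d) : ℝ :=
  ‖(tmap (chartOrbit f q i) (extChartAt (𝓡 d) q q) w).2‖

theorem orbitNorm_nonneg (i : ℕ) (w : Euc d) : 0 ≤ orbitNorm f q i w := by
  have nn : ∀ (x : M) (u : TangentSpace (𝓡 d) x), 0 ≤ ‖u‖ := fun x u => norm_nonneg u
  exact nn _ _

theorem orbitNorm_pos (i : ℕ) {w : Euc d} (hw : w ≠ 0) : 0 < orbitNorm f q i w :=
  norm_tmap_chartOrbit_pos f i (mem_extChartAt_target q) hw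

theorem orbitNorm_zero (i : ℕ) : orbitNorm f q i 0 = 0 := by
  have := norm_tmap_smul (chartOrbit f q i) (extChartAt (𝓡 d) q q) (0 : Euc d) 0
  rwa [zero_smul, abs_zero, zero_mul] at this

/-- If some iterate `f^a` distorts the directions a lot, expanding `w₀` much more than `v`, then a
small shear inserted at once at time `a` adds to `w₀` a vector in the direction of `v` which is
small at time `a`, but large compared to `w₀` at the ends of the windows. -/
theorem isPerturbableAt_of_distortion (hC : 0 < C) (hε : 0 < ε) (hK : 1 ≤ K) (hnN : 4 * n ≤ N)
    (hf : ∀ u : TangentBundle (𝓡 d) M, ‖(tangentMap (𝓡 d) (𝓡 d) f u).2‖ ≤ C * ‖u.2‖)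
    (hf' : ∀ u : TangentBundle (𝓡 d) M, ‖(tangentMap (𝓡 d) (𝓡 d) f.symm u).2‖ ≤ C * ‖u.2‖)
    (hn : ∀ j, j + n ≤ N → ∀ w, orbitNorm f q (j + n) w ≤ K * orbitNorm f q j w ∧
      orbitNorm f q j w ≤ K * orbitNorm f q (j + n) w)
    {η : ℝ} (hη : 0 < η) (hη1 : η ≤ 1 / 2) (hηε : 4 * η * K ^ 6 ≤ ε / (16 * C)) {a : ℕ} (ha : a < n)
    {w₀ v : Euc d} (hdist : 4 * K ^ 6 / η * (orbitNorm f q 0 w₀ * orbitNorm f q a v) <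
      orbitNorm f q a w₀ * orbitNorm f q 0 v) :
    IsPerturbableAt f n N K ε q := by
  have nn := orbitNorm_nonneg f q
  have hpos : 0 < orbitNorm f q a w₀ * orbitNorm f q 0 v :=
    lt_of_le_of_lt (by have := nn 0 w₀; have := nn a v; positivity) hdist
  have hw₀ : 0 < orbitNorm f q a w₀ := pos_of_mul_pos_left hpos (nn _ _)
  have hv0 : 0 < orbitNorm f q 0 v := pos_of_mul_pos_right hpos (nn _ _)
  have hv : v ≠ 0 := by
    rintro rfl
    exact hv0.ne' (orbitNorm_zero f q 0)
  have hva : 0 < orbitNorm f q a v := orbitNorm_pos f q a hv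
  obtain ⟨ℓ₀, hℓ₀, hℓ₀'⟩ := exists_form_le (chartOrbit f q a) (extChartAt (𝓡 d) q q) hw₀
  set ℓ : Euc d →L[ℝ] ℝ := (orbitNorm f q a w₀ / orbitNorm f q a v) • ℓ₀ with hℓ
  have hℓw₀ : ℓ w₀ = orbitNorm f q a w₀ / orbitNorm f q a v := by
    rw [hℓ, smul_apply, hℓ₀, smul_eq_mul, mul_one]
  have hℓle : ∀ w, |ℓ w| * orbitNorm f q a v ≤ orbitNorm f q a w := by
    intro w
    rw [hℓ, smul_apply, smul_eq_mul, abs_mul, abs_of_pos (div_pos hw₀ hva)]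
    calc _ = |ℓ₀ w| * orbitNorm f q a w₀ := by field_simp
      _ ≤ _ := hℓ₀' w
  have hℓv : |ℓ v| ≤ 1 := by
    have := hℓle v
    exact le_of_mul_le_mul_right (by linarith) hva
  have dsin : ∀ u, deriv (fun u => η * Real.sin u) u = η * Real.cos u := fun u =>
    ((Real.hasDerivAt_sin u).const_mul η).deriv
  have dcos : ∀ u, deriv (fun u => η * Real.cos u) u = η * -Real.sin u := fun u =>
    ((Real.hasDerivAt_cos u).const_mul η).deriv
  have hle : ∀ x : ℝ, |x| ≤ 1 → |η * x| ≤ η := fun x hx => by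
    rw [abs_mul, abs_of_pos hη]; nlinarith
  have hlow : ∀ x : ℝ, |x| ≤ η → 2 * (1 / 4) ≤ 1 + x * ℓ v := by
    intro x hx
    have : |x * ℓ v| ≤ η * 1 := by rw [abs_mul]; gcongr
    have := (abs_le.1 this).1
    linarith
  have b1 : ∀ u, |η * Real.cos u| ≤ η := fun u => hle _ (Real.abs_cos_le_one u)
  have b2 : ∀ u, |η * Real.sin u| ≤ η := fun u => hle _ (Real.abs_sin_le_one u)
  have b3 : ∀ u, |η * -Real.sin u| ≤ η := fun u =>
    hle _ (by rw [abs_neg]; exact Real.abs_sin_le_one u)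
  obtain ⟨σ, b, hprof, s0, s1, s2, s3, s4, hb⟩ := exists_shearProfile (ℓ := ℓ) (v := v)
    (contDiff_const.mul Real.contDiff_sin : ContDiff ℝ 1 fun u => η * Real.sin u)
    (contDiff_const.mul Real.contDiff_cos : ContDiff ℝ 1 fun u => η * Real.cos u) b2 b1
    (fun u => by rw [dsin]; exact b1 u) (fun u => by rw [dcos]; exact b3 u)
    (by norm_num : (0 : ℝ) < 1 / 4) (by norm_num) (fun u => by rw [dsin]; exact hlow _ (b1 u))
    (fun u => by rw [dcos]; exact hlow _ (b3 u)) le_rfl (show a + 1 ≤ n by omega)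
  have hsize := shear_size_le nn hK hn hnN (show a + 1 ≤ n by omega) hb (X := 1)
    (fun t ht w => by
      obtain rfl : t = 0 := by omega
      rw [one_mul]; exact hℓle w) hη.le zero_le_one (by norm_num : (0 : ℝ) < 1 / 4)
    (r := ε / (16 * C)) (by norm_num at hηε ⊢; linarith)
  -- the inequality that makes the sheared vector large, at one of the two windows
  have hgrow : ∀ j, j + n ≤ N → (∃ k ≤ 2, j = k * n) →
      K * orbitNorm f q j w₀ + orbitNorm f q (j + n) w₀ <
        η / 2 * |ℓ w₀| * orbitNorm f q (j + n) v := by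
    rintro j hj ⟨k, hk, rfl⟩
    have e : k * n + n = 0 + (k + 1) * n := by ring
    have g1 := (iterate_growth_le hK hn (i := 0) (j := k + 1) (by omega) v).2
    have g2 := (iterate_growth_le hK hn (i := 0) (j := k + 1) (by omega) w₀).1
    have g3 := (iterate_growth_le hK hn (i := 0) (j := k) (by omega) w₀).1
    rw [zero_add] at g3
    rw [← e] at g1 g2
    have p3 : K ^ (k + 1) ≤ K ^ 3 := pow_le_pow_right₀ hK (by omega)
    have hK3 : 0 < K ^ 3 := by positivity
    have m1 : orbitNorm f q 0 v ≤ K ^ 3 * orbitNorm f q (k * n + n) v :=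
      g1.trans (mul_le_mul_of_nonneg_right p3 (nn _ _))
    have m2 : orbitNorm f q (k * n + n) w₀ ≤ K ^ 3 * orbitNorm f q 0 w₀ :=
      g2.trans (mul_le_mul_of_nonneg_right p3 (nn _ _))
    have m3 : K * orbitNorm f q (k * n) w₀ ≤ K ^ 3 * orbitNorm f q 0 w₀ := by
      calc _ ≤ K * (K ^ k * orbitNorm f q 0 w₀) := mul_le_mul_of_nonneg_left g3 (by linarith)
        _ = K ^ (k + 1) * orbitNorm f q 0 w₀ := by ring
        _ ≤ _ := mul_le_mul_of_nonneg_right p3 (nn _ _)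
    rw [hℓw₀, abs_of_pos (div_pos hw₀ hva)]
    have m4 : 4 * K ^ 6 / η * orbitNorm f q 0 w₀ <
        orbitNorm f q a w₀ / orbitNorm f q a v * orbitNorm f q 0 v := by
      calc _ = 4 * K ^ 6 / η * (orbitNorm f q 0 w₀ * orbitNorm f q a v) / orbitNorm f q a v := by
            field_simp
        _ < orbitNorm f q a w₀ * orbitNorm f q 0 v / orbitNorm f q a v := by gcongr
        _ = _ := by ring
    have m5 : orbitNorm f q a w₀ / orbitNorm f q a v * orbitNorm f q 0 v ≤
        orbitNorm f q a w₀ / orbitNorm f q a v * (K ^ 3 * orbitNorm f q (k * n + n) v) :=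
      mul_le_mul_of_nonneg_left m1 (div_pos hw₀ hva).le
    have m6 := mul_lt_mul_of_pos_left (m4.trans_le m5) (show 0 < η / (2 * K ^ 3) by positivity)
    have e1 : η / (2 * K ^ 3) * (4 * K ^ 6 / η * orbitNorm f q 0 w₀) =
        2 * K ^ 3 * orbitNorm f q 0 w₀ := by
      field_simp; ring
    have e2 : η / (2 * K ^ 3) * (orbitNorm f q a w₀ / orbitNorm f q a v *
        (K ^ 3 * orbitNorm f q (k * n + n) v)) =
        η / 2 * (orbitNorm f q a w₀ / orbitNorm f q a v) * orbitNorm f q (k * n + n) v := by field_simp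
    rw [e1, e2] at m6
    linarith
  have hev : ∀ j, j + n ≤ N → (∃ k ≤ 2, j = k * n) → ∃ O ∈ 𝓝 (extChartAt (𝓡 d) q q),
      ∀ z ∈ O, ∀ z' ∈ O, ∀ c : ℝ, η / 2 ≤ |c| →
        K * ‖(tmap (chartOrbit f q j) z w₀).2‖ <
          ‖(tmap (chartOrbit f q (j + n)) z' (w₀ + (c * ℓ w₀) • v)).2‖ := by
    intro j hj hk
    have c1 := (continuousAt_norm_tmap_chartOrbit f q j w₀).const_mul K
    have c2 := ((continuousAt_norm_tmap_chartOrbit f q (j + n) v).const_mul (η / 2 * |ℓ w₀|)).sub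
      (continuousAt_norm_tmap_chartOrbit f q (j + n) w₀)
    obtain ⟨O, hO, h⟩ := exists_nhds_forall_lt c1 c2 (lt_sub_iff_add_lt.2 (hgrow j hj hk))
    refine ⟨O, hO, fun z hz z' hz' c hc => (h z hz z' hz').trans_le ?_⟩
    rw [Pi.sub_apply]
    have h1 := norm_tmap_add_le (chartOrbit f q (j + n)) z' (w₀ + (c * ℓ w₀) • v) ((-1 : ℝ) • w₀)
    have e1 : w₀ + (c * ℓ w₀) • v + (-1 : ℝ) • w₀ = (c * ℓ w₀) • v := by module
    rw [e1, norm_tmap_smul, norm_tmap_smul, abs_neg, abs_one, one_mul, abs_mul] at h1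
    have h2 : 0 ≤ ‖(tmap (chartOrbit f q (j + n)) z' v).2‖ := by
      have : ∀ (x : M) (u : TangentSpace (𝓡 d) x), 0 ≤ ‖u‖ := fun x u => norm_nonneg u
      exact this _ _
    have h3 : η / 2 * |ℓ w₀| * ‖(tmap (chartOrbit f q (j + n)) z' v).2‖ ≤
      |c| * |ℓ w₀| * ‖(tmap (chartOrbit f q (j + n)) z' v).2‖ := by gcongr
    linarith
  obtain ⟨O, hO, hO'⟩ := hev 0 (by omega) ⟨0, by omega, by omega⟩
  obtain ⟨P, hP, hP'⟩ := hev (2 * n) (by omega) ⟨2, le_rfl, rfl⟩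
  refine hprof.isPerturbableAt f q (by omega) hC hε hf hf' s0 (s4 N hnN) (fun i _ w => hsize i w)
    (Filter.inter_mem hO hP) fun t => ?_
  have dz : deriv (0 : ℝ → ℝ) t = 0 := deriv_const t (0 : ℝ)
  rcases half_le_abs_sin_or_abs_cos t with ht | ht
  · refine ⟨0, by omega, w₀, fun z hz z' hz' => Or.inl ?_⟩
    rw [s0, dz, zero_mul, zero_smul, add_zero, zero_add, s1, dsin]
    have := hO' z hz.1 z' hz'.1 (η * Real.cos t) (by rw [abs_mul, abs_of_pos hη]; nlinarith)
    rwa [zero_add] at this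
  · refine ⟨2 * n, by omega, w₀, fun z hz z' hz' => Or.inl ?_⟩
    have e : 2 * n + n = 3 * n := by ring
    rw [s2, dz, zero_mul, zero_smul, add_zero, e, s3, dcos]
    have := hP' z hz.2 z' hz'.2 (η * -Real.sin t)
      (by rw [abs_mul, abs_neg, abs_of_pos hη]; nlinarith)
    rwa [e] at this

/-- If the iterates of `f` distort the directions moderately, then a strong shear, inserted
slowly, contracts the vector `v` by a factor at least `Λ / 2` at one of the two windows. -/
theorem isPerturbableAt_of_bounded_distortion (hC : 0 < C) (hε : 0 < ε) (hK : 1 ≤ K)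
    (hnN : 4 * n ≤ N)
    (hf : ∀ u : TangentBundle (𝓡 d) M, ‖(tangentMap (𝓡 d) (𝓡 d) f u).2‖ ≤ C * ‖u.2‖)
    (hf' : ∀ u : TangentBundle (𝓡 d) M, ‖(tangentMap (𝓡 d) (𝓡 d) f.symm u).2‖ ≤ C * ‖u.2‖)
    (hn : ∀ j, j + n ≤ N → ∀ w, orbitNorm f q (j + n) w ≤ K * orbitNorm f q j w ∧
      orbitNorm f q j w ≤ K * orbitNorm f q (j + n) w)
    {X Λ : ℝ} (hX : 0 ≤ X) (hΛ : 1 ≤ Λ) (hΛK : 2 * K ^ 2 < Λ) {m : ℕ} (hm : 1 ≤ m) (hmn : m ≤ n)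
    (hmε : 2 * Λ ^ 2 / m * (K ^ 6 * X) ≤ ε / (16 * C)) {v : Euc d} (hv : v ≠ 0)
    (hdist : ∀ t < m, ∀ w, orbitNorm f q t v * orbitNorm f q 0 w ≤
      X * (orbitNorm f q 0 v * orbitNorm f q t w)) :
    IsPerturbableAt f n N K ε q := by
  have nn := orbitNorm_nonneg f q
  have hΛ0 : 0 < Λ := by linarith
  have hv0 := orbitNorm_pos f q 0 hv
  obtain ⟨ℓ, hℓv, hℓ⟩ := exists_form_le (chartOrbit f q 0) (extChartAt (𝓡 d) q q) hv0
  have hℓX : ∀ t < m, ∀ w, |ℓ w| * orbitNorm f q (0 + t) v ≤ X * orbitNorm f q (0 + t) w := by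
    intro t ht w
    rw [zero_add]
    have h1 : |ℓ w| * orbitNorm f q 0 v ≤ orbitNorm f q 0 w := hℓ w
    refine le_of_mul_le_mul_right ?_ hv0
    calc _ = orbitNorm f q t v * (|ℓ w| * orbitNorm f q 0 v) := by ring
      _ ≤ orbitNorm f q t v * orbitNorm f q 0 w := mul_le_mul_of_nonneg_left h1 (nn _ _)
      _ ≤ _ := hdist t ht w
      _ = _ := by ring
  have cshift : ContDiff ℝ 1 fun u => projProfile Λ (u + Real.pi / 2) :=
    (contDiff_projProfile hΛ0).comp (contDiff_id.add contDiff_const)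
  have dshift : ∀ u, deriv (fun u => projProfile Λ (u + Real.pi / 2)) u =
      deriv (projProfile Λ) (u + Real.pi / 2) := fun u => deriv_comp_add_const _ _ _
  have hlow : ∀ u, 2 * (1 / (2 * Λ)) ≤ 1 + deriv (projProfile Λ) u * ℓ v := by
    intro u
    have := inv_le_one_add_deriv_projProfile hΛ u
    rw [hℓv, mul_one]
    refine le_trans (le_of_eq ?_) this
    field_simp
  obtain ⟨σ, b, hprof, s0, s1, s2, s3, s4, hb⟩ := exists_shearProfile (ℓ := ℓ) (v := v)
    (contDiff_projProfile hΛ0) cshift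
    (abs_projProfile_le Λ) (fun u => abs_projProfile_le Λ _)
    (abs_deriv_projProfile_le hΛ) (fun u => by rw [dshift]; exact abs_deriv_projProfile_le hΛ _)
    (by positivity : 0 < 1 / (2 * Λ)) (by
      rw [mul_one_div, div_le_one (by positivity)]; linarith) hlow
    (fun u => by rw [dshift]; exact hlow _) hm (show 0 + m ≤ n by omega)
  have hsize := shear_size_le nn hK hn hnN (show 0 + m ≤ n by omega) hb hℓX hΛ0.le hX
    (by positivity : 0 < 1 / (2 * Λ)) (r := ε / (16 * C)) (by
      refine le_trans (le_of_eq ?_) hmε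
      have : (0 : ℝ) < m := by exact_mod_cast hm
      field_simp)
  have hev : ∀ j, j + n ≤ N → ∃ O ∈ 𝓝 (extChartAt (𝓡 d) q q),
      ∀ z ∈ O, ∀ z' ∈ O, ∀ c : ℝ, 0 ≤ c → c ≤ 2 / Λ →
        K * ‖(tmap (chartOrbit f q (j + n)) z' (c • v)).2‖ <
          ‖(tmap (chartOrbit f q j) z v).2‖ := by
    intro j hj
    have c1 := (continuousAt_norm_tmap_chartOrbit f q (j + n) v).const_mul (K * (2 / Λ))
    have c2 := continuousAt_norm_tmap_chartOrbit f q j v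
    have hlt : K * (2 / Λ) * orbitNorm f q (j + n) v < orbitNorm f q j v := by
      have h1 := (hn j hj v).1
      have h2 := orbitNorm_pos f q j hv
      calc _ ≤ K * (2 / Λ) * (K * orbitNorm f q j v) := by gcongr
        _ = 2 * K ^ 2 * orbitNorm f q j v / Λ := by ring
        _ < Λ * orbitNorm f q j v / Λ := by gcongr
        _ = _ := by field_simp
    obtain ⟨O, hO, h⟩ := exists_nhds_forall_lt c1 c2 hlt
    refine ⟨O, hO, fun z hz z' hz' c hc0 hc => lt_of_le_of_lt ?_ (h z' hz' z hz)⟩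
    rw [norm_tmap_smul, abs_of_nonneg hc0, ← mul_assoc]
    have h2 : 0 ≤ ‖(tmap (chartOrbit f q (j + n)) z' v).2‖ := by
      have : ∀ (x : M) (u : TangentSpace (𝓡 d) x), 0 ≤ ‖u‖ := fun x u => norm_nonneg u
      exact this _ _
    gcongr
  obtain ⟨O, hO, hO'⟩ := hev 0 (by omega)
  obtain ⟨P, hP, hP'⟩ := hev (2 * n) (by omega)
  refine hprof.isPerturbableAt f q (by omega) hC hε hf hf' s0 (s4 N hnN) (fun i _ w => hsize i w)
    (Filter.inter_mem hO hP) fun t => ?_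
  have dz : deriv (0 : ℝ → ℝ) t = 0 := deriv_const t (0 : ℝ)
  have evec : ∀ c : ℝ, v + (c * ℓ v) • v = (1 + c) • v := fun c => by rw [hℓv]; module
  have hnonneg : ∀ u, 0 ≤ 1 + deriv (projProfile Λ) u := fun u =>
    le_trans (by positivity) (inv_le_one_add_deriv_projProfile hΛ u)
  rcases le_total (1 / 2) (Real.cos t ^ 2) with ht | ht
  · refine ⟨0, by omega, v, fun z hz z' hz' => Or.inr ?_⟩
    rw [s0, dz, zero_mul, zero_smul, add_zero, zero_add, s1, evec]
    have := hO' z hz.1 z' hz'.1 _ (hnonneg t) (one_add_deriv_projProfile_le hΛ ht)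
    rwa [zero_add] at this
  · refine ⟨2 * n, by omega, v, fun z hz z' hz' => Or.inr ?_⟩
    have e : 2 * n + n = 3 * n := by ring
    have ht' : 1 / 2 ≤ Real.cos (t + Real.pi / 2) ^ 2 := by
      rw [Real.cos_add_pi_div_two, neg_sq]
      linarith [Real.sin_sq_add_cos_sq t]
    rw [s2, dz, zero_mul, zero_smul, add_zero, e, s3, evec, dshift]
    have := hP' z hz.2 z' hz'.2 _ (hnonneg _) (one_add_deriv_projProfile_le hΛ ht')
    rwa [e] at this

end Cases

end LocalTheorem

/-! ### Choice of the constants and conclusion -/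

section Conclusion

/-- The constants of the construction: the amplitude `η` of the small shears, the expansion factor
`Λ` of the strong shears, and the length `m` of their insertion. -/
theorem exists_shear_constants {C K ε : ℝ} (hC : 0 < C) (hK : 1 ≤ K) (hε : 0 < ε) :
    ∃ (η Λ : ℝ) (m : ℕ), 0 < η ∧ η ≤ 1 / 2 ∧ 4 * η * K ^ 6 ≤ ε / (16 * C) ∧ 1 ≤ Λ ∧
      2 * K ^ 2 < Λ ∧ 1 ≤ m ∧ 2 * Λ ^ 2 / m * (K ^ 6 * (4 * K ^ 6 / η)) ≤ ε / (16 * C) := by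
  have hK0 : 0 < K := by linarith
  set η := min (1 / 2) (ε / (64 * C * K ^ 6)) with hη
  set Λ := 2 * K ^ 2 + 1 with hΛ
  have hη0 : 0 < η := by positivity
  set R := 2 * Λ ^ 2 * (K ^ 6 * (4 * K ^ 6 / η)) / (ε / (16 * C)) with hR
  refine ⟨η, Λ, ⌈R⌉₊ + 1, hη0, min_le_left _ _, ?_, by nlinarith [sq_nonneg K], by linarith,
    by omega, ?_⟩
  · calc 4 * η * K ^ 6 ≤ 4 * (ε / (64 * C * K ^ 6)) * K ^ 6 := by gcongr; exact min_le_right _ _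
      _ = ε / (16 * C) := by field_simp; norm_num
  · have h1 : R ≤ ((⌈R⌉₊ + 1 : ℕ) : ℝ) := by
      push_cast
      linarith [Nat.le_ceil R]
    have h2 := (div_le_iff₀ (by positivity)).1 h1
    rw [div_mul_eq_mul_div, div_le_iff₀ (by positivity), mul_comm (ε / (16 * C))]
    exact h2

/-- The three cases at a point `q`: some derivative of `f^n` along the orbit is already large, or
some `Df^a` with `a < m` has a large distortion, or none has. -/
theorem isPerturbableAt {d : ℕ} (hd : 1 ≤ d) {M : Type*} [TopologicalSpace M] [T2Space M]
    [ChartedSpace (Euc d) M] [IsManifold (𝓡 d) ∞ M]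
    [RiemannianBundle (fun x : M => TangentSpace (𝓡 d) x)]
    [IsContMDiffRiemannianBundle (𝓡 d) 1 (Euc d) (fun x : M => TangentSpace (𝓡 d) x)]
    [IsContinuousRiemannianBundle (Euc d) (fun x : M => TangentSpace (𝓡 d) x)]
    (f : M ≃ₘ^1⟮𝓡 d, 𝓡 d⟯ M) {C K ε : ℝ} (hC : 0 < C) (hK : 1 ≤ K) (hε : 0 < ε)
    (hf : ∀ x : M, ‖mfderiv (𝓡 d) (𝓡 d) f x‖ ≤ C)
    (hf' : ∀ x : M, ‖mfderiv (𝓡 d) (𝓡 d) f.symm x‖ ≤ C) {η Λ : ℝ} {m : ℕ} (hη : 0 < η)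
    (hη1 : η ≤ 1 / 2) (hηε : 4 * η * K ^ 6 ≤ ε / (16 * C)) (hΛ : 1 ≤ Λ) (hΛK : 2 * K ^ 2 < Λ)
    (hm : 1 ≤ m) (hmε : 2 * Λ ^ 2 / m * (K ^ 6 * (4 * K ^ 6 / η)) ≤ ε / (16 * C)) {n N : ℕ}
    (hmn : m ≤ n) (hnN : 4 * n ≤ N) (q : M) : IsPerturbableAt f n N K ε q := by
  by_cases hn : ∀ j, j + n ≤ N → ∀ w, orbitNorm f q (j + n) w ≤ K * orbitNorm f q j w ∧
      orbitNorm f q j w ≤ K * orbitNorm f q (j + n) w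
  · by_cases hdist : ∃ a < m, ∃ w₀ v, 4 * K ^ 6 / η * (orbitNorm f q 0 w₀ * orbitNorm f q a v) <
        orbitNorm f q a w₀ * orbitNorm f q 0 v
    · obtain ⟨a, ha, w₀, v, h⟩ := hdist
      exact isPerturbableAt_of_distortion f q hC hε hK hnN (norm_tangentMap_le hf)
        (norm_tangentMap_le hf') hn hη hη1 hηε (ha.trans_le hmn) h
    · push Not at hdist
      have : Nonempty (Fin d) := ⟨⟨0, hd⟩⟩
      obtain ⟨v, hv⟩ := exists_ne (0 : Euc d)
      exact isPerturbableAt_of_bounded_distortion f q hC hε hK hnN (norm_tangentMap_le hf)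
        (norm_tangentMap_le hf') hn (by positivity) hΛ hΛK hm hmn hmε hv
        fun t ht w => hdist t ht v w
  · push Not at hn
    obtain ⟨j, hj, w, hw⟩ := hn
    refine isPerturbableAt_of_lt f q hε hj (w := w) ?_
    rcases le_or_gt (orbitNorm f q (j + n) w) (K * orbitNorm f q j w) with h | h
    · exact Or.inr (hw h)
    · exact Or.inl h

end Conclusion

theorem theoremB (d : ℕ) (hd : 1 ≤ d) (C K ε : ℝ) (hC : 0 < C) (hK : 0 < K) (hε : 0 < ε) :
    ∃ n₀ : ℕ, 1 ≤ n₀ ∧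
      ∀ (M : Type*) [EMetricSpace M] [CompactSpace M]
        [ChartedSpace (EuclideanSpace ℝ (Fin d)) M] [IsManifold (𝓡 d) ∞ M]
        [RiemannianBundle (fun x : M => TangentSpace (𝓡 d) x)]
        [IsContMDiffRiemannianBundle (𝓡 d) ∞ (EuclideanSpace ℝ (Fin d))
          (fun x : M => TangentSpace (𝓡 d) x)]
        [IsRiemannianManifold (𝓡 d) M]
        (f : M ≃ₘ^1⟮𝓡 d, 𝓡 d⟯ M),
        (∀ x : M, ‖mfderiv (𝓡 d) (𝓡 d) f x‖ < C) →
        (∀ x : M, ‖mfderiv (𝓡 d) (𝓡 d) f.symm x‖ < C) →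
        ∀ n N : ℕ, n₀ ≤ n → N = 2 ^ (d + 1) * n →
          ∃ ρ₀ : ℝ, 0 < ρ₀ ∧
            ∀ U : Set M, IsOpen U → Metric.ediam U < ENNReal.ofReal ρ₀ →
              (∀ i < N, ∀ j < N, i ≠ j →
                Disjoint (f^[i] '' closure U) (f^[j] '' closure U)) →
              (∀ x : M, ∃ m : ℤ, (f.toHomeomorph ^ m) x ∉ closure (iteratesUnion f U N)) →
              ∀ Δ : Set M, IsCompact Δ → Δ ⊆ U →
                ∃ g : M ≃ₘ^1⟮𝓡 d, 𝓡 d⟯ M,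
                  c1EDist f g < ENNReal.ofReal ε ∧
                  IsTidyPerturbation f.toHomeomorph g.toHomeomorph (iteratesUnion f U N) ∧
                  ∀ x ∈ Δ, ∃ j : ℕ, j ≤ N - n ∧
                    K < max ‖mfderiv (𝓡 d) (𝓡 d) (g^[n]) (g^[j] x)‖
                      ‖mfderiv (𝓡 d) (𝓡 d) (g.symm^[n]) (g^[j + n] x)‖ := by
  obtain ⟨η, Λ, m, hη, hη1, hηε, hΛ, hΛK, hm, hmε⟩ :=
    exists_shear_constants hC (le_max_right K 1) hε
  refine ⟨m, hm, fun M _ _ _ _ _ _ _ f hf hf' n N hmn hN => ?_⟩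
  have : IsContMDiffRiemannianBundle (𝓡 d) 1 (Euc d) (fun x : M => TangentSpace (𝓡 d) x) :=
    isContMDiffRiemannianBundle_one
  have : IsContinuousRiemannianBundle (Euc d) (fun x : M => TangentSpace (𝓡 d) x) :=
    isContinuousRiemannianBundle_of_contMDiff
  have hnN : 4 * n ≤ N := by
    rw [hN]
    exact Nat.mul_le_mul_right n (Nat.pow_le_pow_right (n := 2) two_pos (show 2 ≤ d + 1 by omega))
  choose W hWo hqW hW using isPerturbableAt hd f hC (le_max_right K 1) hε (fun x => (hf x).le)
    (fun x => (hf' x).le) hη hη1 hηε hΛ hΛK hm hmε hmn hnN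
  obtain ⟨ρ, hρ, hρW⟩ := lebesgue_number_lemma_of_emetric (isCompact_univ (X := M)) hWo
    fun x _ => mem_iUnion.2 ⟨x, hqW x⟩
  obtain ⟨ρ₀, hρ₀, hρ₀ρ⟩ := ENNReal.lt_iff_exists_nnreal_btwn.1 hρ
  refine ⟨ρ₀, by exact_mod_cast hρ₀, fun U hU hdiam hdisj hexit Δ hΔ hΔU => ?_⟩
  rw [ENNReal.ofReal_coe_nnreal] at hdiam
  rcases U.eq_empty_or_nonempty with rfl | ⟨x, hx⟩
  · refine ⟨f, ?_, isTidyPerturbation_self hexit, fun x hx => (hΔU hx).elim⟩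
    rw [c1EDist_self]
    exact ENNReal.ofReal_pos.2 hε
  · obtain ⟨q, hq⟩ := hρW x (mem_univ x)
    have hUW : U ⊆ W q := fun y hy =>
      hq ((Metric.edist_le_ediam_of_mem hy hx).trans_lt (hdiam.trans hρ₀ρ))
    obtain ⟨g, hg, hg', hgK⟩ := hW q U hUW hU hdisj hexit Δ hΔU hΔ
    refine ⟨g, hg, hg', fun x hx => ?_⟩
    obtain ⟨j, hj, hjK⟩ := hgK x hx
    exact ⟨j, hj, (le_max_left K 1).trans_lt hjK⟩
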